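/- **Setting.** Let $L,\tilde a>0$ with $L/\tilde a\in\mathbb N$. Indices $r,s,\alpha$ take the values $\pm$. For ${\bf k}=(k_+,k_-)\in\mathbb R^2$ let $k_s,k_{-s}$ be the components along the unit vectors ${\bf e}_s,{\bf e}_{-s}$. Put $$\Lambda_{1D}=\{x\in\tilde a\mathbb Z: -\tfrac L2\le x<\tfrac L2\},\qquad \Lambda_s^*=\{{\bf k}\in\tfrac{2\pi}{L}(\mathbb Z+\tfrac12)^2: -\tfrac{\pi}{\tilde a}\le k_{-s}<\tfrac{\pi}{\tilde a}\},$$ $$\hat\Lambda_s^*=\{{\bf p}\in\tfrac{2\pi}{L}\mathbb Z^2: -\tfrac{\pi}{\tilde a}\le p_{-s}<\tfrac{\pi}{\tilde a},\ p_s\ne0\},\qquad \tilde\Lambda_{1D}^*=\{p\in\tfrac{2\pi}L\mathbb Z:-\tfrac{\pi}{\tilde a}\le p<\tfrac{\pi}{\tilde a}\}.$$ Let $\mathcal F$ be the fermion Fock space with normalized Dirac vacuum $\Omega$ and fermion operators $c_{r,s,x,\alpha}(k)$, $x\in\Lambda_{1D}$, $k\in\frac{2\pi}L(\mathbb Z+\frac12)$,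 satisfying the canonical anticommutation relations and $c_{r,s,x,\alpha}(k)\Omega=c_{r,s,x,\alpha}(-k)^\dagger\Omega=0$ for $rk>0$; $\mathcal F$ has an orthonormal basis consisting, up to signs, of the vectors obtained by applying to $\Omega$ finitely many distinct operators among the $c(k)^\dagger$ with $rk>0$ and the $c(k)$ with $rk<0$. Let $\mathcal D\subset\mathcal F$ be the linear span of this basis (a dense subspace). All unbounded operators below, and their adjoints, are defined on $\mathcal D$ and map it to itself, and relations between them are identities on $\mathcal D$. Define, for ${\bf k}\in\Lambda_s^*$, $$\hat\psi_{r,s,\alpha}({\bf k})=\frac{L}{2\pi}\sqrt{\frac{\tilde a}{L}}\sum_{x\in\Lambda_{1D}}c_{r,s,x,\alpha}(k_s)\,e^{-ik_{-s}x},$$ and, with $\sigma^0$ the unit matrix, $\sigma^3=\mathrm{diag}(1,-1)$, $:\!\mathcal O\!:\,=\mathcal O-\langle\Omega,\mathcal O\Omega\rangle$, ${\bf p}\in\frac{2\pi}L\mathbb Z^2$ and $\mu=0,3$, $$\hat J^\mu_{r,s}({\bf p})=\sum_{\alpha,\beta}\ \sum_{{\bf k}_1,{\bf k}_2\in\Lambda_s^*}\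 \sum_{n\in\mathbb Z}\Bigl(\frac{2\pi}L\Bigr)^2:\!\hat\psi_{r,s,\alpha}^\dagger({\bf k}_1)\sigma^\mu_{\alpha\beta}\hat\psi_{r,s,\beta}({\bf k}_2)\!:\ \delta_{{\bf k}_1+{\bf p},\,{\bf k}_2+2\pi n{\bf e}_{-s}/\tilde a},\qquad \hat J_{r,s,\alpha}=\tfrac12\bigl(\hat J^0_{r,s}+\alpha\hat J^3_{r,s}\bigr).$$ The boson operators are, for ${\bf p}\in\hat\Lambda_s^*$, $$b_{s,\alpha}({\bf p})=-\frac iL\sqrt{\frac{2\pi\tilde a}{|p_s|}}\,\hat J_{+,s,\alpha}({\bf p})\ \text{ if }p_s>0,\qquad b_{s,\alpha}({\bf p})=\frac iL\sqrt{\frac{2\pi\tilde a}{|p_s|}}\,\hat J_{-,s,\alpha}({\bf p})\ \text{ if }p_s<0,$$ and the zero modes are, for $x\in\Lambda_{1D}$, $$N_{r,s,\alpha}(x)=\sqrt{2\pi\tilde a}\sum_{p\in\tilde\Lambda_{1D}^*}\frac1L\,\hat N_{r,s,\alpha}(p)\,e^{ipx},\qquad \hat N_{r,s,\alpha}(p_{-s})=\sqrt{\frac{\tilde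 a}{2\pi}}\;\hat J_{r,s,\alpha}({\bf p})\Big|_{p_s=0}.$$ **Lemma.** **(a)** There exist unitary operators $R_{r,s,\alpha}(x)$ on $\mathcal F$ (indexed by $r,s,\alpha=\pm$, $x\in\Lambda_{1D}$), mapping $\mathcal D$ onto itself, commuting with all $b_{s',\alpha'}({\bf p})$ and $b_{s',\alpha'}({\bf p})^\dagger$, and satisfying $$[N_{r,s,\alpha}(x),R_{r',s',\alpha'}(x')]=r\,\delta_{r,r'}\delta_{s,s'}\delta_{\alpha,\alpha'}\delta_{x,x'}R_{r,s,\alpha}(x),\qquad \{R_{r,s,\alpha}(x),R_{r',s',\alpha'}(x')^\dagger\}=2\,\delta_{r,r'}\delta_{s,s'}\delta_{\alpha,\alpha'}\delta_{x,x'}.$$ Moreover, for every such family, and for every fixed ordering of the product of the (anticommuting) operators $R$ below: **(b)** Let $\mathcal Q$ be the set of all pairs $({\bf n},\boldsymbol\nu)$ of families of integers $n_{s,\alpha}({\bf p})\ge0$ ($s,\alpha=\pm$, ${\bf p}\in\hat\Lambda_s^*$) and $\nu_{r,s,\alpha}(x)\in\mathbb Z$ ($r,s,\alpha=\pm$, $x\in\Lambda_{1D}$)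 with $$\sum_{r,s,\alpha}\sum_x\nu_{r,s,\alpha}(x)^2<\infty,\qquad \sum_{s,\alpha}\sum_{{\bf p}\in\hat\Lambda_s^*}|p_s|\,n_{s,\alpha}({\bf p})<\infty.$$ Then the states $$\eta_{{\bf n},\boldsymbol\nu}=\Bigl(\prod_{\alpha,s=\pm}\ \prod_{{\bf p}\in\hat\Lambda_s^*}\frac{b_{s,\alpha}^\dagger({\bf p})^{n_{s,\alpha}({\bf p})}}{\sqrt{n_{s,\alpha}({\bf p})!}}\Bigr)\Bigl(\prod_{\alpha,r,s=\pm}\ \prod_{x\in\Lambda_{1D}}R_{r,s,\alpha}(x)^{\nu_{r,s,\alpha}(x)}\Bigr)\Omega,\qquad({\bf n},\boldsymbol\nu)\in\mathcal Q,$$ form a complete orthonormal basis of $\mathcal F$. **(c)** Each $\eta_{{\bf n},\boldsymbol\nu}$ is a common eigenvector of all operators $N_{r,s,\alpha}(x)$ and $b_{s,\alpha}^\dagger({\bf p})b_{s,\alpha}({\bf p})$, with eigenvalues $r\,\nu_{r,s,\alpha}(x)$ and $n_{s,\alpha}({\bf p})$, respectively. -/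

import Mathlib

noncomputable section

namespace Fock

/-!
### Fermion Fock space over a linearly ordered set of modes, in the occupation number representation

The Fock space is `ℓ²` of the set of all finite sets `S` of modes; the orthonormal vector labelled by
`S` is the state in which exactly the modes of `S` are excited. The vectors with finitely many
non-zero components form the dense core, a common invariant domain of all unbounded operators below.
-/

/-- The dense subspace of the Fock space spanned by the occupation number states. -/
abbrev Core (ι : Type) : Type := Finset ι →₀ ℂ

/-- The fermion Fock space (a Hilbert space). -/
abbrev Space (ι : Type) : Type := lp (fun _ : Finset ι => ℂ) 2

/-- The occupation number state in which exactly the modes in `S` are excited. -/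
def ket {ι : Type} (S : Finset ι) : Core ι := Finsupp.single S 1

/-- The normalized vacuum state. -/
def vacuum {ι : Type} : Core ι := ket ∅

/-- The inclusion of the core in the Fock space. -/
def toSpace {ι : Type} : Core ι →ₗ[ℂ] Space ι :=
  Finsupp.linearCombination ℂ fun S =>
    open Classical in (lp.single 2 S (1 : ℂ) : lp (fun _ : Finset ι => ℂ) 2)

/-- The Jordan-Wigner sign: `-1` to the power of the number of excited modes preceding `i`. -/
def sign {ι : Type} [LinearOrder ι] (i : ι) (S : Finset ι) : ℂ := (-1) ^ (S.filter (· < i)).card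

/-- The operator removing an excitation of the mode `i`. -/
def annihilate {ι : Type} [LinearOrder ι] (i : ι) : Module.End ℂ (Core ι) :=
  Finsupp.linearCombination ℂ fun S => if i ∈ S then sign i S • ket (S.erase i) else 0

/-- The operator adding an excitation of the mode `i`, the adjoint of `annihilate i`. -/
def create {ι : Type} [LinearOrder ι] (i : ι) : Module.End ℂ (Core ι) :=
  Finsupp.linearCombination ℂ fun S => if i ∈ S then 0 else sign i S • ket (insert i S)

/-- The vacuum expectation value `⟨Ω, T Ω⟩`. -/
def vev {ι : Type} (T : Module.End ℂ (Core ι)) : ℂ :=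
  inner ℂ (toSpace (vacuum : Core ι)) (toSpace (T vacuum))

/-- Fermion normal ordering `:T: = T - ⟨Ω, T Ω⟩` of a fermion bilinear `T`. -/
def normalOrder {ι : Type} (T : Module.End ℂ (Core ι)) : Module.End ℂ (Core ι) :=
  T - vev T • (1 : Module.End ℂ (Core ι))

/-- A unitary operator on the Fock space that maps the core onto itself, together with its
restriction to the core. -/
structure CoreUnitary (ι : Type) where
  /-- the unitary operator -/
  op : unitary (Space ι →L[ℂ] Space ι)
  /-- its restriction to the core -/
  onCore : Core ι ≃ₗ[ℂ] Core ι
  op_toSpace : ∀ v : Core ι, (op : Space ι →L[ℂ] Space ι) (toSpace v) = toSpace (onCore v)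

/-- The restriction of a `CoreUnitary` to the core, as an endomorphism of the core. -/
def CoreUnitary.toEnd {ι : Type} (U : CoreUnitary ι) : Module.End ℂ (Core ι) := U.onCore.toLinearMap

end Fock

namespace Nodal

open Fock

/-!
### Nodal fermions

`L > 0` is the system size and `a > 0` the lattice constant `ã`, with `L / a` a positive integer.
The indices `r`, `s`, `α` take the values `±`, i.e. `±1 : ℤˣ`. A vector of `ℝ²` is given by its
components `k s`, `s = ±`, in the directions `e₊` and `e₋`.
-/

/-- `Λ_1D`. -/
def lattice (L a : ℝ) : Set ℝ :=
  {x | (∃ j : ℤ, x = a * j) ∧ -(L / 2) ≤ x ∧ x < L / 2}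

/-- The 1D fermion momenta `(2π/L)(ℤ + 1/2)`. -/
def fermiMomenta (L : ℝ) : Set ℝ := {k | ∃ j : ℤ, k = 2 * Real.pi / L * (j + 1 / 2)}

/-- The nodal fermion momenta `Λ_s^*`. -/
def nodalMomenta (L a : ℝ) (s : ℤˣ) : Set (ℤˣ → ℝ) :=
  {k | (∀ t, k t ∈ fermiMomenta L) ∧ -(Real.pi / a) ≤ k (-s) ∧ k (-s) < Real.pi / a}

/-- The boson momenta `p ∈ (2π/L)ℤ²` with `-π/ã ≤ p_{-s} < π/ã` and `p_s ≠ 0`. -/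
def bosonMomenta (L a : ℝ) (s : ℤˣ) : Set (ℤˣ → ℝ) :=
  {p | (∀ t, ∃ j : ℤ, p t = 2 * Real.pi / L * j) ∧
    (-(Real.pi / a) ≤ p (-s) ∧ p (-s) < Real.pi / a) ∧ p s ≠ 0}

/-- The 1D momenta `p ∈ (2π/L)ℤ` with `-π/ã ≤ p < π/ã`. -/
def zeroModeMomenta (L a : ℝ) : Set ℝ :=
  {p | (∃ j : ℤ, p = 2 * Real.pi / L * j) ∧ -(Real.pi / a) ≤ p ∧ p < Real.pi / a}

/-- The flavor indices `(r, s, α, x)`. -/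
@[ext] structure Flavor (L a : ℝ) where
  r : ℤˣ
  s : ℤˣ
  α : ℤˣ
  x : lattice L a

/-- The one-particle modes: a flavor and a 1D momentum. -/
@[ext] structure Mode (L a : ℝ) where
  flavor : Flavor L a
  k : fermiMomenta L

/-- The lexicographic ordering of the modes (used only for the Jordan-Wigner signs). -/
instance (L a : ℝ) : LinearOrder (Mode L a) :=
  LinearOrder.lift' (fun m : Mode L a => toLex (m.flavor.r, toLex (m.flavor.s, toLex (m.flavor.α,
      toLex ((m.flavor.x : ℝ), (m.k : ℝ)))))) (by
    intro m m' h
    simp only [EmbeddingLike.apply_eq_iff_eq, Prod.mk.injEq, Subtype.coe_inj] at h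
    exact Mode.ext (Flavor.ext h.1 h.2.1 h.2.2.1 h.2.2.2.1) h.2.2.2.2)

/-- Operators on the core of the fermion Fock space of the nodal fermions. -/
abbrev Op (L a : ℝ) : Type := Module.End ℂ (Core (Mode L a))

/-- The fermion operator `c_{r,s,x,α}(k)`. Excitations of the Dirac sea are particles if `r k > 0`
and holes if `r k < 0`; so `c(k) Ω = 0` for `r k > 0` and `c(k)† Ω = 0` for `r k < 0`. -/
def c {L a : ℝ} (m : Mode L a) : Op L a :=
  if 0 < ((m.flavor.r : ℤ) : ℝ) * m.k then annihilate m else create m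

/-- The fermion operator `c_{r,s,x,α}(k)†`. -/
def cDag {L a : ℝ} (m : Mode L a) : Op L a :=
  if 0 < ((m.flavor.r : ℤ) : ℝ) * m.k then create m else annihilate m

/-- `ψ_{r,s,α}(k) = (L/2π) √(ã/L) ∑_x c_{r,s,x,α}(k_s) exp(-i k_{-s} x)`. -/
def ψ {L a : ℝ} (r s α : ℤˣ) (k : nodalMomenta L a s) : Op L a :=
  ((L / (2 * Real.pi) * √(a / L) : ℝ) : ℂ) • ∑ᶠ x : lattice L a,
    Complex.exp (-(Complex.I * (k.1 (-s) : ℂ) * (x : ℂ))) • c ⟨⟨r, s, α, x⟩, ⟨k.1 s, k.2.1 s⟩⟩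

/-- `ψ_{r,s,α}(k)†`. -/
def ψDag {L a : ℝ} (r s α : ℤˣ) (k : nodalMomenta L a s) : Op L a :=
  ((L / (2 * Real.pi) * √(a / L) : ℝ) : ℂ) • ∑ᶠ x : lattice L a,
    Complex.exp (Complex.I * (k.1 (-s) : ℂ) * (x : ℂ)) • cDag ⟨⟨r, s, α, x⟩, ⟨k.1 s, k.2.1 s⟩⟩

/-- `∑_{α,β} (2π/L)² σ_{α,β} :ψ_{r,s,α}(k₁)† ψ_{r,s,β}(k₂):`. -/
def bilinear {L a : ℝ} (σ : ℤˣ → ℤˣ → ℂ) (r s : ℤˣ) (k₁ k₂ : nodalMomenta L a s) : Op L a :=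
  ∑ α : ℤˣ, ∑ β : ℤˣ, (((2 * Real.pi / L) ^ 2 : ℝ) * σ α β : ℂ) •
    normalOrder (ψDag r s α k₁ * ψ r s β k₂)

/-- The triples `(k₁, k₂, n)` with `k₁ + p = k₂ + 2π n e_{-s} / ã`. -/
def transfer (L a : ℝ) (s : ℤˣ) (p : ℤˣ → ℝ) :
    Set (nodalMomenta L a s × nodalMomenta L a s × ℤ) :=
  {t | t.1.1 + p = t.2.1.1 + Pi.single (-s) (2 * Real.pi * t.2.2 / a)}

/-- The nodal density- and spin operator
`∑_{α,β} ∑_{k₁,k₂} ∑_n (2π/L)² :ψ_{r,s,α}(k₁)† σ_{α,β} ψ_{r,s,β}(k₂): δ(k₁ + p, k₂ + 2π n e_{-s}/ã)`.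
Only finitely many terms do not vanish on a given occupation number state. -/
def J {L a : ℝ} (σ : ℤˣ → ℤˣ → ℂ) (r s : ℤˣ) (p : ℤˣ → ℝ) : Op L a :=
  Finsupp.linearCombination ℂ fun S =>
    ∑ᶠ t : transfer L a s p, bilinear σ r s t.1.1 t.1.2.1 (ket S)

/-- The adjoint of `J σ r s p` for a hermitian matrix `σ`: the sum of the adjoint terms. -/
def JDag {L a : ℝ} (σ : ℤˣ → ℤˣ → ℂ) (r s : ℤˣ) (p : ℤˣ → ℝ) : Op L a :=
  Finsupp.linearCombination ℂ fun S =>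
    ∑ᶠ t : transfer L a s p, bilinear σ r s t.1.2.1 t.1.1 (ket S)

/-- The unit matrix `σ⁰`. -/
def σ₀ (α β : ℤˣ) : ℂ := if α = β then 1 else 0

/-- The Pauli matrix `σ³`. -/
def σ₃ (α β : ℤˣ) : ℂ := if α = β then ((α : ℤ) : ℂ) else 0

/-- The spin-dependent density `J_{r,s,α}(p) = (J⁰_{r,s}(p) + α J³_{r,s}(p)) / 2`. -/
def density {L a : ℝ} (r s α : ℤˣ) (p : ℤˣ → ℝ) : Op L a :=
  (1 / 2 : ℂ) • (J σ₀ r s p + ((α : ℤ) : ℂ) • J σ₃ r s p)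

/-- `J_{r,s,α}(p)†`. -/
def densityDag {L a : ℝ} (r s α : ℤˣ) (p : ℤˣ → ℝ) : Op L a :=
  (1 / 2 : ℂ) • (JDag σ₀ r s p + ((α : ℤ) : ℂ) • JDag σ₃ r s p)

/-- The indices `(s, α, p)` of the 2D boson operators. -/
@[ext] structure BosonMode (L a : ℝ) where
  s : ℤˣ
  α : ℤˣ
  p : bosonMomenta L a s

/-- The component `p_s`. -/
def BosonMode.ps {L a : ℝ} (m : BosonMode L a) : ℝ := m.p.1 m.s

/-- The boson annihilation operator `b_{s,α}(p)`. -/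
def b {L a : ℝ} (m : BosonMode L a) : Op L a :=
  if 0 < m.ps then
    (-(Complex.I / (L : ℂ)) * (√(2 * Real.pi * a / |m.ps|) : ℝ)) • density 1 m.s m.α m.p
  else
    ((Complex.I / (L : ℂ)) * (√(2 * Real.pi * a / |m.ps|) : ℝ)) • density (-1) m.s m.α m.p

/-- The boson creation operator `b_{s,α}(p)†`. -/
def bDag {L a : ℝ} (m : BosonMode L a) : Op L a :=
  if 0 < m.ps then
    ((Complex.I / (L : ℂ)) * (√(2 * Real.pi * a / |m.ps|) : ℝ)) • densityDag 1 m.s m.α m.p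
  else
    (-(Complex.I / (L : ℂ)) * (√(2 * Real.pi * a / |m.ps|) : ℝ)) • densityDag (-1) m.s m.α m.p

/-- `√(ã/2π) J_{r,s,α}(p)` at the momentum `p` with `p_s = 0` and `p_{-s} = q`. -/
def zeroModeHat {L a : ℝ} (r s α : ℤˣ) (q : ℝ) : Op L a :=
  ((√(a / (2 * Real.pi)) : ℝ) : ℂ) • density r s α (Pi.single (-s) q)

/-- The zero mode `N_{r,s,α}(x) = √(2πã) ∑_p (1/L) N_{r,s,α}(p) exp(i p x)`. -/
def zeroMode {L a : ℝ} (f : Flavor L a) : Op L a :=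
  ((√(2 * Real.pi * a) : ℝ) : ℂ) • ∑ᶠ q : zeroModeMomenta L a,
    ((1 / L : ℂ) * Complex.exp (Complex.I * (q : ℂ) * (f.x : ℂ))) • zeroModeHat f.r f.s f.α q

/-- The Klein factor relations: `R_{r,s,α}(x)` are unitary operators commuting with all boson
operators, with `[N, R'] = r δ R` and `{R, R'†} = 2 δ`. -/
structure IsKleinFamily {L a : ℝ} (R : Flavor L a → CoreUnitary (Mode L a)) : Prop where
  commute_b : ∀ f m, Commute (b m) (R f).toEnd
  commute_bDag : ∀ f m, Commute (bDag m) (R f).toEnd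
  zeroMode_commutator : ∀ f f' : Flavor L a,
    zeroMode f * (R f').toEnd - (R f').toEnd * zeroMode f =
      open Classical in if f = f' then ((f.r : ℤ) : ℂ) • (R f).toEnd else 0
  anticommutator : ∀ f f' : Flavor L a,
    ((R f).op : Space (Mode L a) →L[ℂ] Space (Mode L a)) * star ((R f').op : _ →L[ℂ] _) +
      star ((R f').op : Space (Mode L a) →L[ℂ] Space (Mode L a)) * ((R f).op : _ →L[ℂ] _) =
      open Classical in if f = f' then 2 else 0

/-- The set of pairs `(n, ν)` with `∑ ν² < ∞` and `∑ |p_s| n_{s,α}(p) < ∞`. -/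
def occupations (L a : ℝ) : Set ((BosonMode L a → ℕ) × (Flavor L a → ℤ)) :=
  {q | Summable (fun f => (q.2 f : ℝ) ^ 2) ∧ Summable fun m => |m.ps| * (q.1 m : ℝ)}

/-- `∏ (b_{s,α}(p)†) ^ n_{s,α}(p) / √(n_{s,α}(p)!)` over the (finitely many, for the `n` considered)
boson modes with `n_{s,α}(p) ≠ 0`. These factors commute, so their order is irrelevant. -/
def bosonProduct {L a : ℝ} (n : BosonMode L a → ℕ) : Op L a :=
  open Classical in
  if h : (Function.support n).Finite then
    (h.toFinset.toList.map fun m =>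
      ((1 / √((n m).factorial : ℝ) : ℝ) : ℂ) • (bDag m) ^ n m).prod
  else 0

/-- The state `η_{n,ν}`; the Klein factors, which anticommute, are multiplied in the order given by
the list `o` of all flavors. -/
def η {L a : ℝ} (R : Flavor L a → CoreUnitary (Mode L a)) (o : List (Flavor L a))
    (n : BosonMode L a → ℕ) (ν : Flavor L a → ℤ) : Core (Mode L a) :=
  bosonProduct n ((o.map fun f => (R f).onCore ^ ν f).prod vacuum)

end Nodal

/-!
### Consistency of the definitions

Proved below: the canonical anticommutation relations, the finiteness of the sums defining `J` and
`JDag` on every occupation number state, and the fact that `bDag m` is the adjoint of `b m`.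
-/

namespace Fock

theorem annihilate_ket {ι : Type} [LinearOrder ι] (i : ι) (S : Finset ι) :
    annihilate i (ket S) = if i ∈ S then sign i S • ket (S.erase i) else 0 := by
  simp [annihilate, ket]

theorem create_ket {ι : Type} [LinearOrder ι] (i : ι) (S : Finset ι) :
    create i (ket S) = if i ∈ S then 0 else sign i S • ket (insert i S) := by
  simp [create, ket]

theorem ext_ket {ι : Type} {M : Type} [AddCommMonoid M] [Module ℂ M] {T T' : Core ι →ₗ[ℂ] M}
    (h : ∀ S, T (ket S) = T' (ket S)) : T = T' :=
  Finsupp.lhom_ext' fun S => LinearMap.ext_ring (h S)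

theorem sign_insert {ι : Type} [LinearOrder ι] (i j : ι) (S : Finset ι) (hj : j ∉ S) :
    sign i (insert j S) = (if j < i then -1 else 1) * sign i S := by
  unfold sign
  rw [Finset.filter_insert]
  split_ifs with h
  · rw [Finset.card_insert_of_notMem (by simp [hj]), pow_succ]; ring
  · simp

theorem sign_mul_self {ι : Type} [LinearOrder ι] (i : ι) (S : Finset ι) :
    sign i S * sign i S = 1 := by
  unfold sign
  rw [← mul_pow]; simp

/-- The canonical anticommutation relations. -/
theorem anticomm {ι : Type} [LinearOrder ι] (i j : ι) :
    annihilate i * create j + create j * annihilate i =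
      (if i = j then 1 else 0 : Module.End ℂ (Core ι)) := by
  refine ext_ket fun S => ?_
  simp only [LinearMap.add_apply, Module.End.mul_apply]
  by_cases hij : i = j
  · subst hij
    by_cases hi : i ∈ S
    · have h1 : sign i (S.erase i) = sign i S := by
        conv_rhs => rw [← Finset.insert_erase hi, sign_insert _ _ _ (by simp)]
        simp
      simp [annihilate_ket, create_ket, hi, h1, smul_smul, sign_mul_self]
    · simp [annihilate_ket, create_ket, hi, sign_insert, smul_smul, sign_mul_self]
  · rw [if_neg hij, create_ket, annihilate_ket]
    by_cases hi : i ∈ S <;> by_cases hj : j ∈ S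
    · simp [hi, hj, create_ket, Ne.symm hij]
    · simp only [hi, hj, if_true, if_false, map_smul, annihilate_ket, create_ket,
        Finset.mem_insert, Finset.mem_erase, or_true, and_false, smul_smul]
      have h1 : sign j S = (if i < j then -1 else 1) * sign j (S.erase i) := by
        conv_lhs => rw [← Finset.insert_erase hi, sign_insert _ _ _ (by simp)]
      rw [sign_insert _ _ _ hj, h1, Finset.erase_insert_of_ne (Ne.symm hij)]
      rcases lt_or_gt_of_ne hij with h | h
      · simp [h, h.not_gt, mul_comm]
      · simp [h, h.not_gt, mul_comm]
    · simp [hi, hj]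
    · simp [hi, hj, annihilate_ket, hij]

/-- `T'` is the adjoint of `T` on the core. -/
def IsAdj {ι : Type} (T T' : Module.End ℂ (Core ι)) : Prop :=
  ∀ v w, inner ℂ (toSpace (T' v)) (toSpace w) = inner ℂ (toSpace v) (toSpace (T w))

theorem inner_ket {ι : Type} (S T : Finset ι) [Decidable (S = T)] :
    inner ℂ (toSpace (ket S)) (toSpace (ket T)) = if S = T then (1 : ℂ) else 0 := by
  classical
  simp only [toSpace, ket, Finsupp.linearCombination_single, one_smul]
  rw [lp.inner_single_left]
  simp [lp.single_apply, Pi.single_apply]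

theorem isAdj_of_ket {ι : Type} {T T' : Module.End ℂ (Core ι)}
    (h : ∀ S U, inner ℂ (toSpace (T' (ket S))) (toSpace (ket U)) =
      inner ℂ (toSpace (ket S)) (toSpace (T (ket U)))) : IsAdj T T' := by
  intro v w
  induction v using Finsupp.induction_linear with
  | zero => simp
  | add v v' hv hv' => simp only [map_add, inner_add_left, hv, hv']
  | single S x =>
    have e : Finsupp.single S x = x • ket S := by simp [ket]
    simp only [e, map_smul, inner_smul_left]
    congr 1
    induction w using Finsupp.induction_linear with
    | zero => simp
    | add v v' hv hv' => simp only [map_add, inner_add_right, hv, hv']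
    | single U y =>
      have e : Finsupp.single U y = y • ket U := by simp [ket]
      simp only [e, map_smul, inner_smul_right, h]

theorem IsAdj.symm {ι : Type} {T T' : Module.End ℂ (Core ι)} (h : IsAdj T T') : IsAdj T' T := by
  intro v w
  have := congrArg (starRingEnd ℂ) (h w v)
  simpa using this.symm

theorem IsAdj.smul {ι : Type} {T T' : Module.End ℂ (Core ι)} (h : IsAdj T T') (x : ℂ) :
    IsAdj (x • T) (starRingEnd ℂ x • T') := by
  intro v w
  simp only [LinearMap.smul_apply, map_smul, inner_smul_left, inner_smul_right, h v w,
    Complex.conj_conj]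

theorem IsAdj.add {ι : Type} {T T' U U' : Module.End ℂ (Core ι)} (h : IsAdj T T')
    (h' : IsAdj U U') : IsAdj (T + U) (T' + U') := by
  intro v w
  simp only [LinearMap.add_apply, map_add, inner_add_left, inner_add_right, h v w, h' v w]

theorem IsAdj.mul {ι : Type} {T T' U U' : Module.End ℂ (Core ι)} (h : IsAdj T T')
    (h' : IsAdj U U') : IsAdj (T * U) (U' * T') := by
  intro v w
  simp [h _ _, h' _ _]

theorem IsAdj.one {ι : Type} : IsAdj (1 : Module.End ℂ (Core ι)) 1 := fun _ _ => rfl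

theorem IsAdj.sum {ι κ : Type} (s : Finset κ) (T T' : κ → Module.End ℂ (Core ι))
    (h : ∀ i, IsAdj (T i) (T' i)) : IsAdj (∑ i ∈ s, T i) (∑ i ∈ s, T' i) := by
  classical
  induction s using Finset.induction_on with
  | empty => intro v w; simp
  | insert a s ha ih => rw [Finset.sum_insert ha, Finset.sum_insert ha]; exact (h a).add ih

theorem IsAdj.vev {ι : Type} {T T' : Module.End ℂ (Core ι)} (h : IsAdj T T') :
    vev T' = starRingEnd ℂ (vev T) := by
  unfold Fock.vev
  rw [← h, inner_conj_symm]

theorem IsAdj.normalOrder {ι : Type} {T T' : Module.End ℂ (Core ι)} (h : IsAdj T T') :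
    IsAdj (normalOrder T) (normalOrder T') := by
  unfold Fock.normalOrder
  rw [h.vev]
  intro v w
  have := IsAdj.one.smul (Fock.vev T) v w
  simp only [LinearMap.sub_apply, map_sub, inner_sub_left, inner_sub_right, h v w, this]

theorem isAdj_create {ι : Type} [LinearOrder ι] (i : ι) : IsAdj (annihilate i) (create i) := by
  refine isAdj_of_ket fun S U => ?_
  rw [annihilate_ket, create_ket]
  have hs : ∀ S : Finset ι, starRingEnd ℂ (sign i S) = sign i S := by simp [sign]
  by_cases hi : i ∈ S <;> by_cases hu : i ∈ U
  · simp only [hi, hu, if_true, map_zero, inner_zero_left, map_smul, inner_smul_right, inner_ket]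
    rw [if_neg]; · simp
    rintro rfl; simp at hi
  · simp [hi, hu]
  · simp only [hi, hu, if_true, if_false, map_smul, inner_smul_left, inner_smul_right, inner_ket]
    by_cases h : insert i S = U
    · subst h
      simp [hi, hs, sign_insert]
    · rw [if_neg h, if_neg]; · simp
      rintro rfl; exact h (Finset.insert_erase hu)
  · simp only [hi, hu, if_false, map_zero, inner_zero_right, map_smul, inner_smul_left, inner_ket]
    rw [if_neg]; · simp
    rintro rfl; simp at hu

end Fock

namespace Nodal
open Fock

theorem isAdj_c {L a : ℝ} (m : Mode L a) : IsAdj (c m) (cDag m) := by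
  unfold c cDag
  split_ifs
  · exact isAdj_create m
  · exact (isAdj_create m).symm

theorem finite_lattice {L a : ℝ} (ha : 0 < a) : Finite (lattice L a) := by
  have : (lattice L a) ⊆ (fun j : ℤ => a * j) '' Set.Icc ⌊-(L/2)/a⌋ ⌈L/2/a⌉ := by
    rintro x ⟨⟨j, rfl⟩, h1, h2⟩
    refine ⟨j, ⟨?_, ?_⟩, rfl⟩
    · have : -(L/2)/a ≤ j := by rw [div_le_iff₀ ha]; linarith
      exact_mod_cast (Int.floor_le _).trans this
    · have : (j:ℝ) ≤ L/2/a := by rw [le_div_iff₀ ha]; linarith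
      exact_mod_cast this.trans (Int.le_ceil _)
  exact ((Set.finite_Icc _ _).image _).subset this

theorem isAdj_ψ {L a : ℝ} (ha : 0 < a) (r s α : ℤˣ) (k : nodalMomenta L a s) :
    IsAdj (ψ r s α k) (ψDag r s α k) := by
  have := finite_lattice (L := L) ha
  have := Fintype.ofFinite (lattice L a)
  unfold ψ ψDag
  rw [finsum_eq_sum_of_fintype, finsum_eq_sum_of_fintype]
  convert (IsAdj.sum Finset.univ _ _ fun x : lattice L a =>
    (isAdj_c ⟨⟨r, s, α, x⟩, ⟨k.1 s, k.2.1 s⟩⟩).smul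
      (Complex.exp (-(Complex.I * (k.1 (-s) : ℂ) * (x : ℂ))))).smul
    ((L / (2 * Real.pi) * √(a / L) : ℝ) : ℂ) using 2
  · exact (Complex.conj_ofReal _).symm
  · refine Finset.sum_congr rfl fun x _ => ?_
    rw [← Complex.exp_conj]
    simp

theorem isAdj_bilinear {L a : ℝ} (ha : 0 < a) (σ : ℤˣ → ℤˣ → ℂ)
    (hσ : ∀ α β, σ β α = starRingEnd ℂ (σ α β)) (r s : ℤˣ)
    (k₁ k₂ : nodalMomenta L a s) :
    IsAdj (bilinear σ r s k₁ k₂) (bilinear σ r s k₂ k₁) := by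
  unfold bilinear
  rw [Finset.sum_comm]
  refine IsAdj.sum _ _ _ fun α => IsAdj.sum _ _ _ fun β => ?_
  convert IsAdj.smul (((isAdj_ψ ha r s β k₁).symm.mul (isAdj_ψ ha r s α k₂)).normalOrder) _ using 2
  rw [hσ β α, map_mul, Complex.conj_ofReal]

theorem anticomm_ψ {L a : ℝ} (ha : 0 < a) (r s α β : ℤˣ) (k₁ k₂ : nodalMomenta L a s)
    (h1 : ((r : ℤ) : ℝ) * k₁.1 s < 0) (h2 : ((r : ℤ) : ℝ) * k₂.1 s < 0) :
    ∃ z : ℂ, ψDag r s α k₁ * ψ r s β k₂ = z • (1 : Op L a) - ψ r s β k₂ * ψDag r s α k₁ := by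
  have := finite_lattice (L := L) ha
  have := Fintype.ofFinite (lattice L a)
  have key : ∀ m m' : Mode L a, ((m.flavor.r : ℤ) : ℝ) * m.k < 0 →
      ((m'.flavor.r : ℤ) : ℝ) * m'.k < 0 → ∃ z : ℂ,
      cDag m * c m' + c m' * cDag m = z • (1 : Op L a) := by
    intro m m' h h'
    unfold c cDag
    rw [if_neg h.not_gt, if_neg h'.not_gt, anticomm]
    refine ⟨if m = m' then 1 else 0, ?_⟩
    split_ifs <;> simp
  have key' := fun x y : lattice L a => key ⟨⟨r, s, α, x⟩, ⟨k₁.1 s, k₁.2.1 s⟩⟩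
    ⟨⟨r, s, β, y⟩, ⟨k₂.1 s, k₂.2.1 s⟩⟩ h1 h2
  choose z hz using key'
  suffices h : ∃ z : ℂ, ψDag r s α k₁ * ψ r s β k₂ + ψ r s β k₂ * ψDag r s α k₁ =
      z • (1 : Op L a) from h.imp fun z hz => (eq_sub_iff_add_eq (G := Op L a)).2 hz
  unfold ψ ψDag
  rw [finsum_eq_sum_of_fintype, finsum_eq_sum_of_fintype]
  simp only [Finset.smul_sum, Finset.sum_mul_sum, smul_mul_smul_comm, smul_smul]
  rw [Finset.sum_comm (s := (Finset.univ : Finset (lattice L a)))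
    (f := fun y x => _ • (c _ * cDag _)), ← Finset.sum_add_distrib]
  simp only [← Finset.sum_add_distrib]
  refine ⟨∑ x : lattice L a, ∑ y : lattice L a, ((L / (2 * Real.pi) * √(a / L) : ℝ) : ℂ) *
    Complex.exp (Complex.I * (k₁.1 (-s) : ℂ) * (x : ℂ)) *
    (((L / (2 * Real.pi) * √(a / L) : ℝ) : ℂ) *
    Complex.exp (-(Complex.I * (k₂.1 (-s) : ℂ) * (y : ℂ)))) * z x y, ?_⟩
  simp only [Finset.sum_smul]
  refine Finset.sum_congr rfl fun x _ => Finset.sum_congr rfl fun y _ => ?_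
  rw [mul_smul _ (z x y) (1 : Op L a), ← hz, smul_add]
  congr 2
  ring

theorem ψ_ket {L a : ℝ} (ha : 0 < a) (r s α : ℤˣ) (k : nodalMomenta L a s)
    (h : 0 < ((r : ℤ) : ℝ) * k.1 s) (S : Finset (Mode L a)) (hS : ∀ m ∈ S, (m.k : ℝ) ≠ k.1 s) :
    ψ r s α k (ket S) = 0 := by
  have := finite_lattice (L := L) ha
  have := Fintype.ofFinite (lattice L a)
  unfold ψ
  rw [finsum_eq_sum_of_fintype]
  simp only [LinearMap.smul_apply, LinearMap.sum_apply]
  rw [Finset.sum_eq_zero, smul_zero]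
  intro x _
  unfold c
  rw [if_pos h, annihilate_ket, if_neg, smul_zero]
  intro hm
  exact hS _ hm rfl

theorem ψDag_ket {L a : ℝ} (ha : 0 < a) (r s α : ℤˣ) (k : nodalMomenta L a s)
    (h : ((r : ℤ) : ℝ) * k.1 s < 0) (S : Finset (Mode L a)) (hS : ∀ m ∈ S, (m.k : ℝ) ≠ k.1 s) :
    ψDag r s α k (ket S) = 0 := by
  have := finite_lattice (L := L) ha
  have := Fintype.ofFinite (lattice L a)
  unfold ψDag
  rw [finsum_eq_sum_of_fintype]
  simp only [LinearMap.smul_apply, LinearMap.sum_apply]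
  rw [Finset.sum_eq_zero, smul_zero]
  intro x _
  unfold cDag
  rw [if_neg h.not_gt, annihilate_ket, if_neg, smul_zero]
  intro hm
  exact hS _ hm rfl

theorem bilinear_ket {L a : ℝ} (ha : 0 < a) (σ : ℤˣ → ℤˣ → ℂ) (r s : ℤˣ)
    (k₁ k₂ : nodalMomenta L a s) (S : Finset (Mode L a)) (B : ℝ) (hB : 0 ≤ B)
    (hS : ∀ m ∈ S, |(m.k : ℝ)| ≤ B) (h : B + |k₁.1 s - k₂.1 s| < |k₂.1 s|) :
    bilinear σ r s k₁ k₂ (ket S) = 0 := by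
  have hr : (((r : ℤ) : ℝ) = 1) ∨ (((r : ℤ) : ℝ) = -1) := by
    rcases Int.units_eq_one_or r with rfl | rfl <;> simp
  have hk1 : B < |k₁.1 s| := by
    have := abs_sub_abs_le_abs_sub (k₂.1 s) (k₁.1 s)
    rw [abs_sub_comm] at this
    linarith
  have hk2 : B < |k₂.1 s| := lt_of_le_of_lt (by linarith [abs_nonneg (k₁.1 s - k₂.1 s)]) h
  have hS1 : ∀ m ∈ S, (m.k : ℝ) ≠ k₁.1 s := fun m hm e => by
    have := hS m hm; rw [e] at this; linarith
  have hS2 : ∀ m ∈ S, (m.k : ℝ) ≠ k₂.1 s := fun m hm e => by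
    have := hS m hm; rw [e] at this; linarith
  have habs : |((r : ℤ) : ℝ) * k₂.1 s| = |k₂.1 s| := by
    rcases hr with h | h <;> simp [h]
  unfold bilinear
  simp only [LinearMap.sum_apply, LinearMap.smul_apply]
  refine Finset.sum_eq_zero fun α _ => Finset.sum_eq_zero fun β _ => ?_
  convert smul_zero _
  unfold normalOrder vev
  by_cases hp : 0 < ((r : ℤ) : ℝ) * k₂.1 s
  · simp [ψ_ket ha r s β k₂ hp S hS2, vacuum, ψ_ket ha r s β k₂ hp ∅ (by simp)]
  · have h2 : ((r : ℤ) : ℝ) * k₂.1 s < 0 := by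
      refine lt_of_le_of_ne (not_lt.1 hp) fun e => ?_
      rw [e, abs_zero] at habs; linarith
    have h1 : ((r : ℤ) : ℝ) * k₁.1 s < 0 := by
      rw [abs_of_neg h2] at habs
      have : ((r : ℤ) : ℝ) * k₁.1 s - ((r : ℤ) : ℝ) * k₂.1 s ≤ |k₁.1 s - k₂.1 s| := by
        rw [← mul_sub]
        rcases hr with h | h <;> rw [h]
        · linarith [le_abs_self (k₁.1 s - k₂.1 s)]
        · linarith [neg_abs_le (k₁.1 s - k₂.1 s)]
      linarith
    obtain ⟨z, hz⟩ := anticomm_ψ ha r s α β k₁ k₂ h1 h2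
    have hv : inner ℂ (toSpace (ket (∅ : Finset (Mode L a)))) (toSpace (ket ∅)) = (1 : ℂ) := by
      rw [inner_ket]; simp
    rw [hz]
    simp only [LinearMap.sub_apply, LinearMap.smul_apply, Module.End.one_apply,
      Module.End.mul_apply, ψDag_ket ha r s α k₁ h1 S hS1, vacuum,
      ψDag_ket ha r s α k₁ h1 ∅ (by simp), map_zero, sub_zero, map_smul, inner_smul_right, hv,
      mul_one, sub_self]

theorem finite_momenta {L : ℝ} (hL : 0 < L) (B : ℝ) :
    {k : fermiMomenta L | |(k : ℝ)| ≤ B}.Finite := by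
  have hp : 0 < 2 * Real.pi / L := by positivity
  refine Set.Finite.of_finite_image (f := Subtype.val) ?_ Subtype.val_injective.injOn
  refine ((Set.finite_Icc ⌊-B / (2 * Real.pi / L) - 1/2⌋ ⌈B / (2 * Real.pi / L)⌉).image
    (fun j : ℤ => 2 * Real.pi / L * (j + 1 / 2))).subset ?_
  rintro _ ⟨⟨_, j, rfl⟩, h, rfl⟩
  simp only [Set.mem_ofPred_eq, abs_le] at h
  refine ⟨j, ⟨?_, ?_⟩, rfl⟩
  · have : -B / (2 * Real.pi / L) - 1/2 ≤ j := by
      rw [sub_le_iff_le_add, div_le_iff₀ hp]; linarith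
    exact_mod_cast (Int.floor_le _).trans this
  · have : (j:ℝ) ≤ B / (2 * Real.pi / L) := by rw [le_div_iff₀ hp]; nlinarith
    exact_mod_cast this.trans (Int.le_ceil _)

theorem finite_nodalMomenta {L a : ℝ} (hL : 0 < L) (s : ℤˣ) (B : ℝ) :
    {k : nodalMomenta L a s | |k.1 s| ≤ B}.Finite := by
  have hs : ∀ t : ℤˣ, t = s ∨ t = -s := fun t => by
    rcases Int.units_eq_one_or t with rfl | rfl <;> rcases Int.units_eq_one_or s with rfl | rfl <;>
      simp
  refine Set.Finite.of_injOn (f := fun k : nodalMomenta L a s => fun t : ℤˣ =>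
    (⟨k.1 t, k.2.1 t⟩ : fermiMomenta L)) (t := {f | ∀ t, f t ∈
      {k : fermiMomenta L | |(k : ℝ)| ≤ max B (Real.pi / a)}}) ?_ ?_
      (Set.Finite.pi' fun _ => finite_momenta hL _)
  · intro k hk t
    change |k.1 t| ≤ _
    rcases hs t with rfl | rfl
    · exact le_max_of_le_left hk
    · exact le_max_of_le_right (abs_le.2 ⟨k.2.2.1, k.2.2.2.le⟩)
  · intro k _ k' _ h
    ext t
    exact congrArg Subtype.val (congrFun h t)

theorem transfer_s {L a : ℝ} {s : ℤˣ} {p : ℤˣ → ℝ} (t : transfer L a s p) :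
    t.1.1.1 s - t.1.2.1.1 s = -p s := by
  have h := congrFun t.2 s
  have : s ≠ -s := by rcases Int.units_eq_one_or s with rfl | rfl <;> decide
  simp [this] at h
  linarith

theorem finite_transfer {L a : ℝ} (hL : 0 < L) (ha : 0 < a) (s : ℤˣ) (p : ℤˣ → ℝ) (B : ℝ) :
    {t : transfer L a s p | |t.1.1.1 s| ≤ B ∧ |t.1.2.1.1 s| ≤ B}.Finite := by
  refine Set.Finite.of_injOn (f := fun t => (t.1.1, t.1.2.1))
    (t := {k : nodalMomenta L a s | |k.1 s| ≤ B} ×ˢ {k : nodalMomenta L a s | |k.1 s| ≤ B})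
    (fun t h => Set.mk_mem_prod h.1 h.2) ?_
    ((finite_nodalMomenta hL s B).prod (finite_nodalMomenta hL s B))
  rintro ⟨⟨k, k', n⟩, h⟩ - ⟨⟨l, l', n'⟩, h'⟩ - e
  simp only [Prod.mk.injEq] at e
  obtain ⟨rfl, rfl⟩ := e
  have h1 := congrFun (h.symm.trans h') (-s)
  simp [Real.pi_ne_zero, ha.ne'] at h1
  subst h1
  rfl

/-- Only finitely many terms of `J σ r s p` do not vanish on a given occupation number state. -/
theorem finite_support_J {L a : ℝ} (hL : 0 < L) (ha : 0 < a) (σ : ℤˣ → ℤˣ → ℂ) (r s : ℤˣ)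
    (p : ℤˣ → ℝ) (S : Finset (Mode L a)) :
    (Function.support fun t : transfer L a s p => bilinear σ r s t.1.1 t.1.2.1 (ket S)).Finite ∧
    (Function.support fun t : transfer L a s p =>
      bilinear σ r s t.1.2.1 t.1.1 (ket S)).Finite := by
  obtain ⟨B, hB⟩ : ∃ B : ℝ, ∀ m ∈ S, |(m.k : ℝ)| ≤ B := by
    obtain ⟨B, hB⟩ := (S.image fun m => |(m.k : ℝ)|).exists_le
    exact ⟨B, fun m hm => hB _ (Finset.mem_image_of_mem _ hm)⟩
  have hm : ∀ m ∈ S, |(m.k : ℝ)| ≤ max B 0 := fun m h => le_max_of_le_left (hB m h)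
  constructor
  · refine (finite_transfer hL ha s p (max B 0 + |p s| + |p s|)).subset fun t ht => ?_
    have h1 := transfer_s t
    have h2 : |t.1.2.1.1 s| ≤ max B 0 + |p s| := by
      by_contra! h
      refine ht (bilinear_ket ha σ r s _ _ S _ (le_max_right _ _) hm ?_)
      rwa [h1, abs_neg]
    refine ⟨?_, h2.trans (by linarith [abs_nonneg (p s)])⟩
    rw [sub_eq_iff_eq_add'.1 h1]
    refine (abs_add_le _ _).trans ?_
    rw [abs_neg]; linarith
  · refine (finite_transfer hL ha s p (max B 0 + |p s| + |p s|)).subset fun t ht => ?_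
    have h1 := transfer_s t
    have h2 : |t.1.1.1 s| ≤ max B 0 + |p s| := by
      by_contra! h
      refine ht (bilinear_ket ha σ r s _ _ S _ (le_max_right _ _) hm ?_)
      rwa [abs_sub_comm, h1, abs_neg]
    refine ⟨h2.trans (by linarith [abs_nonneg (p s)]), ?_⟩
    have : t.1.2.1.1 s = t.1.1.1 s + p s := by linarith
    rw [this]
    refine (abs_add_le _ _).trans ?_
    linarith

theorem isAdj_J {L a : ℝ} (hL : 0 < L) (ha : 0 < a) (σ : ℤˣ → ℤˣ → ℂ)
    (hσ : ∀ α β, σ β α = starRingEnd ℂ (σ α β)) (r s : ℤˣ) (p : ℤˣ → ℝ) :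
    IsAdj (J (L := L) (a := a) σ r s p) (JDag σ r s p) := by
  refine isAdj_of_ket fun S U => ?_
  have hS := (finite_support_J hL ha σ r s p S).2
  have hU := (finite_support_J hL ha σ r s p U).1
  simp only [J, JDag, ket, Finsupp.linearCombination_single, one_smul] at hS hU ⊢
  rw [finsum_eq_sum_of_support_subset (s := hS.toFinset ∪ hU.toFinset) _ (by
      intro t ht; simp [Function.mem_support.1 ht]),
    finsum_eq_sum_of_support_subset (s := hS.toFinset ∪ hU.toFinset) _ (by
      intro t ht; simp [Function.mem_support.1 ht])]
  simp only [map_sum, sum_inner, inner_sum]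
  exact Finset.sum_congr rfl fun t _ => isAdj_bilinear ha σ hσ r s _ _ _ _

theorem isAdj_density {L a : ℝ} (hL : 0 < L) (ha : 0 < a) (r s α : ℤˣ) (p : ℤˣ → ℝ) :
    IsAdj (density (L := L) (a := a) r s α p) (densityDag r s α p) := by
  have h0 : ∀ α β, σ₀ β α = starRingEnd ℂ (σ₀ α β) := fun α β => by
    simp [σ₀, eq_comm, apply_ite]
  have h3 : ∀ α β, σ₃ β α = starRingEnd ℂ (σ₃ α β) := fun α β => by
    unfold σ₃
    by_cases h : α = β
    · subst h; simp
    · simp [h, Ne.symm h]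
  have := ((isAdj_J hL ha _ h0 r s p).add ((isAdj_J hL ha _ h3 r s p).smul ((α : ℤ) : ℂ))).smul
    (1 / 2 : ℂ)
  simpa [density, densityDag, Complex.conj_ofNat] using this

/-- `bDag m` is the adjoint of `b m` on the core. -/
theorem isAdj_b {L a : ℝ} (hL : 0 < L) (ha : 0 < a) (m : BosonMode L a) :
    IsAdj (b m) (bDag m) := by
  unfold b bDag
  split_ifs
  · convert (isAdj_density hL ha 1 m.s m.α m.p).smul _ using 2
    rw [map_mul, Complex.conj_ofReal]; simp [neg_div]
  · convert (isAdj_density hL ha (-1) m.s m.α m.p).smul _ using 2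
    rw [map_mul, Complex.conj_ofReal]; simp [neg_div]

/-- For `(n, ν)` in `occupations L a`, only finitely many `n_{s,α}(p)` do not vanish. -/
theorem finite_support_occupations {L a : ℝ} (hL : 0 < L) (q : occupations L a) :
    (Function.support q.1.1).Finite := by
  have hc : 0 < 2 * Real.pi / L := by positivity
  have h := q.2.2.tendsto_cofinite_zero.eventually (gt_mem_nhds hc)
  refine Set.Finite.subset h fun m hm => ?_
  obtain ⟨j, hj⟩ := m.p.2.1 m.s
  have hj' : m.ps = 2 * Real.pi / L * j := hj
  have h0 : m.ps ≠ 0 := m.p.2.2.2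
  have hj0 : j ≠ 0 := by rintro rfl; simp [hj'] at h0
  have h1 : (1 : ℝ) ≤ |(j : ℝ)| := by exact_mod_cast Int.one_le_abs hj0
  have h2 : (1 : ℝ) ≤ q.1.1 m := by exact_mod_cast Nat.one_le_iff_ne_zero.2 hm
  simp only [Set.mem_compl_iff, Set.mem_ofPred_eq, not_lt, hj', abs_mul, abs_of_pos hc]
  nlinarith [mul_le_mul h1 h2 zero_le_one (abs_nonneg _)]

end Nodal
end

set_option linter.unusedSectionVars false

noncomputable section

/-! ### Core vectors and uniqueness of adjoints on the core -/

namespace Fock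

variable {F ι : Type}

/-! The theorem is bosonization of finitely many flavors of chiral fermions. For a fixed flavor `f =
(r, s, α, x)` the modes with `r k = (2π/L)(j + 1/2)`, `j : ℤ`, form one chiral branch whose levels
`j < 0` are filled in the vacuum. In the nodal density the sum over `k_{-s}` yields a Kronecker
delta in the lattice points, and umklapp phases are trivial there. Hence `J_{r,s,α}(p)` is the
Fourier sum `∑ exp(-i p_{-s} x) ρ_f(n)` over `x` of one-dimensional densities, with `p_s = r 2πn/L`
(`density_eq`), and everything reduces to the operators `ρ_f(n)`.

The densities generate a Heisenberg algebra (`rho_mul_rho`): their commutator commutes with all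
fermion operators, so it is a scalar by irreducibility (`eq_smul_one_of_commute`), and its vacuum
expectation counts the levels crossing the Fermi point. The Fourier transform and the normalization
turn this into `[b, b†] = 1` (`b_mul_bDag`), while the zero modes become the charges `ρ_f(0)`
(`zeroMode_eq_rho`). Given normalized boson-free vectors, one for each set of charges
(`IsGroundFamily`), orthonormality of the boson states built on them is the usual ladder algebra and
orthogonality of eigenvectors.

Completeness rests on Kronig's identity (`level_ket`): `∑ ρ(-n) ρ(n)` over `n > 0` is diagonal on
fermion occupation states and counts the inversions, i.e. the pairs of an empty level below a filled
one. Since `ρ(n)` removes `n` inversions, induction on their number generates all occupation states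
from filled Fermi seas by means of the `ρ(-n)` (`eq_top_of_rho_invariant`). The same identity shows
that a boson-free vector with given charges is a multiple of a Fermi sea
(`eq_smul_ket_of_rho_eq_zero`), whatever Klein factors produced it.

For existence, the same basis theorem is applied to the explicit Fermi seas. It gives a basis of the
core labelled by boson numbers and charges, and `R_f` is defined as the shift of the charge of `f`,
with a Jordan-Wigner sign in the charges (`exists_isKleinFamily`). -/

theorem inner_ket_left (S : Finset ι) (u : Core ι) :
    inner ℂ (toSpace (ket S)) (toSpace u) = u S := by
  classical
  induction u using Finsupp.induction_linear with
  | zero => simp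
  | add v v' hv hv' => simp only [map_add, inner_add_right, hv, hv', Finsupp.add_apply]
  | single U y =>
    have e : Finsupp.single U y = y • ket U := by simp [ket]
    rw [e, map_smul, inner_smul_right, inner_ket]
    simp [ket, Finsupp.single_apply, eq_comm]

theorem toSpace_injective : Function.Injective (toSpace : Core ι →ₗ[ℂ] Space ι) := by
  intro v w h
  ext S
  rw [← inner_ket_left S v, ← inner_ket_left S w, h]

/-- The difference of the two images of a vector is orthogonal to the core, hence to itself. This
transfers relations to adjoints and identifies `bDag` without a second computation. -/
theorem IsAdj.unique {T T' T'' : Module.End ℂ (Core ι)} (h : IsAdj T T') (h' : IsAdj T T'') :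
    T' = T'' := by
  refine LinearMap.ext fun v => toSpace_injective ?_
  refine sub_eq_zero.1 ?_
  rw [← map_sub]
  have : ∀ w, inner ℂ (toSpace (T' v - T'' v)) (toSpace w) = (0 : ℂ) := fun w => by
    rw [map_sub, inner_sub_left, h, h', sub_self]
  exact inner_self_eq_zero.1 (this _)

theorem IsAdj.zero : IsAdj (0 : Module.End ℂ (Core ι)) 0 := fun v w => by simp

theorem core_induction {p : Core ι → Prop} (ket : ∀ S, p (ket S)) (add : ∀ v w, p v → p w → p (v + w))
    (smul : ∀ (z : ℂ) v, p v → p (z • v)) (v : Core ι) : p v := by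
  induction v using Finsupp.induction_linear with
  | zero => simpa using smul 0 _ (ket ∅)
  | add v w hv hw => exact add _ _ hv hw
  | single S z => simpa [Fock.ket] using smul z _ (ket S)

/-! ### Anticommutation relations and irreducibility -/

section CAR
variable [LinearOrder ι]

theorem annihilate_anticomm (i j : ι) :
    annihilate i * annihilate j + annihilate j * annihilate i = (0 : Module.End ℂ (Core ι)) := by
  refine ext_ket fun S => ?_
  simp only [LinearMap.add_apply, Module.End.mul_apply, LinearMap.zero_apply]
  have hs : ∀ i j : ι, i ≠ j → j ∈ S →
      sign i S = (if j < i then -1 else 1) * sign i (S.erase j) := fun i j h hj => by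
    conv_lhs => rw [← Finset.insert_erase hj, sign_insert _ _ _ (by simp)]
  rcases eq_or_ne i j with rfl | hij
  · by_cases hi : i ∈ S <;> simp [annihilate_ket, hi]
  by_cases hi : i ∈ S <;> by_cases hj : j ∈ S
  · simp only [annihilate_ket, hi, hj, if_true, map_smul, Finset.mem_erase, hij, hij.symm, ne_eq,
      not_false_eq_true, true_and, smul_smul, Finset.erase_right_comm (a := i)]
    -- Exactly one of the two orders of removal picks up an extra sign.
    rw [hs i j hij hj, hs j i hij.symm hi, ← add_smul]
    refine smul_eq_zero_of_left ?_ _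
    rcases lt_or_gt_of_ne hij with h | h
    · simp only [h, h.not_gt, if_true, if_false]; ring
    · simp only [h, h.not_gt, if_true, if_false]; ring
  all_goals simp [annihilate_ket, hi, hj]

theorem create_anticomm (i j : ι) :
    create i * create j + create j * create i = (0 : Module.End ℂ (Core ι)) := by
  have h := ((isAdj_create j).mul (isAdj_create i)).add ((isAdj_create i).mul (isAdj_create j))
  rw [annihilate_anticomm] at h
  exact h.unique IsAdj.zero

/-- The number operator of a mode is diagonal. It follows that a vector killed by all annihilators
has no component outside the vacuum. -/
theorem create_annihilate_apply (i : ι) (v : Core ι) (S : Finset ι) :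
    create i (annihilate i v) S = if i ∈ S then v S else 0 := by
  induction v using core_induction with
  | ket U =>
    by_cases hU : i ∈ U
    · have h1 : sign i (U.erase i) = sign i U := by
        conv_rhs => rw [← Finset.insert_erase hU, sign_insert _ _ _ (by simp)]
        simp
      simp only [annihilate_ket, hU, if_true, map_smul, create_ket, Finset.notMem_erase, if_false,
        h1, smul_smul, sign_mul_self, Finset.insert_erase hU, one_smul]
      by_cases h : U = S
      · subst h; simp [hU]
      · simp [ket, h]
    · rw [annihilate_ket, if_neg hU, map_zero]
      by_cases h : U = S
      · subst h; simp [hU]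
      · simp [ket, h]
  | add v w hv hw => simp only [map_add, Finsupp.add_apply, hv, hw]; split_ifs <;> simp
  | smul z v hv => simp only [map_smul, Finsupp.smul_apply, hv]; split_ifs <;> simp

/-- An operator commuting with all creation and annihilation operators is scalar. -/
theorem eq_smul_one_of_commute {T : Module.End ℂ (Core ι)} (h : ∀ i, Commute T (annihilate i))
    (h' : ∀ i, Commute T (create i)) : T = T vacuum ∅ • (1 : Module.End ℂ (Core ι)) := by
  -- All annihilators kill `T vacuum`, because they commute with `T`; creators then carry the scalar
  -- from the vacuum to every `ket S`.
  have hv : T vacuum = T vacuum ∅ • vacuum := by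
    ext S
    rcases S.eq_empty_or_nonempty with rfl | ⟨i, hi⟩
    · simp [vacuum, ket]
    · have h0 : annihilate i (T vacuum) = 0 := by
        rw [← Module.End.mul_apply, ← (h i).eq, Module.End.mul_apply, vacuum, annihilate_ket]
        simp
      have h1 := create_annihilate_apply i (T vacuum) S
      rw [h0, map_zero, if_pos hi] at h1
      rw [← h1]
      have : (∅ : Finset ι) ≠ S := by rintro rfl; simp at hi
      simp [vacuum, ket, this]
  refine ext_ket fun S => ?_
  induction S using Finset.induction_on with
  | empty => exact hv
  | insert i S hi ih =>
    have : ket (insert i S) = sign i S • create i (ket S) := by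
      rw [create_ket, if_neg hi, smul_smul, sign_mul_self, one_smul]
    rw [this, map_smul, ← Module.End.mul_apply T, (h' i).eq, Module.End.mul_apply, ih]
    simp

end CAR

/-! ### Infinite sums of operators that are finite on each vector -/

section LocallyFinite
variable {κ : Type*}

/-- A family of operators of which only finitely many do not vanish on any given vector. -/
def LocFinite (T : κ → Module.End ℂ (Core ι)) : Prop :=
  ∀ v, (fun i => T i v).HasFiniteSupport

theorem locFinite_of_ket {T : κ → Module.End ℂ (Core ι)}
    (h : ∀ S, (fun i => T i (ket S)).HasFiniteSupport) : LocFinite T := by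
  intro v
  induction v using core_induction with
  | ket S => exact h S
  | add v w hv hw => simpa using hv.fun_add hw
  | smul z v hv =>
    refine Set.Finite.subset hv fun i hi => ?_
    simp only [map_smul, Function.mem_support] at hi ⊢
    exact right_ne_zero_of_smul hi

open Classical in
/-- The sum of a locally finite family of operators. -/
def opSum (T : κ → Module.End ℂ (Core ι)) : Module.End ℂ (Core ι) :=
  if h : LocFinite T then
    { toFun := fun v => ∑ᶠ i, T i v
      map_add' := fun v w => by simp only [map_add]; exact finsum_add_distrib (h v) (h w)
      map_smul' := fun z v => by simp only [map_smul, smul_finsum, RingHom.id_apply] }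
  else 0

theorem opSum_apply {T : κ → Module.End ℂ (Core ι)} (h : LocFinite T) (v : Core ι) :
    opSum T v = ∑ᶠ i, T i v := by
  rw [opSum, dif_pos h]; rfl

theorem map_finsum_core {f : κ → Core ι} (h : f.HasFiniteSupport) (T : Core ι →ₗ[ℂ] Core ι) :
    T (∑ᶠ i, f i) = ∑ᶠ i, T (f i) := T.toAddMonoidHom.map_finsum h

theorem LocFinite.mul_left {T : κ → Module.End ℂ (Core ι)} (h : LocFinite T)
    (U : Module.End ℂ (Core ι)) : LocFinite fun i => U * T i := fun v => by
  refine Set.Finite.subset (h v) fun i hi e => hi ?_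
  have e : T i v = 0 := e
  simp [e]

theorem LocFinite.mul_right {T : κ → Module.End ℂ (Core ι)} (h : LocFinite T)
    (U : Module.End ℂ (Core ι)) : LocFinite fun i => T i * U := fun v => h (U v)

/-- Commutators with infinite sums may be taken term by term; the corrections `W` are locally
finite, being differences of two locally finite families. In the applications at most one `W i` is
nonzero. -/
theorem opSum_mul_eq {T W : κ → Module.End ℂ (Core ι)} (h : LocFinite T)
    {U : Module.End ℂ (Core ι)} (hW : ∀ i, T i * U = U * T i + W i) :
    opSum T * U = U * opSum T + opSum W := by
  have h1 := h.mul_left U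
  have h2 := h.mul_right U
  have hv : ∀ v i, W i v = (T i * U) v - (U * T i) v := fun v i => by
    rw [hW i, LinearMap.add_apply, add_sub_cancel_left]
  have h3 : LocFinite W := fun v => by simpa only [hv] using (h2 v).fun_sub (h1 v)
  refine LinearMap.ext fun v => ?_
  simp only [LinearMap.add_apply, Module.End.mul_apply]
  rw [opSum_apply h3, opSum_apply h, opSum_apply h, map_finsum_core (h v)]
  simp only [hv]
  have := finsum_sub_distrib (h2 v) (h1 v)
  rw [this]
  simp only [Module.End.mul_apply]
  abel

theorem opSum_single [DecidableEq κ] (i : κ) (T : Module.End ℂ (Core ι)) :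
    opSum (fun j => if j = i then T else 0) = T := by
  have h : LocFinite fun j => if j = i then T else 0 := fun v => by
    refine (Set.finite_singleton i).subset fun j hj => ?_
    by_contra hne
    have : j ≠ i := hne
    simp [this] at hj
  refine LinearMap.ext fun v => ?_
  rw [opSum_apply h, finsum_eq_single _ i fun j hj => by simp [hj]]
  simp

theorem IsAdj.opSum {T T' : κ → Module.End ℂ (Core ι)} (h : ∀ i, IsAdj (T i) (T' i))
    (hT : LocFinite T) (hT' : LocFinite T') : IsAdj (opSum T) (opSum T') := by
  intro v w
  rw [opSum_apply hT', opSum_apply hT]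
  classical
  rw [finsum_eq_sum_of_support_subset (s := (hT w).toFinset ∪ (hT' v).toFinset) _ (by
      intro t ht; rw [Finset.coe_union]; exact Or.inr ((hT' v).mem_toFinset.2 ht)),
    finsum_eq_sum_of_support_subset (s := (hT w).toFinset ∪ (hT' v).toFinset) _ (by
      intro t ht; rw [Finset.coe_union]; exact Or.inl ((hT w).mem_toFinset.2 ht))]
  simp only [map_sum, sum_inner, inner_sum]
  exact Finset.sum_congr rfl fun t _ => h t _ _

end LocallyFinite

end Fock

/-! ### Chiral fermions over a Dirac sea -/

namespace Fock

section Chiral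

variable {F ι : Type} [LinearOrder ι] (e : F × ℤ ≃ ι)

/-- The fermion operators of chiral fermions with flavors `F`, in which the levels with negative
index are filled in the vacuum. -/
def fermi (f : F) (j : ℤ) : Module.End ℂ (Core ι) :=
  if 0 ≤ j then annihilate (e (f, j)) else create (e (f, j))

/-- The adjoint of `fermi e f j`. -/
def fermiDag (f : F) (j : ℤ) : Module.End ℂ (Core ι) :=
  if 0 ≤ j then create (e (f, j)) else annihilate (e (f, j))

/-- The level `j` of flavor `f` is filled in the state `ket S`. -/
def Filled (S : Finset ι) (f : F) (j : ℤ) : Prop :=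
  if 0 ≤ j then e (f, j) ∈ S else e (f, j) ∉ S

theorem isAdj_fermi (f : F) (j : ℤ) : IsAdj (fermi e f j) (fermiDag e f j) := by
  unfold fermi fermiDag
  split_ifs
  · exact isAdj_create _
  · exact (isAdj_create _).symm

theorem fermi_fermiDag [DecidableEq F] (f g : F) (i j : ℤ) :
    fermi e f i * fermiDag e g j + fermiDag e g j * fermi e f i =
      if f = g ∧ i = j then 1 else 0 := by
  have he : e (f, i) = e (g, j) ↔ f = g ∧ i = j := by simp
  unfold fermi fermiDag
  split_ifs with hi hj h h hj h h
  · rw [anticomm, if_pos (he.2 h)]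
  · rw [anticomm, if_neg (mt he.1 h)]
  · omega
  · exact annihilate_anticomm _ _
  · omega
  · exact create_anticomm _ _
  · rw [add_comm, anticomm, if_pos (he.2 h).symm]
  · rw [add_comm, anticomm, if_neg fun h' => h (he.1 h'.symm)]

theorem fermi_fermi (f g : F) (i j : ℤ) :
    fermi e f i * fermi e g j + fermi e g j * fermi e f i = 0 := by
  unfold fermi
  split_ifs with hi hj hj
  · exact annihilate_anticomm _ _
  · rw [anticomm, if_neg]
    simp only [EmbeddingLike.apply_eq_iff_eq, Prod.mk.injEq, not_and]
    omega
  · rw [add_comm, anticomm, if_neg]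
    simp only [EmbeddingLike.apply_eq_iff_eq, Prod.mk.injEq, not_and]
    omega
  · exact create_anticomm _ _

theorem fermiDag_fermiDag (f g : F) (i j : ℤ) :
    fermiDag e f i * fermiDag e g j + fermiDag e g j * fermiDag e f i = 0 := by
  have h := ((isAdj_fermi e g j).mul (isAdj_fermi e f i)).add
    ((isAdj_fermi e f i).mul (isAdj_fermi e g j))
  rw [fermi_fermi] at h
  exact h.unique IsAdj.zero

variable {e}

theorem fermi_ket {S : Finset ι} {f : F} {j : ℤ} (h : ¬ Filled e S f j) :
    fermi e f j (ket S) = 0 := by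
  unfold Filled at h
  unfold fermi
  split_ifs at h ⊢
  · rw [annihilate_ket, if_neg h]
  · rw [create_ket, if_pos (not_not.1 h)]

theorem fermiDag_ket {S : Finset ι} {f : F} {j : ℤ} (h : Filled e S f j) :
    fermiDag e f j (ket S) = 0 := by
  unfold Filled at h
  unfold fermiDag
  split_ifs at h ⊢
  · rw [create_ket, if_pos h]
  · rw [annihilate_ket, if_neg h]

theorem fermiDag_fermi_ket {S : Finset ι} {f : F} {j : ℤ} (h : Filled e S f j) :
    fermiDag e f j (fermi e f j (ket S)) = ket S := by
  classical
  have := congrArg (fun T => T (ket S)) (fermi_fermiDag e f f j j)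
  simpa [fermiDag_ket h] using this

theorem fermi_fermiDag_ket {S : Finset ι} {f : F} {j : ℤ} (h : ¬ Filled e S f j) :
    fermi e f j (fermiDag e f j (ket S)) = ket S := by
  classical
  have := congrArg (fun T => T (ket S)) (fermi_fermiDag e f f j j)
  simpa [fermi_ket h] using this

theorem filled_empty (f : F) (j : ℤ) : Filled e ∅ f j ↔ j < 0 := by
  simp [Filled]

variable (e)

/-- A finite set of excitations changes only finitely many levels of the Dirac sea, so one cutoff
serves all flavors. All finiteness statements below come from it. -/
theorem exists_filled_bound (S : Finset ι) : ∃ A : ℤ, 0 ≤ A ∧ ∀ f j,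
    (A ≤ j → ¬ Filled e S f j) ∧ (j < -A → Filled e S f j) := by
  obtain ⟨A, hA⟩ := (S.image fun m => |(e.symm m).2|).exists_le
  refine ⟨max A 0 + 1, by positivity, fun f j => ⟨fun hj h => ?_, fun hj => ?_⟩⟩
  · rw [Filled, if_pos (by have := le_max_right A 0; omega)] at h
    have := hA _ (Finset.mem_image_of_mem _ h)
    simp only [Equiv.symm_apply_apply] at this
    have := le_abs_self j
    have := le_max_left A 0
    omega
  · rw [Filled, if_neg (by have := le_max_right A 0; omega)]
    intro h
    have := hA _ (Finset.mem_image_of_mem _ h)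
    simp only [Equiv.symm_apply_apply] at this
    have := neg_abs_le j
    have := le_max_left A 0
    omega

theorem filled_injective {S S' : Finset ι} (h : ∀ f j, Filled e S f j ↔ Filled e S' f j) :
    S = S' := by
  ext m
  obtain ⟨⟨f, j⟩, rfl⟩ := e.surjective m
  have := h f j
  unfold Filled at this
  split_ifs at this
  · exact this
  · exact not_iff_not.1 this

/-! ### Density operators -/

/-- The normal ordered product of `fermiDag e f j` and `fermi e f (j + n)`. -/
def hop (f : F) (n j : ℤ) : Module.End ℂ (Core ι) :=
  if j < 0 then (-1 : ℂ) • (fermi e f (j + n) * fermiDag e f j) else fermiDag e f j * fermi e f (j + n)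

/-- Normal ordering removes a constant only when `n = 0` and the level is filled in the vacuum.
Being central, this constant is invisible in commutators. -/
theorem fermiDag_mul_fermi (f : F) (n j : ℤ) :
    fermiDag e f j * fermi e f (j + n) = hop e f n j + if n = 0 ∧ j < 0 then 1 else 0 := by
  classical
  have h := fermi_fermiDag e f f (j + n) j
  have hn : f = f ∧ j + n = j ↔ n = 0 := by simp
  rw [if_congr hn rfl rfl] at h
  unfold hop
  by_cases hj : j < 0
  · simp only [hj, if_true, and_true, ← h]
    module
  · simp [hj]

theorem vev_add (T U : Module.End ℂ (Core ι)) : vev (T + U) = vev T + vev U := by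
  simp [vev]

theorem vev_smul (z : ℂ) (T : Module.End ℂ (Core ι)) : vev (z • T) = z * vev T := by
  simp [vev]

theorem vev_zero : vev (0 : Module.End ℂ (Core ι)) = 0 := by simp [vev]

theorem vev_one : vev (1 : Module.End ℂ (Core ι)) = 1 := by
  classical
  rw [vev, vacuum, Module.End.one_apply, inner_ket, if_pos rfl]

theorem vev_eq (T : Module.End ℂ (Core ι)) : vev T = T vacuum ∅ := by
  rw [vev, vacuum, inner_ket_left]

theorem fermi_vacuum {f : F} {j : ℤ} (h : 0 ≤ j) : fermi e f j vacuum = 0 :=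
  fermi_ket (by rw [filled_empty]; omega)

theorem fermiDag_vacuum {f : F} {j : ℤ} (h : j < 0) : fermiDag e f j vacuum = 0 :=
  fermiDag_ket (by rw [filled_empty]; omega)

theorem vev_fermiDag_mul {f : F} {j : ℤ} (h : 0 ≤ j) (T : Module.End ℂ (Core ι)) :
    vev (fermiDag e f j * T) = 0 := by
  unfold vev
  rw [Module.End.mul_apply, ← (isAdj_fermi e f j).symm, fermi_vacuum e h, map_zero,
    inner_zero_left]

theorem vev_mul_fermiDag {f : F} {j : ℤ} (h : j < 0) (T : Module.End ℂ (Core ι)) :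
    vev (T * fermiDag e f j) = 0 := by
  unfold vev
  rw [Module.End.mul_apply, fermiDag_vacuum e h, map_zero, map_zero, inner_zero_right]

theorem vev_hop (f : F) (n j : ℤ) : vev (hop e f n j) = 0 := by
  unfold hop
  split_ifs with h
  · rw [vev_smul, vev_mul_fermiDag e h, mul_zero]
  · exact vev_fermiDag_mul e (not_lt.1 h) _

theorem vev_fermiDag_fermi (f : F) (n j : ℤ) :
    vev (fermiDag e f j * fermi e f (j + n)) = if n = 0 ∧ j < 0 then 1 else 0 := by
  rw [fermiDag_mul_fermi, vev_add, vev_hop, zero_add]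
  split_ifs
  · exact vev_one
  · exact vev_zero

theorem normalOrder_fermiDag_fermi (f : F) (n j : ℤ) :
    normalOrder (fermiDag e f j * fermi e f (j + n)) = hop e f n j := by
  rw [normalOrder, vev_fermiDag_fermi, fermiDag_mul_fermi]
  refine LinearMap.ext fun v => ?_
  split_ifs <;> simp

theorem isAdj_hop (f : F) (n j : ℤ) : IsAdj (hop e f n j) (hop e f (-n) (j + n)) := by
  have h := ((isAdj_fermi e f j).symm.mul (isAdj_fermi e f (j + n))).normalOrder
  rw [normalOrder_fermiDag_fermi] at h
  convert h
  conv_rhs => rw [show j = j + n + -n by ring]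
  rw [← normalOrder_fermiDag_fermi]
  simp

/-- For `j < -A` the target level is already filled; for `j ≥ A + |n|` the source level `j + n` is
empty. -/
theorem hop_ket_eq_zero {S : Finset ι} {f : F} {n j A : ℤ} (hA : 0 ≤ A)
    (h : ∀ f j, (A ≤ j → ¬ Filled e S f j) ∧ (j < -A → Filled e S f j))
    (hj : j < -A ∨ A + |n| ≤ j) : hop e f n j (ket S) = 0 := by
  have := neg_abs_le n
  have := abs_nonneg n
  unfold hop
  rcases hj with hj | hj
  · rw [if_pos (by omega)]
    simp [fermiDag_ket ((h f j).2 hj)]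
  · rw [if_neg (by omega)]
    simp [fermi_ket ((h f (j + n)).1 (by omega))]

theorem locFinite_hop (f : F) (n : ℤ) : LocFinite (hop e f n) := by
  refine locFinite_of_ket fun S => ?_
  obtain ⟨A, hA, h⟩ := exists_filled_bound e S
  refine (Set.finite_Icc (-A) (A + |n|)).subset fun j hj => ?_
  by_contra hc
  rw [Set.mem_Icc, not_and_or] at hc
  exact hj (hop_ket_eq_zero e hA h (by omega))

/-- The density operators `ρ_f(n) = ∑_j :c_f(j)† c_f(j + n):`. -/
def rho (f : F) (n : ℤ) : Module.End ℂ (Core ι) := opSum (hop e f n)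

theorem opSum_comp_equiv {κ κ' : Type*} (E : κ ≃ κ') (T : κ' → Module.End ℂ (Core ι)) (h : LocFinite T) :
    opSum (fun i => T (E i)) = opSum T := by
  have h' : LocFinite fun i => T (E i) := fun v => (h v).preimage E.injective.injOn
  refine LinearMap.ext fun v => ?_
  rw [opSum_apply h, opSum_apply h']
  exact finsum_comp_equiv E (f := fun i => T i v)

theorem isAdj_rho (f : F) (n : ℤ) : IsAdj (rho e f n) (rho e f (-n)) := by
  have h : LocFinite fun j => hop e f (-n) (j + n) := fun v =>
    (locFinite_hop e f (-n) v).preimage (Equiv.addRight n).injective.injOn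
  have := IsAdj.opSum (fun j => isAdj_hop e f n j) (locFinite_hop e f n) h
  have e1 := opSum_comp_equiv (Equiv.addRight n) _ (locFinite_hop e f (-n))
  simp only [Equiv.coe_addRight] at e1
  rw [e1] at this
  exact this

theorem ite_one_zero_mul_comm (p : Prop) [Decidable p] (x : Module.End ℂ (Core ι)) :
    (if p then 1 else 0) * x = x * if p then 1 else 0 := by
  split_ifs <;> simp

/-- Two anticommutators give the commutator with a bilinear; the normal-ordering constant `k` drops
out. -/
theorem mul_eq_of_anticomm {R : Type*} [Ring R] {c c' d k w H : R} (h : c' * c = H + k)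
    (hk : k * d = d * k) (h1 : c * d + d * c = w) (h2 : c' * d + d * c' = 0) :
    H * d = d * H + c' * w := by
  rw [← h1, eq_sub_of_add_eq h.symm, sub_mul, mul_sub, hk, mul_add, ← mul_assoc, ← mul_assoc,
    ← mul_assoc, eq_neg_of_add_eq_zero_left h2]
  noncomm_ring

theorem mul_eq_of_anticomm' {R : Type*} [Ring R] {c c' d k w H : R} (h : c' * c = H + k)
    (hk : k * d = d * k) (h1 : c * d + d * c = 0) (h2 : d * c' + c' * d = w) :
    d * H = H * d + w * c := by
  rw [← h2, eq_sub_of_add_eq h.symm, sub_mul, mul_sub, hk, add_mul, mul_assoc c', mul_assoc c',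
    mul_assoc d, eq_neg_of_add_eq_zero_left h1]
  noncomm_ring

/-- Only the summand with `j + n = i` fails to commute. Thus commutation with `rho e f n` is a
derivation that shifts the levels of the flavor `f`. -/
theorem rho_mul_fermiDag [DecidableEq F] (f g : F) (n i : ℤ) :
    rho e f n * fermiDag e g i =
      fermiDag e g i * rho e f n + if f = g then fermiDag e g (i - n) else 0 := by
  have key : ∀ j, hop e f n j * fermiDag e g i = fermiDag e g i * hop e f n j +
      if j = i - n then (if f = g then fermiDag e g (i - n) else 0) else 0 := fun j => by
    refine (mul_eq_of_anticomm (R := Module.End ℂ (Core ι)) (fermiDag_mul_fermi e f n j) (ite_one_zero_mul_comm _ _)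
      (fermi_fermiDag e f g (j + n) i) (fermiDag_fermiDag e f g j i)).trans ?_
    congr 1
    by_cases hf : f = g
    · subst hf
      by_cases hj : j = i - n
      · subst hj; simp
      · have : j + n ≠ i := by omega
        simp [hj, this]
    · simp [hf]
  rw [rho, opSum_mul_eq (locFinite_hop e f n) key, opSum_single]

theorem fermi_mul_rho [DecidableEq F] (f g : F) (n i : ℤ) :
    fermi e g i * rho e f n =
      rho e f n * fermi e g i + if f = g then fermi e g (i + n) else 0 := by
  have key : ∀ j, hop e f n j * fermi e g i = fermi e g i * hop e f n j +
      if j = i then (if f = g then (-1 : ℂ) • fermi e g (i + n) else 0) else 0 := fun j => by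
    have := mul_eq_of_anticomm' (R := Module.End ℂ (Core ι)) (fermiDag_mul_fermi e f n j) (ite_one_zero_mul_comm _ _)
      (fermi_fermi e f g (j + n) i) (fermi_fermiDag e g f i j)
    rw [this, add_assoc]
    symm
    refine (congrArg _ ?_).trans (add_zero _)
    by_cases hf : f = g
    · subst hf
      by_cases hj : j = i
      · subst hj
        simp only [and_self, if_true, one_mul]
        module
      · simp [hj, Ne.symm hj]
    · simp [hf, Ne.symm hf]
  rw [rho, opSum_mul_eq (locFinite_hop e f n) key, opSum_single]
  split_ifs
  · module
  · simp

theorem rho_vacuum {f : F} {n : ℤ} (hn : 0 ≤ n) : rho e f n vacuum = 0 := by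
  rw [rho, opSum_apply (locFinite_hop e f n)]
  refine finsum_eq_zero_of_forall_eq_zero fun j => ?_
  unfold hop
  split_ifs with hj
  · simp [fermiDag_vacuum e hj]
  · simp [fermi_vacuum e (show 0 ≤ j + n by omega)]

end Chiral
end Fock

/-! ### Heisenberg algebra of the densities and filled Fermi seas -/

namespace Fock

section Chiral

variable {F ι : Type} [LinearOrder ι] (e : F × ℤ ≃ ι)

/-- This is the Jacobi identity: if the derivations given by `a` and `b` commute on `x`, with common
second derivative `r`, then the commutator of `a` and `b` commutes with `x`. For densities the
derivations are level shifts. -/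
theorem commute_of_derivation {R : Type*} [Ring R] [Algebra ℂ R] {a b x p q r : R}
    (h1 : a * x = x * a + p) (h2 : b * x = x * b + q) (h3 : b * p = p * b + r)
    (h4 : a * q = q * a + r) : Commute (a * b + (-1 : ℂ) • (b * a)) x := by
  have e1 : a * b * x = x * (a * b) + (p * b + q * a + r) := by
    rw [mul_assoc, h2, mul_add, h4, ← mul_assoc, h1, add_mul]
    noncomm_ring
  have e2 : b * a * x = x * (b * a) + (p * b + q * a + r) := by
    rw [mul_assoc, h1, mul_add, h3, ← mul_assoc, h2, add_mul]
    noncomm_ring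
  rw [commute_iff_eq, add_mul, smul_mul_assoc, e1, e2, mul_add, mul_smul_comm]
  module

theorem commute_of_derivation' {R : Type*} [Ring R] [Algebra ℂ R] {a b x p q r : R}
    (h1 : x * a = a * x + p) (h2 : x * b = b * x + q) (h3 : p * b = b * p + r)
    (h4 : q * a = a * q + r) : Commute (a * b + (-1 : ℂ) • (b * a)) x := by
  have e1 : x * (a * b) = a * b * x + (a * q + b * p + r) := by
    rw [← mul_assoc, h1, add_mul, h3, mul_assoc, h2, mul_add]
    noncomm_ring
  have e2 : x * (b * a) = b * a * x + (a * q + b * p + r) := by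
    rw [← mul_assoc, h2, add_mul, h4, mul_assoc, h1, mul_add]
    noncomm_ring
  rw [commute_iff_eq, mul_add, mul_smul_comm, e1, e2, add_mul, smul_mul_assoc]
  module

theorem eq_smul_one_of_commute_fermi {T : Module.End ℂ (Core ι)}
    (h : ∀ f j, Commute T (fermi e f j)) (h' : ∀ f j, Commute T (fermiDag e f j)) :
    T = vev T • (1 : Module.End ℂ (Core ι)) := by
  rw [vev_eq]
  refine eq_smul_one_of_commute (fun i => ?_) fun i => ?_
  all_goals
    obtain ⟨⟨f, j⟩, rfl⟩ := e.surjective i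
    have h1 := h f j
    have h2 := h' f j
    unfold fermi at h1
    unfold fermiDag at h2
    by_cases hj : 0 ≤ j
    · simp only [hj, if_true] at h1 h2
      assumption
    · simp only [hj, if_false] at h1 h2
      assumption

theorem vev_mul_rho (T : Module.End ℂ (Core ι)) (f : F) {n : ℤ} (hn : 0 ≤ n) :
    vev (T * rho e f n) = 0 := by
  rw [vev, Module.End.mul_apply, rho_vacuum e hn, map_zero, map_zero, inner_zero_right]

theorem vev_rho_mul (T : Module.End ℂ (Core ι)) (f : F) {n : ℤ} (hn : n ≤ 0) :
    vev (rho e f n * T) = 0 := by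
  rw [vev, Module.End.mul_apply, ← isAdj_rho, rho_vacuum e (by omega), map_zero, inner_zero_left]

/-- Out of the vacuum a hop needs a filled source `j + m < 0` and an empty target `0 ≤ j`. -/
theorem rho_vacuum_eq_sum (g : F) (m : ℤ) : rho e g m vacuum =
    ∑ j ∈ Finset.Ico 0 (-m), fermiDag e g j (fermi e g (j + m) vacuum) := by
  rw [rho, opSum_apply (locFinite_hop e g m),
    finsum_eq_sum_of_support_subset (s := Finset.Ico 0 (-m))]
  · refine Finset.sum_congr rfl fun j hj => ?_
    rw [hop, if_neg (by simpa using (Finset.mem_Ico.1 hj).1)]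
    rfl
  · intro j hj
    rw [Finset.coe_Ico, Set.mem_Ico]
    by_contra hc
    refine hj ?_
    simp only [hop]
    split_ifs with h
    · simp [fermiDag_vacuum e h]
    · simp [fermi_vacuum e (show 0 ≤ j + m by omega)]

/-- This is the Schwinger term. Moving `rho e f n` past `fermiDag e g j` leaves `fermiDag e g (j -
n) * fermi e g (j + m)`, whose expectation is one exactly when the flavors agree and `n + m = 0`, as
then `j - n < 0`. There are `-m = n` such `j`. -/
theorem vev_rho_mul_rho [DecidableEq F] (f g : F) {n m : ℤ} (hn : 0 < n) :
    vev (rho e f n * rho e g m) = if f = g ∧ n + m = 0 then (n : ℂ) else 0 := by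
  have h1 : ∀ j ∈ Finset.Ico 0 (-m), vev (rho e f n * (fermiDag e g j * fermi e g (j + m))) =
      if f = g ∧ n + m = 0 then 1 else 0 := fun j hj => by
    rw [Finset.mem_Ico] at hj
    rw [← mul_assoc, rho_mul_fermiDag, add_mul, vev_add, mul_assoc, vev_fermiDag_mul e hj.1,
      zero_add]
    by_cases hf : f = g
    · have := vev_fermiDag_fermi e g (n + m) (j - n)
      rw [show j - n + (n + m) = j + m by ring] at this
      rw [if_pos hf, this]
      exact if_congr ⟨fun h => ⟨hf, h.1⟩, fun h => ⟨h.2, by omega⟩⟩ rfl rfl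
    · simp [hf, vev_zero]
  rw [vev_eq, Module.End.mul_apply, rho_vacuum_eq_sum e g m, map_sum, Finsupp.finsetSum_apply]
  refine (Finset.sum_congr rfl fun j hj => (vev_eq _).symm.trans (h1 j hj)).trans ?_
  split_ifs with h
  · rw [Finset.sum_const, Int.card_Ico, show -m - 0 = n by omega, nsmul_eq_mul, mul_one]
    have : ((n.toNat : ℤ) : ℂ) = (n : ℂ) := by rw [Int.toNat_of_nonneg hn.le]
    exact_mod_cast this
  · simp

/-- The density operators satisfy the relations of a Heisenberg algebra. -/
theorem rho_mul_rho [DecidableEq F] (f g : F) (n m : ℤ) :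
    rho e f n * rho e g m = rho e g m * rho e f n + if f = g ∧ n + m = 0 then (n : ℂ) • 1 else 0 := by
  -- The commutator is a scalar by irreducibility, so its vacuum expectation determines it.
  have h := eq_smul_one_of_commute_fermi (T := rho e f n * rho e g m +
      (-1 : ℂ) • (rho e g m * rho e f n)) e (fun h i => ?_) fun h i => ?_
  · have hv : vev (rho e f n * rho e g m + (-1 : ℂ) • (rho e g m * rho e f n)) =
        if f = g ∧ n + m = 0 then (n : ℂ) else 0 := by
      rw [vev_add, vev_smul]
      -- Densities with `n ≥ 0` kill the vacuum on their right, those with `n ≤ 0` the vacuum on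
      -- their left, so at most one of the two orderings contributes.
      rcases lt_trichotomy n 0 with hn | rfl | hn
      · rw [vev_rho_mul e _ f hn.le]
        rcases le_or_gt m 0 with hm | hm
        · rw [vev_rho_mul e _ g hm, if_neg (by omega)]; simp
        · rw [vev_rho_mul_rho e g f hm, zero_add]
          by_cases hf : f = g ∧ n + m = 0
          · rw [if_pos hf, if_pos ⟨hf.1.symm, by omega⟩, show m = -n by omega]; simp
          · rw [if_neg hf, if_neg fun hh => hf ⟨hh.1.symm, by omega⟩, mul_zero]
      · rw [vev_rho_mul e _ f le_rfl, vev_mul_rho e _ f le_rfl]; simp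
      · rw [vev_mul_rho e _ f hn.le]
        rcases le_or_gt 0 m with hm | hm
        · rw [vev_mul_rho e _ g hm, if_neg (by omega)]; simp
        · rw [vev_rho_mul_rho e f g hn, mul_zero, add_zero]
    rw [hv] at h
    have h2 : rho e f n * rho e g m = rho e g m * rho e f n + (rho e f n * rho e g m +
      (-1 : ℂ) • (rho e g m * rho e f n)) := by module
    rw [h2, h]
    split_ifs <;> simp
  · refine commute_of_derivation' (R := Module.End ℂ (Core ι))
      (r := if f = h ∧ g = h then fermi e h (i + n + m) else 0)
      (fermi_mul_rho e f h n i) (fermi_mul_rho e g h m i) ?_ ?_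
    · by_cases hf : f = h
      · simpa [hf] using fermi_mul_rho e g h m (i + n)
      · simp [hf]
    · by_cases hg : g = h
      · simpa [hg, add_right_comm] using fermi_mul_rho e f h n (i + m)
      · simp [hg]
  · refine commute_of_derivation (R := Module.End ℂ (Core ι))
      (r := if f = h ∧ g = h then fermiDag e h (i - n - m) else 0)
      (rho_mul_fermiDag e f h n i) (rho_mul_fermiDag e g h m i) ?_ ?_
    · by_cases hf : f = h
      · simpa [hf] using rho_mul_fermiDag e g h m (i - n)
      · simp [hf]
    · by_cases hg : g = h
      · simpa [hg, sub_right_comm] using rho_mul_fermiDag e f h n (i - m)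
      · simp [hg]

/-- Particles at `0 ≤ j < ν` contribute `+1` and holes at `ν ≤ j < 0` contribute `-1`; at most one
of these ranges is nonempty. -/
theorem rho_zero_ket {S : Finset ι} {f : F} {ν : ℤ} (h : ∀ j, Filled e S f j ↔ j < ν) :
    rho e f 0 (ket S) = (ν : ℂ) • ket S := by
  have key : ∀ j, hop e f 0 j (ket S) =
      ((if 0 ≤ j ∧ j < ν then 1 else 0 : ℂ) - if ν ≤ j ∧ j < 0 then 1 else 0) • ket S := fun j => by
    unfold hop
    split_ifs with h0 h1 h2 h2 h1 h2 h2
    · omega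
    · omega
    · rw [add_zero, LinearMap.smul_apply, Module.End.mul_apply, fermi_fermiDag_ket]
      · simp
      · rw [h]; omega
    · rw [LinearMap.smul_apply, Module.End.mul_apply, fermiDag_ket ((h j).2 (by omega))]
      simp
    · omega
    · rw [add_zero, Module.End.mul_apply, fermiDag_fermi_ket ((h j).2 h1.2)]
      simp
    · omega
    · rw [add_zero, Module.End.mul_apply, fermi_ket (by rw [h]; omega)]
      simp
  rw [rho, opSum_apply (locFinite_hop e f 0)]
  simp only [key]
  rw [finsum_eq_sum_of_support_subset (s := Finset.Ico (-|ν|) |ν|)]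
  · rw [← Finset.sum_smul, Finset.sum_sub_distrib, Finset.sum_boole, Finset.sum_boole]
    congr 1
    have e1 : (Finset.Ico (-|ν|) |ν|).filter (fun j => 0 ≤ j ∧ j < ν) = Finset.Ico 0 ν := by
      ext j
      have := neg_abs_le ν
      have := le_abs_self ν
      have := abs_nonneg ν
      simp only [Finset.mem_filter, Finset.mem_Ico]
      omega
    have e2 : (Finset.Ico (-|ν|) |ν|).filter (fun j => ν ≤ j ∧ j < 0) = Finset.Ico ν 0 := by
      ext j
      have := neg_abs_le ν
      have := le_abs_self ν
      have := abs_nonneg ν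
      simp only [Finset.mem_filter, Finset.mem_Ico]
      omega
    rw [e1, e2, Int.card_Ico, Int.card_Ico]
    have : ((ν - 0).toNat : ℤ) - ((0 - ν).toNat : ℤ) = ν := by omega
    exact_mod_cast this
  · intro j hj
    have := neg_abs_le ν
    have := le_abs_self ν
    have := abs_nonneg ν
    rw [Finset.coe_Ico, Set.mem_Ico]
    by_contra hc
    refine hj ?_
    dsimp only
    rw [if_neg (by omega), if_neg (by omega)]
    simp

/-- Relative to the vacuum such a sea has only the particles `0 ≤ j < ν f` and the holes `ν f ≤ j <
0`, finitely many because there are finitely many flavors. -/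
theorem exists_filled_iff_lt [Finite F] (ν : F → ℤ) :
    ∃ S : Finset ι, ∀ f j, Filled e S f j ↔ j < ν f := by
  have hfin : {m : ι | (0 ≤ (e.symm m).2 ∧ (e.symm m).2 < ν (e.symm m).1) ∨
      (ν (e.symm m).1 ≤ (e.symm m).2 ∧ (e.symm m).2 < 0)}.Finite := by
    refine (Set.finite_iUnion fun f : F =>
      (Set.finite_Icc (-|ν f|) |ν f|).image fun j => e (f, j)).subset ?_
    intro m hm
    obtain ⟨⟨f, j⟩, rfl⟩ := e.surjective m
    simp only [Set.mem_ofPred_eq, Equiv.symm_apply_apply] at hm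
    have := neg_abs_le (ν f)
    have := le_abs_self (ν f)
    have := abs_nonneg (ν f)
    exact Set.mem_iUnion.2 ⟨f, j, ⟨by omega, by omega⟩, rfl⟩
  refine ⟨hfin.toFinset, fun f j => ?_⟩
  unfold Filled
  simp only [Set.Finite.mem_toFinset, Set.mem_ofPred_eq, Equiv.symm_apply_apply]
  split_ifs <;> omega

end Chiral
end Fock

/-! ### Kronig's identity -/

namespace Fock

/-- Splits the offsets `a` in the quartic sum into zero, positive and negative ones. The latter two
cancel separately, by different antisymmetries. -/
theorem sum_Icc_neg_eq {M : Type*} [AddCommMonoid M] (g : ℤ → M) (C : ℕ) :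
    ∑ a ∈ Finset.Icc (-(C : ℤ)) C, g a =
      g 0 + ((∑ i ∈ Finset.range C, g (i + 1)) + ∑ i ∈ Finset.range C, g (-(i + 1))) := by
  induction C with
  | zero => simp
  | succ C ih =>
    have : Finset.Icc (-((C + 1 : ℕ) : ℤ)) (C + 1 : ℕ) =
        insert ((C : ℤ) + 1) (insert (-((C : ℤ) + 1)) (Finset.Icc (-(C : ℤ)) C)) := by
      ext j
      simp only [Finset.mem_Icc, Finset.mem_insert]
      omega
    rw [this, Finset.sum_insert, Finset.sum_insert, ih, Finset.sum_range_succ,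
      Finset.sum_range_succ]
    · abel
    · simp only [Finset.mem_Icc]; omega
    · simp only [Finset.mem_Icc, Finset.mem_insert]; omega

theorem sum_sum_eq_zero_of_antisymm {M : Type*} [AddCommGroup M] [Module ℂ M] (s : Finset ℕ)
    (X : ℕ → ℕ → M) (h : ∀ i j, X i j = -X j i) : ∑ i ∈ s, ∑ j ∈ s, X i j = 0 := by
  have h1 : ∑ i ∈ s, ∑ j ∈ s, X i j = -∑ i ∈ s, ∑ j ∈ s, X i j := by
    conv_lhs => rw [Finset.sum_comm]
    simp only [← Finset.sum_neg_distrib, ← h]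
  have h2 : (2 : ℂ) • ∑ i ∈ s, ∑ j ∈ s, X i j = 0 := by
    rw [two_smul]
    exact eq_neg_iff_add_eq_zero.1 h1
  exact (smul_eq_zero.1 h2).resolve_left two_ne_zero

section Chiral

variable {F ι : Type} [LinearOrder ι] (e : F × ℤ ≃ ι)

theorem fermi_fermi_apply (f : F) (i j : ℤ) (v : Core ι) :
    fermi e f i (fermi e f j v) = -fermi e f j (fermi e f i v) :=
  eq_neg_of_add_eq_zero_left (congrArg (fun T => T v) (fermi_fermi e f f i j))

theorem fermiDag_fermiDag_apply (f : F) (i j : ℤ) (v : Core ι) :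
    fermiDag e f i (fermiDag e f j v) = -fermiDag e f j (fermiDag e f i v) :=
  eq_neg_of_add_eq_zero_left (congrArg (fun T => T v) (fermiDag_fermiDag e f f i j))

theorem fermi_fermiDag_apply (f : F) {i j : ℤ} (h : i ≠ j) (v : Core ι) :
    fermi e f i (fermiDag e f j v) = -fermiDag e f j (fermi e f i v) := by
  classical
  have := congrArg (fun T => T v) (fermi_fermiDag e f f i j)
  rw [if_neg (by simp [h])] at this
  exact eq_neg_of_add_eq_zero_left this

/-- The quartic terms of `∑ n, rho (-n) * rho n`. -/
def quartic (f : F) (v : Core ι) (n l a : ℤ) : Core ι :=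
  fermiDag e f (l + a + n) (fermi e f (l + a) (fermiDag e f l (fermi e f (l + n) v)))

/-- For positive offsets, exchanging `n` and `a` just exchanges the two operators `fermi`. -/
theorem quartic_swap (f : F) (v : Core ι) {n a : ℤ} (l : ℤ) (hn : 0 < n) (ha : 0 < a) :
    quartic e f v n l a = -quartic e f v a l n := by
  unfold quartic
  rw [fermi_fermiDag_apply e f (by omega : l + a ≠ l), fermi_fermiDag_apply e f
    (by omega : l + n ≠ l), fermi_fermi_apply e f (l + a), add_right_comm l a n]
  simp

/-- For negative offsets it is the two operators `fermiDag` that are exchanged, once `l` is shifted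
so that the lowest level `k` is common to both terms. -/
theorem quartic_neg_swap (f : F) (v : Core ι) {n m : ℤ} (k : ℤ) (hn : 0 < n) (hm : 0 < m) :
    quartic e f v n (k + m) (-m) = -quartic e f v m (k + n) (-n) := by
  unfold quartic
  simp only [add_neg_cancel_right]
  rw [fermi_fermiDag_apply e f (by omega : k ≠ k + m), fermi_fermiDag_apply e f
    (by omega : k ≠ k + n), add_right_comm k m n, map_neg, fermiDag_fermiDag_apply]
  simp

theorem finsum_quartic_neg_swap (f : F) (v : Core ι) {n m : ℤ} (hn : 0 < n) (hm : 0 < m) :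
    ∑ᶠ l, quartic e f v n l (-m) = -∑ᶠ l, quartic e f v m l (-n) := by
  have h1 : ∑ᶠ k, quartic e f v n (k + m) (-m) = ∑ᶠ l, quartic e f v n l (-m) :=
    finsum_comp_equiv (Equiv.addRight m) (f := fun l => quartic e f v n l (-m))
  have h2 : ∑ᶠ k, quartic e f v m (k + n) (-n) = ∑ᶠ l, quartic e f v m l (-n) :=
    finsum_comp_equiv (Equiv.addRight n) (f := fun l => quartic e f v m l (-n))
  rw [← h1, ← h2, ← finsum_neg_distrib]
  exact finsum_congr fun k => quartic_neg_swap e f v k hn hm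

variable {e}

/-- As `n` and `a` are nonzero, each of the four operators can be moved to act first, up to sign; it
kills the state when its level lies beyond the cutoff on the wrong side. -/
theorem quartic_ket_eq_zero {S : Finset ι} {f : F} {n l a A : ℤ} (hn : 0 < n) (ha : a ≠ 0)
    (h : ∀ f j, (A ≤ j → ¬ Filled e S f j) ∧ (j < -A → Filled e S f j))
    (hl : A ≤ l + n ∨ l < -A ∨ A ≤ l + a ∨ l + a + n < -A) : quartic e f (ket S) n l a = 0 := by
  unfold quartic
  rcases hl with hl | hl | hl | hl
  · simp [fermi_ket ((h f _).1 hl)]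
  · rw [← neg_eq_iff_eq_neg.2 (fermi_fermiDag_apply e f (by omega : l + n ≠ l) _),
      fermiDag_ket ((h f _).2 hl)]
    simp
  · rw [fermi_fermiDag_apply e f (by omega : l + a ≠ l), fermi_fermi_apply,
      fermi_ket ((h f _).1 hl)]
    simp
  · rw [← neg_eq_iff_eq_neg.2 (fermi_fermiDag_apply e f (by omega : l + n ≠ l) _), map_neg, map_neg,
      ← neg_eq_iff_eq_neg.2 (fermi_fermiDag_apply e f (by omega : l + a ≠ l + a + n) _),
      ← neg_eq_iff_eq_neg.2 (fermi_fermiDag_apply e f (by omega : l + n ≠ l + a + n) _),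
      fermiDag_fermiDag_apply, fermiDag_ket ((h f _).2 hl)]
    simp

-- At zero offset the four operators combine to the occupation of level `l + n` times the vacancy of
-- level `l`.
open Classical in
theorem quartic_diag_ket (S : Finset ι) (f : F) {n : ℤ} (l : ℤ) (hn : 0 < n) :
    quartic e f (ket S) n l 0 = if ¬ Filled e S f l ∧ Filled e S f (l + n) then ket S else 0 := by
  unfold quartic
  rw [add_zero, ← neg_eq_iff_eq_neg.2 (fermi_fermiDag_apply e f (by omega : l + n ≠ l) _), map_neg,
    fermi_fermi_apply, neg_neg]
  by_cases h : Filled e S f l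
  · simp [fermiDag_ket h, h]
  · rw [fermi_fermiDag_ket h]
    by_cases h' : Filled e S f (l + n)
    · rw [fermiDag_fermi_ket h', if_pos ⟨h, h'⟩]
    · simp [fermi_ket h', h']

variable (e)

theorem rho_apply_of_pos (f : F) {n : ℤ} (hn : n ≠ 0) (v : Core ι) :
    rho e f n v = ∑ᶠ j, fermiDag e f j (fermi e f (j + n) v) := by
  rw [rho, opSum_apply (locFinite_hop e f n)]
  refine finsum_congr fun j => ?_
  have := fermiDag_mul_fermi e f n j
  rw [if_neg (by tauto), add_zero] at this
  rw [← this, Module.End.mul_apply]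

theorem finite_fermiDag_fermi (f : F) {n : ℤ} (hn : n ≠ 0) (v : Core ι) :
    (fun j => fermiDag e f j (fermi e f (j + n) v)).HasFiniteSupport := by
  convert locFinite_hop e f n v using 2 with j
  have := fermiDag_mul_fermi e f n j
  rw [if_neg (by tauto), add_zero] at this
  rw [← this, Module.End.mul_apply]

theorem rho_neg_rho_apply (f : F) {n : ℤ} (hn : 0 < n) (v : Core ι) :
    rho e f (-n) (rho e f n v) = ∑ᶠ l, ∑ᶠ a, quartic e f v n l a := by
  rw [rho_apply_of_pos e f hn.ne', map_finsum_core (finite_fermiDag_fermi e f hn.ne' v)]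
  refine finsum_congr fun l => ?_
  rw [rho_apply_of_pos e f (by omega : -n ≠ 0)]
  -- The substitution `j = l + n + a` makes `a = 0` the term in which the second hop undoes the
  -- first.
  have := finsum_comp_equiv (Equiv.addLeft (l + n)) (f := fun j =>
    fermiDag e f j (fermi e f (j + -n) (fermiDag e f l (fermi e f (l + n) v))))
  rw [← this]
  refine finsum_congr fun a => ?_
  simp only [quartic, Equiv.coe_addLeft, add_right_comm l n a, add_neg_cancel_right]

/-- A hop of length at least `2 * A` cannot start below `A` and end at or above `-A`. -/
theorem rho_ket_eq_zero {S : Finset ι} {f : F} {n A : ℤ} (hn : 0 < n) (hA : 2 * A ≤ n)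
    (h : ∀ f j, (A ≤ j → ¬ Filled e S f j) ∧ (j < -A → Filled e S f j)) :
    rho e f n (ket S) = 0 := by
  rw [rho_apply_of_pos e f hn.ne']
  refine finsum_eq_zero_of_forall_eq_zero fun j => ?_
  by_cases hj : j < -A
  · rw [← neg_eq_iff_eq_neg.2 (fermi_fermiDag_apply e f (by omega : j + n ≠ j) _),
      fermiDag_ket ((h f j).2 hj)]
    simp
  · rw [fermi_ket ((h f (j + n)).1 (by omega)), map_zero]

theorem locFinite_rho_neg_rho (f : F) :
    LocFinite fun k : ℕ => rho e f (-(k + 1)) * rho e f (k + 1) := by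
  refine locFinite_of_ket fun S => ?_
  obtain ⟨A, hA, h⟩ := exists_filled_bound e S
  refine (Set.finite_Iio (2 * A).toNat).subset fun k hk => ?_
  by_contra hc
  refine hk ?_
  simp only [Set.mem_Iio, not_lt, Module.End.mul_apply] at hc ⊢
  rw [rho_ket_eq_zero e (by omega) (by omega) h, map_zero]

/-- The operator `∑ n > 0, rho (-n) * rho n`. -/
def level (f : F) : Module.End ℂ (Core ι) :=
  opSum fun k : ℕ => rho e f (-(k + 1)) * rho e f (k + 1)

open Classical in
/-- Kronig's identity: `∑ n > 0, rho (-n) * rho n` counts the pairs of an empty level below a filled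
one. -/
theorem level_ket (S : Finset ι) (f : F) : ∃ N : ℕ, level e f (ket S) = (N : ℂ) • ket S ∧
    (N = 0 → ∀ l n, 0 < n → Filled e S f (l + n) → Filled e S f l) := by
  obtain ⟨A, hA, h⟩ := exists_filled_bound e S
  -- Nonzero terms have `n < 2 * A` and `|a| < 2 * A`. One cutoff for both makes the double sums
  -- square, as the antisymmetry argument needs.
  obtain ⟨C, hC⟩ : ∃ C : ℕ, (C : ℤ) = 2 * A + 1 := ⟨(2 * A + 1).toNat, by omega⟩
  have hq : ∀ n l a : ℤ, 0 < n → quartic e f (ket S) n l a ≠ 0 → (-A ≤ l ∧ l + n < A) ∧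
      (-C ≤ a ∧ a ≤ C) := fun n l a hn hne => by
    rcases eq_or_ne a 0 with rfl | ha
    · rw [quartic_diag_ket S f l hn] at hne
      have h1 : ¬ Filled e S f l ∧ Filled e S f (l + n) := by
        by_contra hc
        rw [if_neg hc] at hne
        exact hne rfl
      have h2 := mt (h f l).2 h1.1
      have h3 : ¬ A ≤ l + n := fun hc => (h f _).1 hc h1.2
      omega
    · have := mt (quartic_ket_eq_zero hn ha h) hne
      omega
  have hl : ∀ n a : ℤ, 0 < n → (fun l => quartic e f (ket S) n l a).HasFiniteSupport :=
    fun n a hn => (Set.finite_Icc (-A) A).subset fun l hl => by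
      have := hq n l a hn hl
      exact ⟨by omega, by omega⟩
  set T : ℤ → ℤ → Core ι := fun n a => ∑ᶠ l, quartic e f (ket S) n l a with hT
  have h1 : ∀ n : ℤ, 0 < n → rho e f (-n) (rho e f n (ket S)) =
      ∑ a ∈ Finset.Icc (-(C : ℤ)) C, T n a := fun n hn => by
    rw [rho_neg_rho_apply e f hn, hT, ← finsum_sum_comm _ _ fun a _ => hl n a hn]
    refine finsum_congr fun l => finsum_eq_sum_of_support_subset _ fun a ha => ?_
    have := hq n l a hn ha
    rw [Finset.coe_Icc]
    exact this.2
  have h2 : level e f (ket S) = ∑ k ∈ Finset.range C, ∑ a ∈ Finset.Icc (-(C : ℤ)) C, T (k + 1) a := by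
    rw [level, opSum_apply (locFinite_rho_neg_rho e f),
      finsum_eq_sum_of_support_subset (s := Finset.range C)]
    · exact Finset.sum_congr rfl fun k _ => h1 _ (by omega)
    · intro k hk
      rw [Finset.coe_range, Set.mem_Iio]
      by_contra hc
      refine hk ?_
      simp only [Module.End.mul_apply]
      rw [rho_ket_eq_zero e (by omega) (by omega) h, map_zero]
  have hT1 : ∀ i j : ℕ, T (i + 1) (j + 1) = -T (j + 1) (i + 1) := fun i j => by
    simp only [hT]
    rw [← finsum_neg_distrib]
    exact finsum_congr fun l => quartic_swap e f _ l (by omega) (by omega)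
  have hT2 : ∀ i j : ℕ, T (i + 1) (-(j + 1)) = -T (j + 1) (-(i + 1)) := fun i j => by
    exact finsum_quartic_neg_swap e f _ (by omega) (by omega)
  have hfin : ∀ n : ℤ, 0 < n → {l | ¬ Filled e S f l ∧ Filled e S f (l + n)}.Finite := fun n hn =>
    (Set.finite_Icc (-A) A).subset fun l hl => by
      have h2 := mt (h f l).2 hl.1
      have h3 : ¬ A ≤ l + n := fun hc => (h f _).1 hc hl.2
      exact ⟨by omega, by omega⟩
  have hT0 : ∀ n : ℤ, 0 < n → T n 0 =
      ({l | ¬ Filled e S f l ∧ Filled e S f (l + n)}.ncard : ℂ) • ket S := fun n hn => by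
    simp only [hT, quartic_diag_ket S f _ hn]
    rw [finsum_eq_sum_of_support_subset (s := (hfin n hn).toFinset), Finset.sum_congr rfl
      (g := fun _ => ket S), Finset.sum_const, Set.ncard_eq_toFinset_card _ (hfin n hn),
      Nat.cast_smul_eq_nsmul]
    · intro l hl
      rw [if_pos]
      simpa using hl
    · intro l hl
      rw [Set.Finite.coe_toFinset]
      by_contra hc
      exact hl (if_neg hc)
  refine ⟨∑ k ∈ Finset.range C, {l | ¬ Filled e S f l ∧ Filled e S f (l + ((k : ℤ) + 1))}.ncard,
    ?_, fun h0 l n hn hf => ?_⟩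
  · rw [h2]
    simp only [sum_Icc_neg_eq, Finset.sum_add_distrib]
    -- Positive and negative offsets cancel; only the diagonal terms, which count inversions,
    -- survive.
    rw [sum_sum_eq_zero_of_antisymm _ (fun i j : ℕ => T (i + 1) (j + 1)) hT1,
      sum_sum_eq_zero_of_antisymm _ (fun i j : ℕ => T (i + 1) (-(j + 1))) hT2, add_zero, add_zero,
      Finset.sum_congr rfl fun (k : ℕ) _ => hT0 (k + 1) (by omega), ← Finset.sum_smul]
    push_cast
    rfl
  -- An inversion of length `n` would be counted in the summand `k = n - 1`, which lies below the
  -- cutoff `C`.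
  · by_contra hc
    have h3 : ¬ A ≤ l + n := fun hc => (h f _).1 hc hf
    have h4 := mt (h f l).2 hc
    have h5 := Finset.sum_eq_zero_iff.1 h0 (n - 1).toNat (by rw [Finset.mem_range]; omega)
    rw [show ((n - 1).toNat : ℤ) + 1 = n by omega, Set.ncard_eq_zero (hfin n hn)] at h5
    exact Set.eq_empty_iff_forall_notMem.1 h5 l ⟨hc, hf⟩

/-- Only the term `rho (-n) * rho n` fails to commute with `rho n`. So `rho e f n` lowers the
eigenvalue of `level e f` by `n`, which drives the induction below. -/
theorem level_mul_rho [DecidableEq F] (f g : F) {n : ℤ} (hn : 0 < n) :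
    level e f * rho e g n = rho e g n * level e f +
      if f = g then (-(n : ℂ)) • rho e g n else 0 := by
  have key : ∀ k : ℕ, rho e f (-(k + 1)) * rho e f (k + 1) * rho e g n =
      rho e g n * (rho e f (-(k + 1)) * rho e f (k + 1)) +
        if k = (n - 1).toNat then (if f = g then (-(n : ℂ)) • rho e g n else 0) else 0 := fun k => by
    have h1 := rho_mul_rho e f g (k + 1) n
    rw [if_neg (by omega), add_zero] at h1
    rw [mul_assoc, h1, ← mul_assoc, rho_mul_rho e f g _ n, add_mul, mul_assoc]
    congr 1
    by_cases hf : f = g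
    · subst hf
      by_cases hk : k = (n - 1).toNat
      · have : (k : ℤ) + 1 = n := by omega
        rw [this]
        simp [hk]
      · rw [if_neg (by omega), if_neg hk, zero_mul]
    · simp [hf]
  rw [level, opSum_mul_eq (locFinite_rho_neg_rho e f) key, opSum_single]

/-! ### Generation from Fermi seas and uniqueness of boson-free vectors -/

/-- A subspace which contains the filled Fermi seas and which is invariant under the density
operators is the whole space. -/
theorem eq_top_of_rho_invariant [Fintype F] (W : Submodule ℂ (Core ι))
    (hρ : ∀ f n, 0 < n → ∀ v ∈ W, rho e f (-n) v ∈ W)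
    (hg : ∀ (S : Finset ι) (ν : F → ℤ), (∀ f j, Filled e S f j ↔ j < ν f) → ket S ∈ W) : W = ⊤ := by
  classical
  choose inv hinv hinv0 using level_ket e
  have hlev : ∀ f v S, level e f v S = inv S f * v S := fun f v S => by
    induction v using core_induction with
    | ket U =>
      rw [hinv]
      by_cases h : U = S
      · subst h; simp
      · simp [ket, h]
    | add v w hv hw => simp only [map_add, Finsupp.add_apply, hv, hw]; ring
    | smul z v hv => simp only [map_smul, Finsupp.smul_apply, hv, smul_eq_mul]; ring
  -- Strong induction on the total number of inversions; `inv S f` is the eigenvalue of `level e f`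
  -- on `ket S`.
  have key : ∀ (N : ℕ) S, ∑ f, inv S f = N → ket S ∈ W := fun N => by
    induction N using Nat.strong_induction_on with
    | _ N ih =>
    intro S hS
    by_cases h0 : ∀ f, inv S f = 0
    · obtain ⟨A, hA, h⟩ := exists_filled_bound e S
      have : ∀ f, ∃ ν : ℤ, ∀ j, Filled e S f j ↔ j < ν := fun f => by
        -- Without inversions nothing is filled above the least empty level, so that level is the
        -- Fermi level.
        obtain ⟨ν, hν, hmin⟩ := Int.exists_least_of_bdd (P := fun j => ¬ Filled e S f j)
          ⟨-A, fun z hz => not_lt.1 fun hc => hz ((h f z).2 hc)⟩ ⟨A, (h f A).1 le_rfl⟩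
        refine ⟨ν, fun j => ⟨fun hj => ?_, fun hj => ?_⟩⟩
        · by_contra hc
          rcases (not_lt.1 hc).eq_or_lt with rfl | hlt
          · exact hν hj
          · exact hν (hinv0 S f (h0 f) ν (j - ν) (by omega) (by rwa [add_sub_cancel]))
        · by_contra hc
          exact absurd (hmin j hc) (by omega)
      choose ν hν using this
      exact hg S ν hν
    · push Not at h0
      obtain ⟨f, hf⟩ := h0
      have h1 : ∀ n, 0 < n → rho e f n (ket S) ∈ W := fun n hn => by
        set u := rho e f n (ket S) with hu
        have h2 : ∀ U, u U ≠ 0 → ket U ∈ W := fun U hU => by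
          -- Comparing the components at `U` in the relation of `level_mul_rho` shows that every `U`
          -- occurring in `u` has `n` inversions of flavor `f` fewer.
          have h3 : ∀ g, (inv U g : ℂ) = inv S g - if g = f then (n : ℂ) else 0 := fun g => by
            refine mul_right_cancel₀ hU ?_
            rw [← hlev, hu, ← Module.End.mul_apply, level_mul_rho e g f hn, LinearMap.add_apply,
              Module.End.mul_apply, hinv]
            by_cases hgf : g = f
            · subst hgf
              simp only [if_true, map_smul, LinearMap.smul_apply, Finsupp.add_apply,
                Finsupp.smul_apply, smul_eq_mul]
              ring
            · simp [hgf]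
          have h4 : ∀ g, (inv U g : ℤ) = inv S g - if g = f then n else 0 := fun g => by
            have := h3 g
            split_ifs at this ⊢ <;> exact_mod_cast this
          refine ih (∑ g, inv U g) ?_ U rfl
          rw [← hS]
          refine Finset.sum_lt_sum (fun g _ => ?_) ⟨f, Finset.mem_univ _, ?_⟩
          · have := h4 g
            split_ifs at this <;> omega
          · have := h4 f
            rw [if_pos rfl] at this
            omega
        rw [← Finsupp.sum_single u]
        refine W.sum_mem fun U hU => ?_
        have : Finsupp.single U (u U) = u U • ket U := by simp [ket]
        rw [this]
        exact W.smul_mem _ (h2 U (Finsupp.mem_support_iff.1 hU))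
      -- The lowered states `rho n (ket S)` lie in `W` by induction, so applying `rho (-n)` and
      -- summing gives a nonzero multiple of `ket S` in `W`.
      have h2 : level e f (ket S) ∈ W := by
        rw [level, opSum_apply (locFinite_rho_neg_rho e f)]
        refine finsum_induction (· ∈ W) W.zero_mem (fun _ _ => W.add_mem) fun k => ?_
        exact hρ f _ (by omega) _ (h1 _ (by omega))
      rw [hinv] at h2
      exact (W.smul_mem_iff (Nat.cast_ne_zero.2 hf)).1 h2
  rw [eq_top_iff]
  intro v _
  induction v using core_induction with
  | ket S => exact key _ S rfl
  | add v w hv hw => exact W.add_mem (hv trivial) (hw trivial)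
  | smul z v hv => exact W.smul_mem z (hv trivial)

/-- A vector with definite charges that is annihilated by all density operators with positive
momentum is a multiple of a filled Fermi sea. -/
theorem eq_smul_ket_of_rho_eq_zero {v : Core ι} {ν : F → ℤ}
    (h : ∀ f n, 0 < n → rho e f n v = 0) (hc : ∀ f, rho e f 0 v = (ν f : ℂ) • v) {S : Finset ι}
    (hS : ∀ f j, Filled e S f j ↔ j < ν f) : v = v S • ket S := by
  classical
  ext U
  by_cases hU : U = S
  · subst hU; simp [ket]
  have hz : v U = 0 := by
    by_contra hne
    refine hU (filled_injective e fun f j => ?_)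
    obtain ⟨N, hN, hN0⟩ := level_ket e U f
    -- By self-adjointness and `level e f v = 0`, every `U` in the support of `v` has no inversions,
    -- hence is a Fermi sea in each flavor.
    have hadj : IsAdj (level e f) (level e f) := by
      refine IsAdj.opSum (fun k => ?_) (locFinite_rho_neg_rho e f) (locFinite_rho_neg_rho e f)
      have h1 := isAdj_rho e f (-((k : ℤ) + 1))
      rw [neg_neg] at h1
      exact h1.mul (isAdj_rho e f (k + 1))
    have h1 : level e f v = 0 := by
      rw [level, opSum_apply (locFinite_rho_neg_rho e f)]
      refine finsum_eq_zero_of_forall_eq_zero fun k => ?_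
      rw [Module.End.mul_apply, h f _ (by omega), map_zero]
    have h2 := hadj (ket U) v
    rw [h1, hN, map_zero, inner_zero_right, map_smul, inner_smul_left, inner_ket_left] at h2
    have h3 : N = 0 := by simpa [hne] using h2
    obtain ⟨A, hA, hb⟩ := exists_filled_bound e U
    obtain ⟨μ, hμ, hmin⟩ := Int.exists_least_of_bdd (P := fun j => ¬ Filled e U f j)
      ⟨-A, fun z hz => not_lt.1 fun hc => hz ((hb f z).2 hc)⟩ ⟨A, (hb f A).1 le_rfl⟩
    have hth : ∀ j, Filled e U f j ↔ j < μ := fun j => by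
      refine ⟨fun hj => ?_, fun hj => ?_⟩
      · by_contra hc
        rcases (not_lt.1 hc).eq_or_lt with rfl | hlt
        · exact hμ hj
        · exact hμ (hN0 h3 μ (j - μ) (by omega) (by rwa [add_sub_cancel]))
      · by_contra hc
        exact absurd (hmin j hc) (by omega)
    -- The charge, self-adjoint too, then fixes the Fermi level.
    have h4 := isAdj_rho e f 0 (ket U) v
    rw [neg_zero, rho_zero_ket e hth, hc, map_smul, map_smul, inner_smul_left, inner_smul_right,
      inner_ket_left, map_intCast] at h4
    have h5 : μ = ν f := by exact_mod_cast mul_right_cancel₀ hne h4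
    rw [hth, hS, h5]
  rw [hz]
  simp [ket, Ne.symm hU]

end Chiral
end Fock

namespace Fock

variable {ι : Type}

theorem normalOrder_smul (z : ℂ) (T : Module.End ℂ (Core ι)) :
    normalOrder (z • T) = z • normalOrder T := by
  refine LinearMap.ext fun v => ?_
  simp only [normalOrder, vev, LinearMap.sub_apply, LinearMap.smul_apply, map_smul,
    inner_smul_right, Module.End.one_apply]
  module

theorem normalOrder_add (T U : Module.End ℂ (Core ι)) :
    normalOrder (T + U) = normalOrder T + normalOrder U := by
  refine LinearMap.ext fun v => ?_
  simp only [normalOrder, vev, LinearMap.sub_apply, LinearMap.smul_apply, LinearMap.add_apply,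
    map_add, inner_add_right, Module.End.one_apply]
  module

theorem normalOrder_sum {κ : Type*} (s : Finset κ) (T : κ → Module.End ℂ (Core ι)) :
    normalOrder (∑ i ∈ s, T i) = ∑ i ∈ s, normalOrder (T i) := by
  classical
  induction s using Finset.induction_on with
  | empty => simpa using normalOrder_smul 0 (0 : Module.End ℂ (Core ι))
  | insert i s hi ih => rw [Finset.sum_insert hi, Finset.sum_insert hi, normalOrder_add, ih]

end Fock

/-! ### Momenta, lattice points and discrete Fourier sums -/

namespace Nodal
open Fock

/-- The integers `i` with `-M ≤ 2 i + c < M`. -/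
def window (M : ℕ) (c : ℤ) : Finset ℤ := Finset.Ico (-((M + c) / 2)) (-((M + c) / 2) + M)

theorem mem_window {M : ℕ} {c i : ℤ} : i ∈ window M c ↔ -M ≤ 2 * i + c ∧ 2 * i + c < M := by
  rw [window, Finset.mem_Ico]
  omega

theorem card_window (M : ℕ) (c : ℤ) : (window M c).card = M := by
  rw [window, Int.card_Ico]
  omega

/-- A geometric sum over `M` consecutive powers of an `M`-th root of unity, which is not `1` when `0
< |d| < M`; the starting point only gives a common phase. -/
theorem sum_exp_window {M : ℕ} (hM : 0 < M) (c : ℤ) {d : ℤ} (hd : |d| < M) :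
    ∑ i ∈ window M c, Complex.exp (Complex.I * (2 * Real.pi * (i + c / 2) * d / M)) =
      if d = 0 then (M : ℂ) else 0 := by
  have hM0 : (M : ℂ) ≠ 0 := Nat.cast_ne_zero.2 hM.ne'
  split_ifs with h
  · subst h
    simp [card_window]
  set ζ := Complex.exp (2 * Real.pi * Complex.I * (d / M)) with hζ
  have h1 : ζ ≠ 1 := by
    rw [hζ, Ne, Complex.exp_eq_one_iff]
    rintro ⟨n, hn⟩
    have h2 : (2 * Real.pi * Complex.I : ℂ) ≠ 0 := Complex.two_pi_I_ne_zero
    rw [mul_comm (n : ℂ), mul_right_inj' h2, div_eq_iff hM0] at hn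
    have h3 : d = n * M := by exact_mod_cast hn
    refine h (Int.eq_zero_of_abs_lt_dvd (m := M) ⟨n, by rw [h3, mul_comm]⟩ hd)
  have hζM : ζ ^ M = 1 := by
    rw [hζ, ← Complex.exp_nat_mul, Complex.exp_eq_one_iff]
    exact ⟨d, by field_simp⟩
  have h2 : ∀ k : ℕ, Complex.exp (Complex.I * (2 * Real.pi * (((-((M + c) / 2) + k : ℤ) : ℂ) +
      c / 2) * d / M)) = Complex.exp (Complex.I * (2 * Real.pi * (((-((M + c) / 2) : ℤ) : ℂ) +
      c / 2) * d / M)) * ζ ^ k := fun k => by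
    rw [hζ, ← Complex.exp_nat_mul, ← Complex.exp_add]
    congr 1
    push_cast
    ring
  rw [window, Int.Ico_eq_finset_map, Finset.sum_map]
  simp only [Function.Embedding.trans_apply, Nat.castEmbedding_apply, addLeftEmbedding_apply, h2]
  rw [← Finset.mul_sum, add_sub_cancel_left, Int.toNat_natCast]
  have h3 := mul_geom_sum ζ M
  rw [hζM, sub_self] at h3
  rw [(mul_eq_zero.1 h3).resolve_left (sub_ne_zero.2 h1), mul_zero]

section Momenta

variable {L a : ℝ} {M : ℕ}

theorem pi_div_eq (hL : 0 < L) (ha : 0 < a) (hM : L = M * a) :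
    Real.pi / a = 2 * Real.pi / L * (M / 2) := by
  have : (M : ℝ) ≠ 0 := by
    rintro h
    rw [h, zero_mul] at hM
    exact hL.ne' hM
  rw [hM]
  field_simp

/-- For `L = M a` the zone boundary is `M / 2` in units of `2π/L`. Doubled inequalities treat even
and odd `M` alike; `c = 0` is for boson and `c = 1` for fermion momenta. -/
theorem momentum_mem_iff (hL : 0 < L) (ha : 0 < a) (hM : L = M * a) (i c : ℤ) :
    (-(Real.pi / a) ≤ 2 * Real.pi / L * (i + c / 2) ∧ 2 * Real.pi / L * (i + c / 2) < Real.pi / a) ↔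
      i ∈ window M c := by
  have hp : 0 < 2 * Real.pi / L := by positivity
  rw [pi_div_eq hL ha hM, ← mul_neg, mul_le_mul_iff_right₀ hp, mul_lt_mul_iff_right₀ hp, mem_window]
  have e1 : (-(M / 2 : ℝ) ≤ i + c / 2) ↔ (-(M : ℝ) ≤ 2 * i + c) := by
    constructor <;> intro h <;> linarith
  have e2 : ((i : ℝ) + c / 2 < M / 2) ↔ (2 * i + c < (M : ℝ)) := by
    constructor <;> intro h <;> linarith
  rw [e1, e2]
  norm_cast

/-- The points of `lattice L a`. -/
def latticeEquiv (ha : 0 < a) (hM : L = M * a) : window M 0 ≃ lattice L a :=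
  Equiv.ofBijective (fun i => ⟨a * (i : ℤ), ⟨⟨i, rfl⟩, by
    have h := mem_window.1 i.2
    have h1 : (-(M : ℝ) ≤ 2 * (i : ℤ) + 0) ∧ (2 * (i : ℤ) + 0 < (M : ℝ)) := by exact_mod_cast h
    constructor <;> nlinarith⟩⟩) (by
    constructor
    · intro i j h
      have : a * ((i : ℤ) : ℝ) = a * ((j : ℤ) : ℝ) := congrArg Subtype.val h
      exact Subtype.ext (by exact_mod_cast mul_left_cancel₀ ha.ne' this)
    · rintro ⟨_, ⟨j, rfl⟩, h1, h2⟩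
      refine ⟨⟨j, mem_window.2 ?_⟩, rfl⟩
      have h1 : (-(M : ℝ) ≤ 2 * (j : ℤ) + 0) ∧ (2 * (j : ℤ) + 0 < (M : ℝ)) := by
        constructor
        · refine le_of_mul_le_mul_left ?_ ha
          linarith
        · refine lt_of_mul_lt_mul_left ?_ ha.le
          linarith
      exact_mod_cast h1)

theorem latticeEquiv_apply (ha : 0 < a) (hM : L = M * a) (i : window M 0) :
    (latticeEquiv ha hM i : ℝ) = a * (i : ℤ) := rfl

/-- The points of `zeroModeMomenta L a`. -/
def zeroModeEquiv (hL : 0 < L) (ha : 0 < a) (hM : L = M * a) : window M 0 ≃ zeroModeMomenta L a :=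
  Equiv.ofBijective (fun i => ⟨2 * Real.pi / L * (i : ℤ), ⟨⟨i, rfl⟩, by
    simpa using (momentum_mem_iff hL ha hM i 0).2 i.2⟩⟩) (by
    have hp : 0 < 2 * Real.pi / L := by positivity
    constructor
    · intro i j h
      have : 2 * Real.pi / L * ((i : ℤ) : ℝ) = 2 * Real.pi / L * ((j : ℤ) : ℝ) :=
        congrArg Subtype.val h
      exact Subtype.ext (by exact_mod_cast mul_left_cancel₀ hp.ne' this)
    · rintro ⟨_, ⟨j, rfl⟩, h⟩
      exact ⟨⟨j, (momentum_mem_iff hL ha hM j 0).1 (by simpa using h)⟩, rfl⟩)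

theorem zeroModeEquiv_apply (hL : 0 < L) (ha : 0 < a) (hM : L = M * a) (i : window M 0) :
    (zeroModeEquiv hL ha hM i : ℝ) = 2 * Real.pi / L * (i : ℤ) := rfl

theorem abs_sub_lt_of_mem_window {c i j : ℤ} (hi : i ∈ window M c) (hj : j ∈ window M c) :
    |i - j| < M := by
  rw [mem_window] at hi hj
  rw [abs_lt]
  omega

theorem natCast_pos_of_eq (hL : 0 < L) (hM : L = M * a) : 0 < M := by
  rcases M.eq_zero_or_pos with rfl | h
  · simp at hM; exact absurd hM hL.ne'
  · exact h

theorem sum_exp_momentum (hL : 0 < L) (ha : 0 < a) (hM : L = M * a) (c : ℤ) (x y : lattice L a) :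
    ∑ i ∈ window M c, Complex.exp (Complex.I * ((2 * Real.pi / L * (i + c / 2) : ℝ) : ℂ) *
      ((x : ℝ) - (y : ℝ) : ℂ)) = open Classical in if x = y then (M : ℂ) else 0 := by
  classical
  obtain ⟨i, rfl⟩ := (latticeEquiv ha hM).surjective x
  obtain ⟨j, rfl⟩ := (latticeEquiv ha hM).surjective y
  have hM' := natCast_pos_of_eq hL hM
  have hM0 : (M : ℂ) ≠ 0 := Nat.cast_ne_zero.2 hM'.ne'
  have ha0 : (a : ℂ) ≠ 0 := Complex.ofReal_ne_zero.2 ha.ne'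
  rw [if_congr (EmbeddingLike.apply_eq_iff_eq _) rfl rfl]
  refine Eq.trans (Finset.sum_congr rfl fun k _ => ?_) ((sum_exp_window hM' c
    (abs_sub_lt_of_mem_window i.2 j.2)).trans (if_congr ?_ rfl rfl))
  · congr 1
    rw [latticeEquiv_apply, latticeEquiv_apply, hM]
    push_cast
    field_simp
  · rw [sub_eq_zero, Subtype.ext_iff]

theorem sum_exp_zeroMode [Fintype (zeroModeMomenta L a)] (hL : 0 < L) (ha : 0 < a) (hM : L = M * a)
    (x y : lattice L a) : ∑ q : zeroModeMomenta L a, Complex.exp (Complex.I * ((q : ℝ) : ℂ) *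
      ((x : ℝ) - (y : ℝ) : ℂ)) = open Classical in if x = y then (M : ℂ) else 0 := by
  have h := sum_exp_momentum hL ha hM 0 x y
  rw [← Finset.sum_coe_sort] at h
  rw [← h, ← (zeroModeEquiv hL ha hM).sum_comp]
  refine Finset.sum_congr rfl fun i _ => ?_
  rw [zeroModeEquiv_apply]
  simp

theorem sum_exp_lattice [Fintype (lattice L a)] (hL : 0 < L) (ha : 0 < a) (hM : L = M * a)
    (q q' : zeroModeMomenta L a) : ∑ x : lattice L a, Complex.exp (Complex.I *
      ((q : ℝ) - (q' : ℝ) : ℂ) * ((x : ℝ) : ℂ)) =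
        open Classical in if q = q' then (M : ℂ) else 0 := by
  classical
  obtain ⟨i, rfl⟩ := (zeroModeEquiv hL ha hM).surjective q
  obtain ⟨j, rfl⟩ := (zeroModeEquiv hL ha hM).surjective q'
  have hM' := natCast_pos_of_eq hL hM
  have hM0 : (M : ℂ) ≠ 0 := Nat.cast_ne_zero.2 hM'.ne'
  have ha0 : (a : ℂ) ≠ 0 := Complex.ofReal_ne_zero.2 ha.ne'
  rw [if_congr (EmbeddingLike.apply_eq_iff_eq _) rfl rfl, ← (latticeEquiv ha hM).sum_comp]
  have := sum_exp_window hM' 0 (abs_sub_lt_of_mem_window i.2 j.2)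
  rw [← Finset.sum_coe_sort] at this
  refine Eq.trans (Finset.sum_congr rfl fun k _ => ?_) (this.trans (if_congr ?_ rfl rfl))
  · congr 1
    rw [latticeEquiv_apply, zeroModeEquiv_apply, zeroModeEquiv_apply, hM]
    push_cast
    field_simp
    ring
  · rw [sub_eq_zero, Subtype.ext_iff]

end Momenta

section Levels

variable {L a : ℝ}

theorem units_cast_eq (r : ℤˣ) : (((r : ℤ) : ℝ) = 1) ∨ (((r : ℤ) : ℝ) = -1) := by
  rcases Int.units_eq_one_or r with rfl | rfl <;> simp

theorem units_cast_mul_self (r : ℤˣ) : ((r : ℤ) : ℝ) * ((r : ℤ) : ℝ) = 1 := by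
  rcases units_cast_eq r with h | h <;> rw [h] <;> norm_num

theorem levelMomentum_mem (L : ℝ) (r : ℤˣ) (j : ℤ) :
    ((r : ℤ) : ℝ) * (2 * Real.pi / L * (j + 1 / 2)) ∈ fermiMomenta L := by
  rcases units_cast_eq r with h | h <;> rw [h]
  · exact ⟨j, by ring⟩
  · exact ⟨-j - 1, by push_cast; ring⟩

/-- The modes, labelled by the flavor and the integer `j` with `r k = 2π / L (j + 1/2)`. -/
def levels (a : ℝ) (hL : 0 < L) : Flavor L a × ℤ ≃ Mode L a :=
  Equiv.ofBijective (fun x => ⟨x.1, ⟨_, levelMomentum_mem L x.1.r x.2⟩⟩) (by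
    have hp : 0 < 2 * Real.pi / L := by positivity
    constructor
    · rintro ⟨f, j⟩ ⟨g, i⟩ h
      rw [Mode.mk.injEq, Subtype.mk.injEq] at h
      obtain ⟨rfl, h⟩ := h
      have hr : ((f.r : ℤ) : ℝ) ≠ 0 := left_ne_zero_of_mul_eq_one (units_cast_mul_self f.r)
      have := mul_left_cancel₀ hp.ne' (mul_left_cancel₀ hr h)
      have h2 : (j : ℝ) = i := by simpa using this
      rw [show j = i by exact_mod_cast h2]
    · rintro ⟨f, k, j, rfl⟩
      rcases Int.units_eq_one_or f.r with h | h
      · refine ⟨⟨f, j⟩, Mode.ext rfl (Subtype.ext ?_)⟩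
        simp [h]
      · refine ⟨⟨f, -j - 1⟩, Mode.ext rfl (Subtype.ext ?_)⟩
        simp [h]
        ring)

theorem levels_apply (hL : 0 < L) (f : Flavor L a) (j : ℤ) :
    levels a hL (f, j) = ⟨f, ⟨_, levelMomentum_mem L f.r j⟩⟩ := rfl

/-- The chirality in the labelling cancels `r` in the condition `r k > 0`, so both chiralities have
the same Dirac sea `j < 0`. -/
theorem zero_lt_levels_iff (hL : 0 < L) (f : Flavor L a) (j : ℤ) :
    0 < (((levels a hL (f, j)).flavor.r : ℤ) : ℝ) * (levels a hL (f, j)).k ↔ 0 ≤ j := by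
  have hp : 0 < 2 * Real.pi / L := by positivity
  rw [levels_apply]
  simp only
  rw [← mul_assoc, units_cast_mul_self, one_mul, mul_pos_iff_of_pos_left hp]
  constructor
  · intro h
    by_contra! hc
    have : (j : ℝ) ≤ -1 := by exact_mod_cast (by omega : j ≤ -1)
    linarith
  · intro h
    have : (0 : ℝ) ≤ j := by exact_mod_cast h
    linarith

theorem c_levels (hL : 0 < L) (f : Flavor L a) (j : ℤ) :
    c (levels a hL (f, j)) = fermi (levels a hL) f j := by
  unfold c fermi
  exact if_congr (zero_lt_levels_iff hL f j) rfl rfl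

theorem cDag_levels (hL : 0 < L) (f : Flavor L a) (j : ℤ) :
    cDag (levels a hL (f, j)) = fermiDag (levels a hL) f j := by
  unfold cDag fermiDag
  exact if_congr (zero_lt_levels_iff hL f j) rfl rfl

end Levels

end Nodal

/-! ### Nodal densities as Fourier sums of one-dimensional densities -/

namespace Nodal
open Fock

section Density

variable {L a : ℝ} {M : ℕ}

theorem units_ne_neg (s : ℤˣ) : s ≠ -s := by
  rcases Int.units_eq_one_or s with rfl | rfl <;> decide

theorem units_eq_or_eq_neg (s t : ℤˣ) : t = s ∨ t = -s := by
  rcases Int.units_eq_one_or t with rfl | rfl <;> rcases Int.units_eq_one_or s with rfl | rfl <;>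
    simp

theorem units_sum_eq {N : Type*} [AddCommMonoid N] (s : ℤˣ) (f : ℤˣ → N) :
    ∑ t, f t = f s + f (-s) := by
  rcases Int.units_eq_one_or s with rfl | rfl
  · exact Finset.sum_pair (by decide)
  · rw [neg_neg, add_comm]
    exact Finset.sum_pair (by decide)

theorem nodal_ext {s : ℤˣ} {k k' : ℤˣ → ℝ} (h : k s = k' s) (h' : k (-s) = k' (-s)) : k = k' := by
  funext t
  rcases units_eq_or_eq_neg s t with rfl | rfl
  · exact h
  · exact h'

/-- The momentum in `nodalMomenta L a s` with components labelled by `j` and `i`. -/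
def nodalMomentum (L : ℝ) (r s : ℤˣ) (j i : ℤ) : ℤˣ → ℝ := fun t =>
  if t = s then ((r : ℤ) : ℝ) * (2 * Real.pi / L * (j + 1 / 2)) else 2 * Real.pi / L * (i + 1 / 2)

theorem nodalMomentum_self (L : ℝ) (r s : ℤˣ) (j i : ℤ) :
    nodalMomentum L r s j i s = ((r : ℤ) : ℝ) * (2 * Real.pi / L * (j + 1 / 2)) := if_pos rfl

theorem nodalMomentum_neg (L : ℝ) (r s : ℤˣ) (j i : ℤ) :
    nodalMomentum L r s j i (-s) = 2 * Real.pi / L * (i + 1 / 2) := if_neg (units_ne_neg s).symm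

theorem nodalMomentum_mem_iff (hL : 0 < L) (ha : 0 < a) (hM : L = M * a) (r s : ℤˣ) (j i : ℤ) :
    nodalMomentum L r s j i ∈ nodalMomenta L a s ↔ i ∈ window M 1 := by
  have h := momentum_mem_iff hL ha hM i 1
  rw [Int.cast_one] at h
  rw [nodalMomenta, Set.mem_ofPred_eq, nodalMomentum_neg, h]
  refine and_iff_right fun t => ?_
  rcases units_eq_or_eq_neg s t with rfl | rfl
  · rw [nodalMomentum_self]
    exact levelMomentum_mem L r j
  · rw [nodalMomentum_neg]
    exact ⟨i, rfl⟩

/-- The elements of `nodalMomenta L a s`. -/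
def nodalEquiv (hL : 0 < L) (ha : 0 < a) (hM : L = M * a) (r s : ℤˣ) :
    ℤ × window M 1 ≃ nodalMomenta L a s :=
  Equiv.ofBijective (fun x => ⟨nodalMomentum L r s x.1 x.2,
    (nodalMomentum_mem_iff hL ha hM r s _ _).2 x.2.2⟩) (by
    have hp : 0 < 2 * Real.pi / L := by positivity
    have hr : ((r : ℤ) : ℝ) ≠ 0 := left_ne_zero_of_mul_eq_one (units_cast_mul_self r)
    constructor
    · rintro ⟨j, i⟩ ⟨j', i'⟩ h
      have h0 : nodalMomentum L r s j i = nodalMomentum L r s j' i' := congrArg Subtype.val h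
      have h1 := congrFun h0 s
      have h2 := congrFun h0 (-s)
      rw [nodalMomentum_self, nodalMomentum_self] at h1
      rw [nodalMomentum_neg, nodalMomentum_neg] at h2
      have h1 := add_right_cancel (mul_left_cancel₀ hp.ne' (mul_left_cancel₀ hr h1))
      have h2 := add_right_cancel (mul_left_cancel₀ hp.ne' h2)
      rw [Prod.mk.injEq]
      exact ⟨by exact_mod_cast h1, Subtype.ext (by exact_mod_cast h2)⟩
    · rintro ⟨k, hk⟩
      obtain ⟨i, hi⟩ := hk.1 (-s)
      obtain ⟨j, hj⟩ : ∃ j : ℤ, k s = ((r : ℤ) : ℝ) * (2 * Real.pi / L * (j + 1 / 2)) := by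
        obtain ⟨j, hj⟩ := hk.1 s
        rcases units_cast_eq r with h | h
        · exact ⟨j, by rw [hj, h, one_mul]⟩
        · exact ⟨-j - 1, by rw [hj, h]; push_cast; ring⟩
      have e : k = nodalMomentum L r s j i :=
        nodal_ext (hj.trans (nodalMomentum_self L r s j i).symm)
          (hi.trans (nodalMomentum_neg L r s j i).symm)
      subst e
      exact ⟨⟨j, i, (nodalMomentum_mem_iff hL ha hM r s j i).1 hk⟩, rfl⟩)

theorem nodalEquiv_self (hL : 0 < L) (ha : 0 < a) (hM : L = M * a) (r s : ℤˣ)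
    (x : ℤ × window M 1) : (nodalEquiv hL ha hM r s x).1 s =
      ((r : ℤ) : ℝ) * (2 * Real.pi / L * (x.1 + 1 / 2)) := nodalMomentum_self _ _ _ _ _

theorem nodalEquiv_neg (hL : 0 < L) (ha : 0 < a) (hM : L = M * a) (r s : ℤˣ)
    (x : ℤ × window M 1) : (nodalEquiv hL ha hM r s x).1 (-s) =
      2 * Real.pi / L * ((x.2 : ℤ) + 1 / 2) := nodalMomentum_neg _ _ _ _ _

/-- Exactly one reciprocal lattice vector folds `k₁ + p` back into the half-open zone of width
`2π/a`, so `k₁` determines `k₂` and `n`. -/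
theorem transfer_fst_bijective (hL : 0 < L) (ha : 0 < a) (hM : L = M * a) (s : ℤˣ) {p : ℤˣ → ℝ}
    (hp : ∀ t, ∃ j : ℤ, p t = 2 * Real.pi / L * j) :
    Function.Bijective fun t : transfer L a s p => t.1.1 := by
  have hc : 0 < Real.pi / a := by positivity
  have hw : ∀ n : ℤ, 2 * Real.pi * n / a = 2 * (Real.pi / a) * n := fun n => by ring
  have hw' : ∀ n : ℤ, 2 * Real.pi * n / a = 2 * Real.pi / L * (M * n : ℤ) := fun n => by
    rw [hw, pi_div_eq hL ha hM]
    push_cast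
    ring
  constructor
  · rintro ⟨⟨k, k', n⟩, h⟩ ⟨⟨l, l', n'⟩, h'⟩ (e : k = l)
    subst e
    have h0 : k'.1 + Pi.single (-s) (2 * Real.pi * n / a) =
      l'.1 + Pi.single (-s) (2 * Real.pi * n' / a) := h.symm.trans h'
    have h1 := congrFun h0 (-s)
    have h2 := congrFun h0 s
    simp only [Pi.add_apply, Pi.single_eq_same, Pi.single_eq_of_ne (units_ne_neg s), add_zero, hw]
      at h1 h2
    have hn : n = n' := by
      have b1 := k'.2.2.1
      have b2 := k'.2.2.2
      have b3 := l'.2.2.1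
      have b4 := l'.2.2.2
      have c1 : (n : ℝ) - n' < 1 := by
        by_contra! hcon
        nlinarith
      have c2 : (n' : ℝ) - n < 1 := by
        by_contra! hcon
        nlinarith
      have c1 : n - n' < 1 := by exact_mod_cast c1
      have c2 : n' - n < 1 := by exact_mod_cast c2
      omega
    subst hn
    have : k' = l' := Subtype.ext (nodal_ext h2 (add_right_cancel h1))
    subst this
    rfl
  · intro k
    set y := k.1 (-s) + p (-s) with hy
    -- The number of full zone widths by which `y` lies above the lower boundary `-π/a`.
    set n : ℤ := ⌊(y + Real.pi / a) / (2 * (Real.pi / a))⌋ with hn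
    have h1 : (n : ℝ) * (2 * (Real.pi / a)) ≤ y + Real.pi / a := by
      rw [← le_div_iff₀ (by positivity)]
      exact Int.floor_le _
    have h2 : y + Real.pi / a < (n + 1) * (2 * (Real.pi / a)) := by
      rw [← div_lt_iff₀ (by positivity)]
      exact Int.lt_floor_add_one _
    have hmem : k.1 + p - Pi.single (-s) (2 * Real.pi * n / a) ∈ nodalMomenta L a s := by
      refine ⟨fun t => ?_, ?_, ?_⟩
      · obtain ⟨j, hj⟩ := k.2.1 t
        obtain ⟨i, hi⟩ := hp t
        rcases units_eq_or_eq_neg s t with rfl | rfl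
        · refine ⟨j + i, ?_⟩
          simp only [Pi.sub_apply, Pi.add_apply, Pi.single_eq_of_ne (units_ne_neg t), hj, hi]
          push_cast
          ring
        · refine ⟨j + i - M * n, ?_⟩
          simp only [Pi.sub_apply, Pi.add_apply, Pi.single_eq_same, hj, hi, hw']
          push_cast
          ring
      · simp only [Pi.sub_apply, Pi.add_apply, Pi.single_eq_same, ← hy, hw]
        linarith
      · simp only [Pi.sub_apply, Pi.add_apply, Pi.single_eq_same, ← hy, hw]
        linarith
    exact ⟨⟨⟨k, ⟨_, hmem⟩, n⟩, (sub_add_cancel _ _).symm⟩, rfl⟩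

/-- The matrix `(σ⁰ + α σ³) / 2` is the projection onto the spin component `α`. -/
theorem half_bilinear (r s α : ℤˣ) (k₁ k₂ : nodalMomenta L a s) :
    (1 / 2 : ℂ) • (bilinear σ₀ r s k₁ k₂ + ((α : ℤ) : ℂ) • bilinear σ₃ r s k₁ k₂) =
      (((2 * Real.pi / L) ^ 2 : ℝ) : ℂ) • normalOrder (ψDag r s α k₁ * ψ r s α k₂) := by
  have h0 : (α : ℤ) * (α : ℤ) = 1 := by
    rw [← Units.val_mul, Int.units_mul_self, Units.val_one]
  have h1 : ((α : ℤ) : ℂ) * ((α : ℤ) : ℂ) = 1 := by exact_mod_cast h0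
  have h2 : (((-α : ℤˣ) : ℤ) : ℂ) = -((α : ℤ) : ℂ) := by simp
  unfold bilinear
  simp only [units_sum_eq α, σ₀, σ₃, if_true, if_neg (units_ne_neg α), if_neg (units_ne_neg α).symm,
    mul_zero, zero_smul, mul_one, add_zero, zero_add, h2]
  generalize normalOrder (ψDag r s α k₁ * ψ r s α k₂) = X
  generalize normalOrder (ψDag r s (-α) k₁ * ψ r s (-α) k₂) = Y
  generalize ((((2 * Real.pi / L) ^ 2 : ℝ)) : ℂ) = w
  simp only [smul_add, smul_smul]
  rw [show 1 / 2 * (((α : ℤ) : ℂ) * (w * ((α : ℤ) : ℂ))) = 1 / 2 * w by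
      linear_combination (1 / 2 * w) * h1,
    show 1 / 2 * (((α : ℤ) : ℂ) * (w * -((α : ℤ) : ℂ))) = -(1 / 2 * w) by
      linear_combination -(1 / 2 * w) * h1]
  module

theorem density_ket (hL : 0 < L) (ha : 0 < a) (r s α : ℤˣ) (p : ℤˣ → ℝ) (S : Finset (Mode L a)) :
    (fun t : transfer L a s p => ((((2 * Real.pi / L) ^ 2 : ℝ) : ℂ) •
      normalOrder (ψDag r s α t.1.1 * ψ r s α t.1.2.1)) (ket S)).HasFiniteSupport ∧
    density r s α p (ket S) = ∑ᶠ t : transfer L a s p, ((((2 * Real.pi / L) ^ 2 : ℝ) : ℂ) •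
      normalOrder (ψDag r s α t.1.1 * ψ r s α t.1.2.1)) (ket S) := by
  have h0 : (fun t : transfer L a s p => bilinear σ₀ r s t.1.1 t.1.2.1 (ket S)).HasFiniteSupport :=
    (finite_support_J hL ha σ₀ r s p S).1
  have h3 : (fun t : transfer L a s p => bilinear σ₃ r s t.1.1 t.1.2.1 (ket S)).HasFiniteSupport :=
    (finite_support_J hL ha σ₃ r s p S).1
  have h3' : (fun t : transfer L a s p =>
      ((α : ℤ) : ℂ) • bilinear σ₃ r s t.1.1 t.1.2.1 (ket S)).HasFiniteSupport :=
    Set.Finite.subset h3 fun t ht => right_ne_zero_of_smul ht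
  simp only [← half_bilinear, LinearMap.smul_apply, LinearMap.add_apply]
  constructor
  · exact Set.Finite.subset (h0.fun_add h3') fun t ht => right_ne_zero_of_smul ht
  · rw [← smul_finsum, finsum_add_distrib h0 h3', ← smul_finsum]
    simp [density, J, ket]

theorem normalOrder_ψDag_mul_ψ [Fintype (lattice L a)] (hL : 0 < L) (r s α : ℤˣ)
    (k₁ k₂ : nodalMomenta L a s) {j n : ℤ}
    (h₁ : k₁.1 s = ((r : ℤ) : ℝ) * (2 * Real.pi / L * (j + 1 / 2)))
    (h₂ : k₂.1 s = ((r : ℤ) : ℝ) * (2 * Real.pi / L * ((j + n : ℤ) + 1 / 2))) :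
    normalOrder (ψDag r s α k₁ * ψ r s α k₂) = ∑ x : lattice L a, ∑ y : lattice L a,
      (((L / (2 * Real.pi) * √(a / L) : ℝ) : ℂ) ^ 2 * (Complex.exp (Complex.I * (k₁.1 (-s) : ℂ) *
        (x : ℂ)) * Complex.exp (-(Complex.I * (k₂.1 (-s) : ℂ) * (y : ℂ))))) •
      normalOrder (fermiDag (levels a hL) ⟨r, s, α, x⟩ j * fermi (levels a hL) ⟨r, s, α, y⟩ (j + n)) := by
  have e1 : ∀ x : lattice L a, cDag ⟨⟨r, s, α, x⟩, ⟨k₁.1 s, k₁.2.1 s⟩⟩ =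
      fermiDag (levels a hL) ⟨r, s, α, x⟩ j := fun x => by
    rw [← cDag_levels, levels_apply]
    congr 3
  have e2 : ∀ y : lattice L a, c ⟨⟨r, s, α, y⟩, ⟨k₂.1 s, k₂.2.1 s⟩⟩ =
      fermi (levels a hL) ⟨r, s, α, y⟩ (j + n) := fun x => by
    rw [← c_levels, levels_apply]
    congr 3
  unfold ψ ψDag
  simp only [finsum_eq_sum_of_fintype, e1, e2]
  rw [smul_mul_smul_comm, Finset.sum_mul_sum, normalOrder_smul, normalOrder_sum, Finset.smul_sum]
  refine Finset.sum_congr rfl fun x _ => ?_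
  rw [normalOrder_sum, Finset.smul_sum]
  refine Finset.sum_congr rfl fun y _ => ?_
  rw [smul_mul_smul_comm, normalOrder_smul, smul_smul, sq]

/-- On lattice points `y = a j` the umklapp phase `exp(2πi n j)` is one. -/
theorem exp_transfer (ha : 0 < a) {s : ℤˣ} {p : ℤˣ → ℝ} (t : transfer L a s p) (y : lattice L a) :
    Complex.exp (-(Complex.I * (t.1.2.1.1 (-s) : ℂ) * (y : ℂ))) =
      Complex.exp (-(Complex.I * (t.1.1.1 (-s) : ℂ) * (y : ℂ))) *
        Complex.exp (-(Complex.I * (p (-s) : ℂ) * (y : ℂ))) := by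
  obtain ⟨⟨k, k', n⟩, h⟩ := t
  obtain ⟨j, hj⟩ := y.2.1
  have h1 := congrFun (show k.1 + p = k'.1 + Pi.single (-s) (2 * Real.pi * n / a) from h) (-s)
  simp only [Pi.add_apply, Pi.single_eq_same] at h1
  have h2 : (k'.1 (-s) : ℂ) = k.1 (-s) + p (-s) - 2 * Real.pi * n / a := by
    rw [eq_sub_iff_add_eq]
    exact_mod_cast h1.symm
  have ha0 : (a : ℂ) ≠ 0 := Complex.ofReal_ne_zero.2 ha.ne'
  rw [← Complex.exp_add, Complex.exp_eq_exp_iff_exists_int]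
  refine ⟨n * j, ?_⟩
  simp only [h2, hj]
  push_cast
  field_simp
  ring

/-- The densities are discrete Fourier transforms of the 1D densities. -/
theorem density_eq [Fintype (lattice L a)] (hL : 0 < L) (ha : 0 < a) (hM : L = M * a) (r s α : ℤˣ)
    {p : ℤˣ → ℝ} (hp : ∀ t, ∃ j : ℤ, p t = 2 * Real.pi / L * j) {n : ℤ}
    (hn : p s = ((r : ℤ) : ℝ) * (2 * Real.pi / L * n)) :
    density r s α p = ∑ x : lattice L a, Complex.exp (-(Complex.I * (p (-s) : ℂ) * (x : ℂ))) •
      rho (levels a hL) ⟨r, s, α, x⟩ n := by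
  classical
  have hM' := natCast_pos_of_eq hL hM
  have hM0 : (M : ℂ) ≠ 0 := Nat.cast_ne_zero.2 hM'.ne'
  -- The prefactors combine to `a / L = 1 / M`, the normalization of a sum over `M` momenta.
  have hc : (((2 * Real.pi / L) ^ 2 * (L / (2 * Real.pi) * √(a / L)) ^ 2 : ℝ) : ℂ) = 1 / M := by
    have : (2 * Real.pi / L) ^ 2 * (L / (2 * Real.pi) * √(a / L)) ^ 2 = 1 / M := by
      have hM1 : (M : ℝ) ≠ 0 := Nat.cast_ne_zero.2 hM'.ne'
      rw [mul_pow, Real.sq_sqrt (by positivity)]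
      field_simp
      rw [hM]
      ring
    rw [this]
    push_cast
    rfl
  refine ext_ket fun S => ?_
  obtain ⟨hfin, hsum⟩ := density_ket hL ha r s α p S
  -- Triples are labelled by the two components of `k₁`: `j` for the direction `s` and `i` for the
  -- direction `-s`.
  set E := (nodalEquiv hL ha hM r s).trans
    (Equiv.ofBijective _ (transfer_fst_bijective hL ha hM s hp)).symm with hE
  have hE1 : ∀ x, (E x).1.1 = nodalEquiv hL ha hM r s x := fun x =>
    (Equiv.ofBijective _ (transfer_fst_bijective hL ha hM s hp)).apply_symm_apply _
  have hE2 : ∀ x, (E x).1.2.1.1 s = ((r : ℤ) : ℝ) * (2 * Real.pi / L * ((x.1 + n : ℤ) + 1 / 2)) :=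
    fun x => by
      have := transfer_s (E x)
      rw [hE1, nodalEquiv_self, hn] at this
      push_cast
      linarith
  rw [hsum, ← finsum_comp_equiv E]
  refine (finsum_curry _ (hfin.comp_of_injective E.injective)).trans ?_
  have key : ∀ j : ℤ, ∑ᶠ i : window M 1, ((((2 * Real.pi / L) ^ 2 : ℝ) : ℂ) •
      normalOrder (ψDag r s α (E (j, i)).1.1 * ψ r s α (E (j, i)).1.2.1)) (ket S) =
      ∑ x : lattice L a, Complex.exp (-(Complex.I * (p (-s) : ℂ) * (x : ℂ))) •
        hop (levels a hL) ⟨r, s, α, x⟩ n j (ket S) := fun j => by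
    rw [finsum_eq_sum_of_fintype, ← LinearMap.sum_apply]
    have h1 : ∀ i : window M 1, (((2 * Real.pi / L) ^ 2 : ℝ) : ℂ) •
        normalOrder (ψDag r s α (E (j, i)).1.1 * ψ r s α (E (j, i)).1.2.1) =
        ∑ x : lattice L a, ∑ y : lattice L a, Complex.exp (Complex.I *
          ((2 * Real.pi / L * ((i : ℤ) + (1 : ℤ) / 2) : ℝ) : ℂ) * ((x : ℝ) - (y : ℝ) : ℂ)) •
          (((1 / M : ℂ) * Complex.exp (-(Complex.I * (p (-s) : ℂ) * (y : ℂ)))) •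
          normalOrder (fermiDag (levels a hL) ⟨r, s, α, x⟩ j *
            fermi (levels a hL) ⟨r, s, α, y⟩ (j + n))) := fun i => by
      rw [normalOrder_ψDag_mul_ψ hL r s α _ _ (by rw [hE1, nodalEquiv_self]) (hE2 (j, i)),
        Finset.smul_sum]
      refine Finset.sum_congr rfl fun x _ => ?_
      rw [Finset.smul_sum]
      refine Finset.sum_congr rfl fun y _ => ?_
      rw [smul_smul, smul_smul, exp_transfer ha, hE1, nodalEquiv_neg, ← mul_assoc, ← mul_assoc,
        ← mul_assoc, ← mul_assoc, ← Complex.ofReal_pow, ← Complex.ofReal_mul, hc]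
      congr 1
      rw [mul_assoc (1 / M : ℂ), ← Complex.exp_add, mul_comm (1 / M : ℂ)]
      congr 3
      push_cast
      ring
    have h2 : ∑ i : window M 1, (((2 * Real.pi / L) ^ 2 : ℝ) : ℂ) •
        normalOrder (ψDag r s α (E (j, i)).1.1 * ψ r s α (E (j, i)).1.2.1) =
        ∑ x : lattice L a, Complex.exp (-(Complex.I * (p (-s) : ℂ) * (x : ℂ))) •
          hop (levels a hL) ⟨r, s, α, x⟩ n j := by
      simp only [h1]
      -- The sum over `i` is done first; it gives `M` for `x = y` and zero otherwise, leaving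
      -- densities at a single lattice point.
      rw [Finset.sum_comm]
      refine Finset.sum_congr rfl fun x _ => ?_
      rw [Finset.sum_comm]
      simp only [← Finset.sum_smul]
      rw [Finset.sum_eq_single x]
      · rw [Finset.sum_coe_sort (window M 1) fun i : ℤ => Complex.exp (Complex.I *
          ((2 * Real.pi / L * (i + (1 : ℤ) / 2) : ℝ) : ℂ) * ((x : ℝ) - (x : ℝ) : ℂ)),
          sum_exp_momentum hL ha hM 1, if_pos rfl, normalOrder_fermiDag_fermi, smul_smul]
        congr 1
        field_simp
      · intro y _ hy
        rw [Finset.sum_coe_sort (window M 1) fun i : ℤ => Complex.exp (Complex.I *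
          ((2 * Real.pi / L * (i + (1 : ℤ) / 2) : ℝ) : ℂ) * ((x : ℝ) - (y : ℝ) : ℂ)),
          sum_exp_momentum hL ha hM 1, if_neg hy.symm, zero_smul]
      · simp
    rw [h2]
    simp
  refine (finsum_congr key).trans ?_
  have hfin' : ∀ x : lattice L a, (fun j => Complex.exp (-(Complex.I * (p (-s) : ℂ) * (x : ℂ))) •
      hop (levels a hL) ⟨r, s, α, x⟩ n j (ket S)).HasFiniteSupport := fun x =>
    Set.Finite.subset (locFinite_hop (levels a hL) _ n (ket S)) fun j hj => right_ne_zero_of_smul hj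
  rw [finsum_sum_comm _ _ fun x _ => hfin' x, LinearMap.sum_apply]
  refine Finset.sum_congr rfl fun x _ => ?_
  rw [← smul_finsum, LinearMap.smul_apply, rho, opSum_apply (locFinite_hop _ _ n)]

end Density

end Nodal

/-! ### Zero modes and canonical commutation relations of the bosons -/

namespace Nodal
open Fock

section Bosons

variable {L a : ℝ} {M : ℕ}

/-- Fourier inversion on the lattice: the square roots multiply to `a`, and `a / L` cancels the `M`
coming from the sum over momenta. -/
theorem zeroMode_eq_rho (hL : 0 < L) (ha : 0 < a) (hM : L = M * a) (f : Flavor L a) :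
    zeroMode f = rho (levels a hL) f 0 := by
  classical
  have := finite_lattice (L := L) ha
  have := Fintype.ofFinite (lattice L a)
  have := Fintype.ofEquiv _ (zeroModeEquiv hL ha hM)
  have hM' := natCast_pos_of_eq hL hM
  have hM0 : (M : ℂ) ≠ 0 := Nat.cast_ne_zero.2 hM'.ne'
  have ha0 : (a : ℂ) ≠ 0 := Complex.ofReal_ne_zero.2 ha.ne'
  have hL0 : (L : ℂ) = M * a := by rw [hM]; push_cast; rfl
  have hd : ∀ q : zeroModeMomenta L a, density f.r f.s f.α (Pi.single (-f.s) (q : ℝ)) =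
      ∑ y : lattice L a, Complex.exp (-(Complex.I * ((q : ℝ) : ℂ) * (y : ℂ))) •
        rho (levels a hL) ⟨f.r, f.s, f.α, y⟩ 0 := fun q => by
    have h1 : ∀ t, ∃ j : ℤ, (Pi.single (-f.s) (q : ℝ) : ℤˣ → ℝ) t = 2 * Real.pi / L * j := fun t => by
      rcases units_eq_or_eq_neg f.s t with rfl | rfl
      · exact ⟨0, by rw [Pi.single_eq_of_ne (units_ne_neg _)]; simp⟩
      · rw [Pi.single_eq_same]
        exact q.2.1
    rw [density_eq hL ha hM f.r f.s f.α (n := 0) h1, Pi.single_eq_same]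
    rw [Pi.single_eq_of_ne (units_ne_neg _)]; simp
  have hs : (((√(2 * Real.pi * a)) * √(a / (2 * Real.pi)) : ℝ) : ℂ) = a := by
    rw [← Real.sqrt_mul (by positivity), show 2 * Real.pi * a * (a / (2 * Real.pi)) = a * a by
      field_simp, Real.sqrt_mul_self ha.le]
  unfold zeroMode zeroModeHat
  simp only [finsum_eq_sum_of_fintype, hd, Finset.smul_sum, smul_smul]
  rw [Finset.sum_comm]
  simp only [← Finset.sum_smul]
  rw [Finset.sum_eq_single f.x]
  · have h := sum_exp_zeroMode hL ha hM f.x f.x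
    rw [if_pos rfl] at h
    have : ∀ q : zeroModeMomenta L a, ((√(2 * Real.pi * a) : ℝ) : ℂ) * (1 / L * Complex.exp
        (Complex.I * q * f.x) * (((√(a / (2 * Real.pi)) : ℝ) : ℂ) *
        Complex.exp (-(Complex.I * q * f.x)))) =
        a / L * Complex.exp (Complex.I * ((q : ℝ) : ℂ) * ((f.x : ℝ) - (f.x : ℝ) : ℂ)) := fun q => by
      rw [← hs, mul_sub, sub_eq_add_neg, Complex.exp_add]
      push_cast
      ring
    simp only [this]
    rw [← Finset.mul_sum, h, hL0]
    have : (a : ℂ) / (M * a) * M = 1 := by field_simp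
    rw [this, one_smul]
  · intro y _ hy
    have h := sum_exp_zeroMode hL ha hM f.x y
    rw [if_neg hy.symm] at h
    have : ∀ q : zeroModeMomenta L a, ((√(2 * Real.pi * a) : ℝ) : ℂ) * (1 / L * Complex.exp
        (Complex.I * q * f.x) * (((√(a / (2 * Real.pi)) : ℝ) : ℂ) *
        Complex.exp (-(Complex.I * q * y)))) =
        a / L * Complex.exp (Complex.I * ((q : ℝ) : ℂ) * ((f.x : ℝ) - (y : ℝ) : ℂ)) := fun q => by
      rw [← hs, mul_sub, sub_eq_add_neg, Complex.exp_add]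
      push_cast
      ring
    simp only [this]
    rw [← Finset.mul_sum, h, mul_zero, zero_smul]
  · simp

/-- The chirality of the densities that make up `b m`. -/
def BosonMode.chirality (m : BosonMode L a) : ℤˣ := if 0 < m.ps then 1 else -1

/-- The positive integer `n` with `|p_s| = 2π / L n`. -/
def BosonMode.index (m : BosonMode L a) : ℤ := |(m.p.2.1 m.s).choose|

theorem BosonMode.ps_eq (hL : 0 < L) (m : BosonMode L a) :
    m.ps = ((m.chirality : ℤ) : ℝ) * (2 * Real.pi / L * m.index) := by
  have hp : 0 < 2 * Real.pi / L := by positivity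
  have h : m.ps = _ := (m.p.2.1 m.s).choose_spec
  unfold chirality index
  generalize (m.p.2.1 m.s).choose = j at h
  split_ifs with h0
  · rw [h, mul_pos_iff_of_pos_left hp] at h0
    rw [h, abs_of_pos (by exact_mod_cast h0)]
    simp
  · rw [h, mul_pos_iff_of_pos_left hp, not_lt] at h0
    rw [h, abs_of_nonpos (by exact_mod_cast h0)]
    simp

theorem BosonMode.index_pos (m : BosonMode L a) : 0 < m.index := by
  have h : m.ps = _ := (m.p.2.1 m.s).choose_spec
  have h0 : m.ps ≠ 0 := m.p.2.2.2
  unfold index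
  rw [abs_pos]
  intro hj
  rw [hj] at h
  simp [h] at h0

theorem BosonMode.abs_ps (hL : 0 < L) (m : BosonMode L a) :
    |m.ps| = 2 * Real.pi / L * m.index := by
  have h1 : (0 : ℝ) < m.index := by exact_mod_cast m.index_pos
  have h2 : |((m.chirality : ℤ) : ℝ)| = 1 := by
    rcases units_cast_eq m.chirality with h | h <;> simp [h]
  rw [m.ps_eq hL, abs_mul, h2, one_mul, abs_of_pos (by positivity)]

/-- The coefficients of `b m` in terms of the 1D densities. -/
def BosonMode.coeff (m : BosonMode L a) (x : lattice L a) : ℂ :=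
  (-((m.chirality : ℤ) : ℂ) * (Complex.I / L) * (√(2 * Real.pi * a / |m.ps|) : ℝ)) *
    Complex.exp (-(Complex.I * (m.p.1 (-m.s) : ℂ) * (x : ℂ)))

/-- The factor `1 / (M n)` is what is needed against the Schwinger term `n` at each of the `M`
lattice points. -/
theorem BosonMode.normSq_prefactor (hL : 0 < L) (ha : 0 < a) (hM : L = M * a) (m : BosonMode L a) :
    (-((m.chirality : ℤ) : ℂ) * (Complex.I / L) * (√(2 * Real.pi * a / |m.ps|) : ℝ)) *
      (starRingEnd ℂ) (-((m.chirality : ℤ) : ℂ) * (Complex.I / L) *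
        (√(2 * Real.pi * a / |m.ps|) : ℝ)) = 1 / (M * m.index) := by
  have h0 : (((m.chirality : ℤ) : ℝ) : ℂ) * (((m.chirality : ℤ) : ℝ) : ℂ) = 1 := by
    rw [← Complex.ofReal_mul, units_cast_mul_self, Complex.ofReal_one]
  have h1 : (0 : ℝ) < m.index := by exact_mod_cast m.index_pos
  have hM' := natCast_pos_of_eq hL hM
  have hM0 : (M : ℂ) ≠ 0 := Nat.cast_ne_zero.2 hM'.ne'
  have h1' : (m.index : ℂ) ≠ 0 := by exact_mod_cast h1.ne'
  have hL0 : (L : ℂ) ≠ 0 := Complex.ofReal_ne_zero.2 hL.ne'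
  have ha0 : (a : ℂ) ≠ 0 := Complex.ofReal_ne_zero.2 ha.ne'
  have h2 : ((√(2 * Real.pi * a / |m.ps|) : ℝ) : ℂ) * ((√(2 * Real.pi * a / |m.ps|) : ℝ) : ℂ) =
      L * a / m.index := by
    rw [← Complex.ofReal_mul, Real.mul_self_sqrt (by positivity), m.abs_ps hL]
    push_cast
    have : (Real.pi : ℂ) ≠ 0 := Complex.ofReal_ne_zero.2 Real.pi_ne_zero
    field_simp
  simp only [Complex.ofReal_intCast] at h0
  simp only [map_mul, map_neg, map_div₀, Complex.conj_I, Complex.conj_ofReal, map_intCast]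
  generalize ((√(2 * Real.pi * a / |m.ps|) : ℝ) : ℂ) = w at h2
  generalize ((m.chirality : ℤ) : ℂ) = r at h0
  have h3 : -r * (Complex.I / L) * w * (-r * (-Complex.I / L) * w) = (w * w) * (r * r) *
      (-(Complex.I * Complex.I)) / (L * L) := by
    field_simp
  rw [h3, h2, h0, Complex.I_mul_I]
  have hL1 : (L : ℂ) = M * a := by rw [hM]; push_cast; rfl
  rw [hL1]
  field_simp

theorem b_eq [Fintype (lattice L a)] (hL : 0 < L) (ha : 0 < a) (hM : L = M * a)
    (m : BosonMode L a) : b m = ∑ x : lattice L a, m.coeff x •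
      rho (levels a hL) ⟨m.chirality, m.s, m.α, x⟩ m.index := by
  have h := density_eq hL ha hM m.chirality m.s m.α m.p.2.1 (m.ps_eq hL)
  have h1 : b m = (-((m.chirality : ℤ) : ℂ) * (Complex.I / L) *
      (√(2 * Real.pi * a / |m.ps|) : ℝ)) • density m.chirality m.s m.α m.p := by
    unfold b BosonMode.chirality
    split_ifs
    · simp
    · simp
  rw [h1, h, Finset.smul_sum]
  simp only [smul_smul, BosonMode.coeff]

theorem bDag_eq [Fintype (lattice L a)] (hL : 0 < L) (ha : 0 < a) (hM : L = M * a)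
    (m : BosonMode L a) : bDag m = ∑ x : lattice L a, (starRingEnd ℂ) (m.coeff x) •
      rho (levels a hL) ⟨m.chirality, m.s, m.α, x⟩ (-m.index) := by
  have h := isAdj_b hL ha m
  rw [b_eq hL ha hM m] at h
  exact h.unique (IsAdj.sum _ _ _ fun x => (isAdj_rho _ _ _).smul _)

theorem sum_rho_mul_sum_rho {F ι : Type} [LinearOrder ι] [DecidableEq F] (e : F × ℤ ≃ ι)
    {κ κ' : Type*} [Fintype κ] [Fintype κ'] (z : κ → ℂ) (w : κ' → ℂ) (f : κ → F) (g : κ' → F)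
    (n n' : ℤ) : (∑ x, z x • rho e (f x) n) * (∑ y, w y • rho e (g y) n') =
      (∑ y, w y • rho e (g y) n') * (∑ x, z x • rho e (f x) n) +
      (∑ x, ∑ y, z x * w y * if f x = g y ∧ n + n' = 0 then (n : ℂ) else 0) •
        (1 : Module.End ℂ (Core ι)) := by
  rw [Finset.sum_mul_sum, Finset.sum_mul_sum, Finset.sum_comm (s := Finset.univ (α := κ')),
    Finset.sum_smul, ← Finset.sum_add_distrib]
  refine Finset.sum_congr rfl fun x _ => ?_
  rw [Finset.sum_smul, ← Finset.sum_add_distrib]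
  refine Finset.sum_congr rfl fun y _ => ?_
  rw [smul_mul_smul_comm, smul_mul_smul_comm, rho_mul_rho, smul_add, mul_comm (w y)]
  congr 1
  split_ifs
  · rw [smul_smul]
  · simp

/-- Both densities carry positive indices, so the central term, which needs indices summing to zero,
is absent. -/
theorem b_mul_b (hL : 0 < L) (ha : 0 < a) (hM : L = M * a) (m m' : BosonMode L a) :
    b m * b m' = b m' * b m := by
  classical
  have := finite_lattice (L := L) ha
  have := Fintype.ofFinite (lattice L a)
  have h1 := m.index_pos
  have h2 := m'.index_pos
  have h3 : ¬ m.index + m'.index = 0 := by omega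
  rw [b_eq hL ha hM m, b_eq hL ha hM m', sum_rho_mul_sum_rho]
  simp [h3]

theorem bDag_mul_bDag (hL : 0 < L) (ha : 0 < a) (hM : L = M * a) (m m' : BosonMode L a) :
    bDag m * bDag m' = bDag m' * bDag m := by
  have h := (isAdj_b hL ha m').mul (isAdj_b hL ha m)
  rw [b_mul_b hL ha hM] at h
  exact h.unique ((isAdj_b hL ha m).mul (isAdj_b hL ha m'))

theorem zeroMode_mul_b (hL : 0 < L) (ha : 0 < a) (hM : L = M * a) (f : Flavor L a)
    (m : BosonMode L a) : zeroMode f * b m = b m * zeroMode f := by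
  classical
  have := finite_lattice (L := L) ha
  have := Fintype.ofFinite (lattice L a)
  have h1 := m.index_pos
  have h := sum_rho_mul_sum_rho (levels a hL) (κ := Unit) (fun _ => 1) m.coeff (fun _ => f)
    (fun x => ⟨m.chirality, m.s, m.α, x⟩) 0 m.index
  rw [← b_eq hL ha hM] at h
  simpa [zeroMode_eq_rho hL ha hM] using h

theorem isAdj_zeroMode (hL : 0 < L) (ha : 0 < a) (hM : L = M * a) (f : Flavor L a) :
    IsAdj (zeroMode f) (zeroMode f) := by
  rw [zeroMode_eq_rho hL ha hM]
  exact isAdj_rho _ _ 0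

theorem zeroMode_mul_bDag (hL : 0 < L) (ha : 0 < a) (hM : L = M * a) (f : Flavor L a)
    (m : BosonMode L a) : zeroMode f * bDag m = bDag m * zeroMode f := by
  have h := (isAdj_b hL ha m).mul (isAdj_zeroMode hL ha hM f)
  rw [← zeroMode_mul_b hL ha hM] at h
  exact h.unique ((isAdj_zeroMode hL ha hM f).mul (isAdj_b hL ha m))

theorem zeroMode_ext {q q' : ℤˣ → ℝ} {s : ℤˣ} (hq : q ∈ bosonMomenta L a s)
    (hq' : q' ∈ bosonMomenta L a s) (h : q s = q' s)
    (h' : (⟨q (-s), hq.1 _, hq.2.1⟩ : zeroModeMomenta L a) = ⟨q' (-s), hq'.1 _, hq'.2.1⟩) : q = q' :=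
  nodal_ext h (congrArg Subtype.val h')

open Classical in
/-- The canonical commutation relations of the bosons. -/
theorem b_mul_bDag (hL : 0 < L) (ha : 0 < a) (hM : L = M * a) (m m' : BosonMode L a) :
    b m * bDag m' = bDag m' * b m + if m = m' then 1 else 0 := by
  have := finite_lattice (L := L) ha
  have := Fintype.ofFinite (lattice L a)
  have hM' := natCast_pos_of_eq hL hM
  have hM0 : (M : ℂ) ≠ 0 := Nat.cast_ne_zero.2 hM'.ne'
  have h1 := m.index_pos
  have h1' : (m.index : ℂ) ≠ 0 := by exact_mod_cast h1.ne'
  rw [b_eq hL ha hM m, bDag_eq hL ha hM m', sum_rho_mul_sum_rho]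
  congr 1
  -- If these labels agree, the modes can differ only in `p_{-s}`, and orthogonality of the lattice
  -- sum decides. Otherwise each single central term vanishes.
  by_cases h : m.chirality = m'.chirality ∧ m.s = m'.s ∧ m.α = m'.α ∧ m.index = m'.index
  · obtain ⟨h2, h3, h4, h5⟩ := h
    have hps : m.ps = m'.ps := by rw [m.ps_eq hL, m'.ps_eq hL, h2, h5]
    obtain ⟨s, α, p, hp⟩ := m
    obtain ⟨s', α', p', hp'⟩ := m'
    dsimp only at h3 h4
    subst h3 h4
    have hsum := sum_exp_lattice hL ha hM (⟨p' (-s), hp'.1 _, hp'.2.1⟩ : zeroModeMomenta L a)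
      ⟨p (-s), hp.1 _, hp.2.1⟩
    have hA := BosonMode.normSq_prefactor hL ha hM ⟨s, α, p, hp⟩
    have hterm : ∀ x : lattice L a, BosonMode.coeff ⟨s, α, p, hp⟩ x *
        (starRingEnd ℂ) (BosonMode.coeff ⟨s, α, p', hp'⟩ x) =
        1 / (M * (BosonMode.index ⟨s, α, p, hp⟩ : ℂ)) *
          Complex.exp (Complex.I * ((p' (-s) : ℝ) - (p (-s) : ℝ) : ℂ) * ((x : ℝ) : ℂ)) := fun x => by
      rw [← hA]
      unfold BosonMode.coeff
      rw [← h2, ← hps, map_mul (starRingEnd ℂ) _ (Complex.exp _), ← Complex.exp_conj, mul_mul_mul_comm, ← Complex.exp_add]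
      congr 2
      simp only [map_neg, map_mul, Complex.conj_I, Complex.conj_ofReal]
      ring
    have hflav : ∀ x y : lattice L a, (((⟨BosonMode.chirality ⟨s, α, p, hp⟩, s, α, x⟩ : Flavor L a) =
        ⟨BosonMode.chirality ⟨s, α, p', hp'⟩, s, α, y⟩) ∧ BosonMode.index ⟨s, α, p, hp⟩ +
        -BosonMode.index ⟨s, α, p', hp'⟩ = 0) ↔ x = y := fun x y => by
      rw [Flavor.mk.injEq, h2, h5]
      simp
    simp only [hflav, mul_ite, mul_zero, Finset.sum_ite_eq, Finset.mem_univ, if_true, hterm]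
    rw [← Finset.sum_mul, ← Finset.mul_sum, hsum]
    by_cases hpp : p = p'
    · subst hpp
      rw [if_pos rfl, if_pos rfl]
      rw [show 1 / (M * (BosonMode.index ⟨s, α, p, hp⟩ : ℂ)) * M *
        (BosonMode.index ⟨s, α, p, hp⟩ : ℂ) = 1 by field_simp, one_smul]
    · rw [if_neg fun hh => hpp (zeroMode_ext hp hp' hps hh.symm), if_neg fun hh => hpp ?_]
      · simp
      · simpa using hh
  · rw [if_neg fun hh => h (by rw [hh]; simp)]
    rw [Finset.sum_eq_zero, zero_smul]
    intro x _
    refine Finset.sum_eq_zero fun y _ => ?_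
    rw [if_neg, mul_zero]
    rw [Flavor.mk.injEq]
    rintro ⟨⟨h2, h3, h4, -⟩, h5⟩
    exact h ⟨h2, h3, h4, by omega⟩

/-- The boson mode with given flavor indices and momentum. -/
def bosonMode (hL : 0 < L) (f : Flavor L a) {n : ℤ} (hn : 0 < n) (q : zeroModeMomenta L a) :
    BosonMode L a :=
  ⟨f.s, f.α, fun t => if t = f.s then ((f.r : ℤ) : ℝ) * (2 * Real.pi / L * n) else q, by
    have hp : 0 < 2 * Real.pi / L := by positivity
    have hr : ((f.r : ℤ) : ℝ) ≠ 0 := left_ne_zero_of_mul_eq_one (units_cast_mul_self f.r)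
    refine ⟨fun t => ?_, ?_, ?_⟩ <;> dsimp only
    · split_ifs
      · exact ⟨f.r * n, by push_cast; ring⟩
      · exact q.2.1
    · rw [if_neg (units_ne_neg _).symm]
      exact q.2.2
    · rw [if_pos rfl]
      have : (0 : ℝ) < n := by exact_mod_cast hn
      positivity⟩

theorem bosonMode_ps (hL : 0 < L) (f : Flavor L a) {n : ℤ} (hn : 0 < n) (q : zeroModeMomenta L a) :
    (bosonMode hL f hn q).ps = ((f.r : ℤ) : ℝ) * (2 * Real.pi / L * n) := if_pos rfl

theorem bosonMode_chirality (hL : 0 < L) (f : Flavor L a) {n : ℤ} (hn : 0 < n)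
    (q : zeroModeMomenta L a) : (bosonMode hL f hn q).chirality = f.r := by
  have hp : 0 < 2 * Real.pi / L * (n : ℝ) := by
    have : (0 : ℝ) < n := by exact_mod_cast hn
    positivity
  unfold BosonMode.chirality
  rw [bosonMode_ps]
  rcases Int.units_eq_one_or f.r with h | h
  · rw [h, if_pos (by simpa using hp)]
  · rw [h, if_neg (by push_cast; linarith)]

theorem bosonMode_index (hL : 0 < L) (f : Flavor L a) {n : ℤ} (hn : 0 < n)
    (q : zeroModeMomenta L a) : (bosonMode hL f hn q).index = n := by
  have hp : 0 < 2 * Real.pi / L := by positivity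
  have hr : ((f.r : ℤ) : ℝ) ≠ 0 := left_ne_zero_of_mul_eq_one (units_cast_mul_self f.r)
  have h := (bosonMode hL f hn q).ps_eq hL
  rw [bosonMode_chirality, bosonMode_ps] at h
  exact_mod_cast (mul_left_cancel₀ hp.ne' (mul_left_cancel₀ hr h)).symm

/-- Fourier inversion in `p_{-s}`. It passes invariance under the `bDag m` to the `rho (-n)`, and
vanishing of all `b m v` to vanishing of all `rho n v` for `n > 0`. -/
theorem exists_rho_eq_sum_b (hL : 0 < L) (ha : 0 < a) (hM : L = M * a) (f : Flavor L a) {n : ℤ}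
    (hn : 0 < n) : ∃ (s : Finset (BosonMode L a)) (z : BosonMode L a → ℂ),
      rho (levels a hL) f n = ∑ m ∈ s, z m • b m ∧
      rho (levels a hL) f (-n) = ∑ m ∈ s, (starRingEnd ℂ) (z m) • bDag m := by
  classical
  have := finite_lattice (L := L) ha
  have := Fintype.ofFinite (lattice L a)
  have := Fintype.ofEquiv _ (zeroModeEquiv hL ha hM)
  have hM' := natCast_pos_of_eq hL hM
  have hM0 : (M : ℂ) ≠ 0 := Nat.cast_ne_zero.2 hM'.ne'
  have hinj : Function.Injective (bosonMode hL f hn) := fun q q' h => by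
    have h1 : (bosonMode hL f hn q).p.1 (-f.s) = (bosonMode hL f hn q').p.1 (-f.s) := by rw [h]
    have h2 : ∀ q, (bosonMode hL f hn q).p.1 (-f.s) = q := fun q => if_neg (units_ne_neg _).symm
    rw [h2, h2] at h1
    exact Subtype.ext h1
  set A : ℂ := -((f.r : ℤ) : ℂ) * (Complex.I / L) *
    (√(2 * Real.pi * a / |((f.r : ℤ) : ℝ) * (2 * Real.pi / L * n)|) : ℝ) with hA
  have hA' : ∀ q, A = -(((bosonMode hL f hn q).chirality : ℤ) : ℂ) * (Complex.I / L) *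
      (√(2 * Real.pi * a / |(bosonMode hL f hn q).ps|) : ℝ) := fun q => by
    rw [bosonMode_chirality, bosonMode_ps]
  -- The square norm of `A` is `1 / (M n)`, seen at the boson mode with `p_{-s} = 0`.
  have hA0 : A ≠ 0 := by
    intro h0
    have q := zeroModeEquiv hL ha hM ⟨0, mem_window.2 (by omega)⟩
    have h1 := (bosonMode hL f hn q).normSq_prefactor hL ha hM
    rw [← hA' q, h0, zero_mul, bosonMode_index] at h1
    have : (n : ℂ) ≠ 0 := by exact_mod_cast hn.ne'
    have := one_div_ne_zero (mul_ne_zero hM0 this)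
    exact this h1.symm
  have hb : ∀ q, b (bosonMode hL f hn q) = ∑ y : lattice L a,
      (A * Complex.exp (-(Complex.I * ((q : ℝ) : ℂ) * (y : ℂ)))) •
        rho (levels a hL) ⟨f.r, f.s, f.α, y⟩ n := fun q => by
    rw [b_eq hL ha hM]
    refine Finset.sum_congr rfl fun y _ => ?_
    rw [BosonMode.coeff, ← hA', bosonMode_chirality, bosonMode_index]
    have h2 : (bosonMode hL f hn q).p.1 (-(bosonMode hL f hn q).s) = q :=
      if_neg (units_ne_neg _).symm
    rw [h2]
    rfl
  have key : rho (levels a hL) f n = ∑ q : zeroModeMomenta L a,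
      ((A * M)⁻¹ * Complex.exp (Complex.I * ((q : ℝ) : ℂ) * (f.x : ℂ))) • b (bosonMode hL f hn q) := by
    simp only [hb, Finset.smul_sum, smul_smul]
    rw [Finset.sum_comm]
    simp only [← Finset.sum_smul]
    have hterm : ∀ (y : lattice L a) (q : zeroModeMomenta L a), (A * M)⁻¹ *
        Complex.exp (Complex.I * ((q : ℝ) : ℂ) * (f.x : ℂ)) *
        (A * Complex.exp (-(Complex.I * ((q : ℝ) : ℂ) * (y : ℂ)))) =
        (M : ℂ)⁻¹ * Complex.exp (Complex.I * ((q : ℝ) : ℂ) * ((f.x : ℝ) - (y : ℝ) : ℂ)) :=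
      fun y q => by
        rw [mul_sub, sub_eq_add_neg, Complex.exp_add]
        field_simp
    simp only [hterm, ← Finset.mul_sum, sum_exp_zeroMode hL ha hM]
    rw [Finset.sum_eq_single f.x]
    · rw [if_pos rfl, inv_mul_cancel₀ hM0, one_smul]
    · intro y _ hy
      rw [if_neg hy.symm, mul_zero, zero_smul]
    · simp
  set z : BosonMode L a → ℂ := fun m => (A * M)⁻¹ *
    Complex.exp (Complex.I * ((m.p.1 (-f.s) : ℝ) : ℂ) * (f.x : ℂ)) with hz
  have key' : rho (levels a hL) f n =
      ∑ m ∈ Finset.univ.map ⟨bosonMode hL f hn, hinj⟩, z m • b m := by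
    rw [key, Finset.sum_map]
    refine Finset.sum_congr rfl fun q _ => ?_
    have h2 : (bosonMode hL f hn q).p.1 (-f.s) = q := if_neg (units_ne_neg _).symm
    simp only [hz, Function.Embedding.coeFn_mk, h2]
  refine ⟨_, z, key', ?_⟩
  have h := isAdj_rho (levels a hL) f n
  refine h.unique ?_
  rw [key']
  exact IsAdj.sum _ _ _ fun m => (isAdj_b hL ha m).smul _

end Bosons

end Nodal

/-! ### Boson occupation states -/

namespace Nodal
open Fock

/-- One modified factor contributes `x`, which commutes past the preceding factors to the front. -/
theorem list_prod_map_eq_mul {R κ : Type*} [Monoid R] {f f' : κ → R} {x : R} {m : κ}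
    (hx : ∀ k, Commute x (f k)) (hm : f' m = x * f m) (hne : ∀ k, k ≠ m → f' k = f k) {l : List κ}
    (hl : l.Nodup) (hml : m ∈ l) : (l.map f').prod = x * (l.map f).prod := by
  induction l with
  | nil => simp at hml
  | cons k l ih =>
    rw [List.nodup_cons] at hl
    rw [List.map_cons, List.map_cons, List.prod_cons, List.prod_cons]
    by_cases hk : k = m
    · subst hk
      have : l.map f' = l.map f := List.map_congr_left fun j hj => hne j fun h => hl.1 (h ▸ hj)
      rw [this, hm, mul_assoc]
    · rw [hne k hk, ih hl.2 ((List.mem_cons.1 hml).resolve_left (Ne.symm hk)), ← mul_assoc,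
        ← (hx k).eq, mul_assoc]

section

variable {L a : ℝ} {M : ℕ}

/-- The factors of `bosonProduct n`. -/
def bosonFactor (n : BosonMode L a → ℕ) (m : BosonMode L a) : Op L a :=
  ((1 / √((n m).factorial : ℝ) : ℝ) : ℂ) • (bDag m) ^ n m

/-- `bosonProduct n` for finitely supported `n`. -/
def bosonOp (N : BosonMode L a →₀ ℕ) : Op L a := bosonProduct N

theorem bosonOp_eq (N : BosonMode L a →₀ ℕ) :
    bosonOp N = (N.support.toList.map (bosonFactor N)).prod := by
  have h : (Function.support N).Finite := N.hasFiniteSupport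
  unfold bosonOp bosonProduct
  rw [dif_pos h]
  have : h.toFinset = N.support := by ext; simp
  rw [this]
  rfl

theorem bosonOp_zero : bosonOp (0 : BosonMode L a →₀ ℕ) = 1 := by
  rw [bosonOp_eq]
  simp

theorem commute_bosonFactor (hL : 0 < L) (ha : 0 < a) (hM : L = M * a) (n n' : BosonMode L a → ℕ)
    (m m' : BosonMode L a) : Commute (bosonFactor n m) (bosonFactor n' m') := by
  have h : Commute (bDag m) (bDag m') := bDag_mul_bDag hL ha hM m m'
  exact ((h.pow_pow _ _).smul_left _).smul_right _

theorem bosonOp_succ (hL : 0 < L) (ha : 0 < a) (hM : L = M * a) (N : BosonMode L a →₀ ℕ)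
    (m : BosonMode L a) : bosonOp (N + Finsupp.single m 1) =
      ((1 / √((N m : ℝ) + 1) : ℝ) : ℂ) • (bDag m * bosonOp N) := by
  classical
  set N' := N + Finsupp.single m 1 with hN'
  have hNm : N' m = N m + 1 := by simp [hN']
  have hNk : ∀ k, k ≠ m → N' k = N k := fun k hk => by simp [hN', hk.symm]
  have hx : ∀ k, Commute (((1 / √((N m : ℝ) + 1) : ℝ) : ℂ) • bDag m) (bosonFactor N k) := fun k => by
    have h : Commute (bDag m) (bDag k) := bDag_mul_bDag hL ha hM m k
    exact ((h.pow_right _).smul_right _).smul_left _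
  have hm : bosonFactor N' m = (((1 / √((N m : ℝ) + 1) : ℝ) : ℂ) • bDag m) * bosonFactor N m := by
    unfold bosonFactor
    rw [hNm, smul_mul_smul_comm, ← pow_succ', Nat.factorial_succ, ← Complex.ofReal_mul]
    congr 2
    rw [div_mul_div_comm, one_mul, ← Real.sqrt_mul (by positivity)]
    push_cast
    rfl
  have hne : ∀ k, k ≠ m → bosonFactor N' k = bosonFactor N k := fun k hk => by
    unfold bosonFactor
    rw [hNk k hk]
  rw [bosonOp_eq, bosonOp_eq, ← smul_mul_assoc]
  -- A newly occupied mode enlarges the support, whose list is then known only up to permutation;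
  -- commutativity of the factors absorbs this.
  by_cases hms : m ∈ N.support
  · have hs : N'.support = N.support := by
      ext k
      by_cases hk : k = m
      · subst hk
        simp only [Finsupp.mem_support_iff] at hms
        simp [hNm, hms]
      · simp [hNk k hk]
    rw [hs]
    exact list_prod_map_eq_mul hx hm hne (Finset.nodup_toList _) (Finset.mem_toList.2 hms)
  · have hs : N'.support = insert m N.support := by
      ext k
      by_cases hk : k = m
      · subst hk
        simp [hNm]
      · simp [hNk k hk, hk]
    have hperm := (Finset.toList_insert hms).map (bosonFactor N')
    rw [hs, hperm.prod_eq' ?_]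
    · rw [List.map_cons, List.prod_cons, hm]
      have h0 : bosonFactor (⇑N) m = 1 := by
        rw [Finsupp.notMem_support_iff] at hms
        simp [bosonFactor, hms]
      rw [h0, mul_one]
      congr 2
      refine List.map_congr_left fun k hk => hne k ?_
      rintro rfl
      exact hms (Finset.mem_toList.1 hk)
    · refine List.pairwise_of_forall_mem_list ?_
      intro x hx y hy
      obtain ⟨k, -, rfl⟩ := List.mem_map.1 hx
      obtain ⟨k', -, rfl⟩ := List.mem_map.1 hy
      exact commute_bosonFactor hL ha hM _ _ _ _

theorem occupation_induction {κ : Type*} {P : (κ →₀ ℕ) → Prop} (zero : P 0)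
    (succ : ∀ N m, P N → P (N + Finsupp.single m 1)) (N : κ →₀ ℕ) : P N := by
  induction N using Finsupp.induction with
  | zero => exact zero
  | single_add m k N _ _ ih =>
    rw [add_comm]
    clear * - ih succ
    induction k with
    | zero => simpa using ih
    | succ k ihk =>
      rw [Finsupp.single_add, ← add_assoc]
      exact succ _ _ ihk

theorem bDag_bosonOp (hL : 0 < L) (ha : 0 < a) (hM : L = M * a) (N : BosonMode L a →₀ ℕ)
    (m : BosonMode L a) (g : Core (Mode L a)) : bDag m (bosonOp N g) =
      ((√((N m : ℝ) + 1) : ℝ) : ℂ) • bosonOp (N + Finsupp.single m 1) g := by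
  have h0 : √((N m : ℝ) + 1) ≠ 0 := (Real.sqrt_pos.2 (by positivity)).ne'
  rw [bosonOp_succ hL ha hM, LinearMap.smul_apply, smul_smul, ← Complex.ofReal_mul,
    mul_one_div_cancel h0, Complex.ofReal_one, one_smul]
  rfl

/-- For `N m = 0` the truncated subtraction does not undo the addition, but then the coefficient
vanishes. -/
theorem sqrt_smul_bosonOp_sub_add (N : BosonMode L a →₀ ℕ) (m : BosonMode L a)
    (g : Core (Mode L a)) : (((√(N m : ℝ) : ℝ) : ℂ) *
      ((√((((N - Finsupp.single m 1 : BosonMode L a →₀ ℕ) m : ℕ) : ℝ) + 1) : ℝ) : ℂ)) •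
      bosonOp (N - Finsupp.single m 1 + Finsupp.single m 1) g = (N m : ℂ) • bosonOp N g := by
  rcases Nat.eq_zero_or_pos (N m) with h | h
  · simp [h]
  · have e2 : N - Finsupp.single m 1 + Finsupp.single m 1 = N := by
      refine tsub_add_cancel_of_le ?_
      rw [Finsupp.single_le_iff]
      exact h
    have e3 : ((((N - Finsupp.single m 1 : BosonMode L a →₀ ℕ) m : ℕ) : ℝ) + 1) = N m := by
      rw [Finsupp.tsub_apply, Finsupp.single_eq_same]
      exact_mod_cast Nat.sub_add_cancel h
    rw [e2, e3, ← Complex.ofReal_mul, Real.mul_self_sqrt (by positivity)]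
    simp

theorem b_bosonOp (hL : 0 < L) (ha : 0 < a) (hM : L = M * a) {g : Core (Mode L a)}
    (hg : ∀ m, b m g = 0) (N : BosonMode L a →₀ ℕ) (m : BosonMode L a) : b m (bosonOp N g) =
      ((√(N m : ℝ) : ℝ) : ℂ) • bosonOp (N - Finsupp.single m 1) g := by
  classical
  induction N using occupation_induction generalizing m with
  | zero => rw [bosonOp_zero]; simp [hg]
  | succ N k ih =>
    have h0 : √((N k : ℝ) + 1) ≠ 0 := (Real.sqrt_pos.2 (by positivity)).ne'
    have h0' : ((√((N k : ℝ) + 1) : ℝ) : ℂ) ≠ 0 := Complex.ofReal_ne_zero.2 h0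
    -- Multiplying by `√(N k + 1)` replaces the state with one more boson by `bDag k (bosonOp N g)`,
    -- past which `b m` can be commuted.
    refine smul_right_injective _ h0' ?_
    dsimp only
    rw [← map_smul, ← bDag_bosonOp hL ha hM, ← Module.End.mul_apply, b_mul_bDag hL ha hM,
      LinearMap.add_apply, Module.End.mul_apply, ih]
    by_cases hmk : m = k
    · subst hmk
      rw [if_pos rfl, add_tsub_cancel_right, map_smul, bDag_bosonOp hL ha hM, smul_smul,
        smul_smul]
      rw [sqrt_smul_bosonOp_sub_add, Finsupp.add_apply, Finsupp.single_eq_same, Module.End.one_apply, ← Complex.ofReal_mul,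
        Nat.cast_add, Nat.cast_one, Real.mul_self_sqrt (by positivity)]
      push_cast
      module
    · have e1 : N + Finsupp.single k 1 - Finsupp.single m 1 =
          N - Finsupp.single m 1 + Finsupp.single k 1 ∨ N m = 0 := by
        by_cases h : N m = 0
        · exact Or.inr h
        · left
          refine (tsub_add_eq_add_tsub ?_).symm
          rw [Finsupp.single_le_iff]
          omega
      have e2 : (N - Finsupp.single m 1 : BosonMode L a →₀ ℕ) k = N k := by simp [Ne.symm hmk]
      have e3 : (N + Finsupp.single k 1 : BosonMode L a →₀ ℕ) m = N m := by simp [hmk]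
      rw [if_neg hmk, LinearMap.zero_apply, add_zero, map_smul, bDag_bosonOp hL ha hM, e2, e3]
      rcases e1 with e1 | e1
      · rw [e1, smul_comm]
      · simp [e1]

theorem number_bosonOp (hL : 0 < L) (ha : 0 < a) (hM : L = M * a) {g : Core (Mode L a)}
    (hg : ∀ m, b m g = 0) (N : BosonMode L a →₀ ℕ) (m : BosonMode L a) :
    bDag m (b m (bosonOp N g)) = (N m : ℂ) • bosonOp N g := by
  rw [b_bosonOp hL ha hM hg, map_smul, bDag_bosonOp hL ha hM, smul_smul]
  exact sqrt_smul_bosonOp_sub_add N m g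

theorem zeroMode_bosonOp (hL : 0 < L) (ha : 0 < a) (hM : L = M * a) {g : Core (Mode L a)}
    {f : Flavor L a} {z : ℂ} (hg : zeroMode f g = z • g) (N : BosonMode L a →₀ ℕ) :
    zeroMode f (bosonOp N g) = z • bosonOp N g := by
  induction N using occupation_induction with
  | zero => simpa [bosonOp_zero] using hg
  | succ N m ih =>
    rw [bosonOp_succ hL ha hM, LinearMap.smul_apply, map_smul, Module.End.mul_apply,
      ← Module.End.mul_apply, zeroMode_mul_bDag hL ha hM, Module.End.mul_apply, ih, map_smul,
      smul_comm]

theorem inner_eq_zero_of_eigenvectors {ι : Type} {T : Module.End ℂ (Core ι)} (hT : IsAdj T T)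
    {v w : Core ι} {x y : ℝ} (hv : T v = (x : ℂ) • v) (hw : T w = (y : ℂ) • w) (h : x ≠ y) :
    inner ℂ (toSpace v) (toSpace w) = (0 : ℂ) := by
  have := hT v w
  rw [hv, hw, map_smul, map_smul, inner_smul_left, inner_smul_right, Complex.conj_ofReal] at this
  by_contra hc
  exact h (by exact_mod_cast mul_right_cancel₀ hc this)

/-- Different occupations are different eigenvalues of some self-adjoint `bDag m * b m`. Equal
occupations reduce to `g`, `g'` by induction, since `b m * bDag m` has eigenvalue `N m + 1`. -/
theorem inner_bosonOp (hL : 0 < L) (ha : 0 < a) (hM : L = M * a) {g g' : Core (Mode L a)}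
    (hg : ∀ m, b m g = 0) (hg' : ∀ m, b m g' = 0) (N N' : BosonMode L a →₀ ℕ) :
    inner ℂ (toSpace (bosonOp N g)) (toSpace (bosonOp N' g')) =
      open Classical in if N = N' then inner ℂ (toSpace g) (toSpace g') else 0 := by
  split_ifs with h
  · subst h
    induction N using occupation_induction with
    | zero => simp [bosonOp_zero]
    | succ N m ih =>
      have h0 : (0 : ℝ) < (N m : ℝ) + 1 := by positivity
      rw [← ih, bosonOp_succ hL ha hM, LinearMap.smul_apply, LinearMap.smul_apply,
        Module.End.mul_apply, Module.End.mul_apply, map_smul, map_smul, inner_smul_left,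
        inner_smul_right, isAdj_b hL ha m, ← Module.End.mul_apply (b m), b_mul_bDag hL ha hM,
        if_pos rfl, LinearMap.add_apply, Module.End.mul_apply, Module.End.one_apply,
        number_bosonOp hL ha hM hg', map_add, map_smul, inner_add_right, inner_smul_right,
        Complex.conj_ofReal, ← mul_assoc, ← Complex.ofReal_mul, div_mul_div_comm, one_mul,
        Real.mul_self_sqrt h0.le]
      have h1 : ((N m : ℂ) + 1) ≠ 0 := by exact_mod_cast h0.ne'
      push_cast
      field_simp
  · obtain ⟨m, hm⟩ : ∃ m, N m ≠ N' m := by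
      by_contra! hc
      exact h (Finsupp.ext hc)
    have hT : IsAdj (bDag m * b m) (bDag m * b m) := (isAdj_b hL ha m).symm.mul (isAdj_b hL ha m)
    refine inner_eq_zero_of_eigenvectors hT (x := N m) (y := N' m) ?_ ?_ (by exact_mod_cast hm)
    · rw [Module.End.mul_apply, number_bosonOp hL ha hM hg]
      push_cast
      rfl
    · rw [Module.End.mul_apply, number_bosonOp hL ha hM hg']
      push_cast
      rfl

theorem finite_flavor (ha : 0 < a) : Finite (Flavor L a) := by
  have := finite_lattice (L := L) ha
  refine Finite.of_injective (fun f : Flavor L a => (f.r, f.s, f.α, f.x)) fun f f' h => ?_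
  simp only [Prod.mk.injEq] at h
  exact Flavor.ext h.1 h.2.1 h.2.2.1 h.2.2.2

/-! ### Bases built on charged ground states -/

/-- The charged ground states: normalized vectors without bosons and with charges `r ν`. -/
structure IsGroundFamily (g : (Flavor L a → ℤ) → Core (Mode L a)) : Prop where
  b_eq_zero : ∀ ν m, b m (g ν) = 0
  zeroMode_eq : ∀ ν f, zeroMode f (g ν) = (((f.r : ℤ) : ℂ) * (ν f : ℂ)) • g ν
  norm_eq_one : ∀ ν, ‖toSpace (g ν)‖ = 1

namespace IsGroundFamily

variable {g : (Flavor L a → ℤ) → Core (Mode L a)}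

theorem orthonormal (hL : 0 < L) (ha : 0 < a) (hM : L = M * a) (hg : IsGroundFamily g) :
    Orthonormal ℂ fun q : (BosonMode L a →₀ ℕ) × (Flavor L a → ℤ) =>
      toSpace (bosonOp q.1 (g q.2)) := by
  classical
  rw [orthonormal_iff_ite]
  rintro ⟨N, ν⟩ ⟨N', ν'⟩
  rw [inner_bosonOp hL ha hM (hg.b_eq_zero ν) (hg.b_eq_zero ν')]
  by_cases hN : N = N'
  · by_cases hν : ν = ν'
    · rw [if_pos hN, hν, if_pos (by rw [hN]), inner_self_eq_norm_sq_to_K, hg.norm_eq_one]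
      simp
    · rw [if_pos hN, if_neg (by simp [hν])]
      obtain ⟨f, hf⟩ : ∃ f, ν f ≠ ν' f := by
        by_contra! hc
        exact hν (funext hc)
      refine inner_eq_zero_of_eigenvectors (isAdj_zeroMode hL ha hM f)
        (x := ((f.r : ℤ) : ℝ) * ν f) (y := ((f.r : ℤ) : ℝ) * ν' f) ?_ ?_ ?_
      · rw [hg.zeroMode_eq]
        push_cast
        rfl
      · rw [hg.zeroMode_eq]
        push_cast
        rfl
      · intro h
        have hr : ((f.r : ℤ) : ℝ) ≠ 0 := left_ne_zero_of_mul_eq_one (units_cast_mul_self f.r)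
        exact hf (by exact_mod_cast mul_left_cancel₀ hr h)
  · rw [if_neg hN, if_neg (by simp [hN])]

theorem span_eq_top (hL : 0 < L) (ha : 0 < a) (hM : L = M * a) (hg : IsGroundFamily g) :
    Submodule.span ℂ (Set.range fun q : (BosonMode L a →₀ ℕ) × (Flavor L a → ℤ) =>
      bosonOp q.1 (g q.2)) = ⊤ := by
  have := finite_flavor (L := L) ha
  have := Fintype.ofFinite (Flavor L a)
  set W := Submodule.span ℂ (Set.range fun q : (BosonMode L a →₀ ℕ) × (Flavor L a → ℤ) =>
      bosonOp q.1 (g q.2)) with hW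
  have hb : ∀ m, ∀ v ∈ W, bDag m v ∈ W := fun m v hv => by
    induction hv using Submodule.span_induction with
    | mem v h =>
      obtain ⟨q, rfl⟩ := h
      dsimp only
      rw [bDag_bosonOp hL ha hM]
      exact W.smul_mem _ (Submodule.subset_span ⟨(q.1 + Finsupp.single m 1, q.2), rfl⟩)
    | zero => simp
    | add v w _ _ hv hw => rw [map_add]; exact W.add_mem hv hw
    | smul z v _ hv => rw [map_smul]; exact W.smul_mem z hv
  refine eq_top_of_rho_invariant (levels a hL) W (fun f n hn v hv => ?_) fun S μ hS => ?_
  · obtain ⟨s, z, -, h⟩ := exists_rho_eq_sum_b hL ha hM f hn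
    rw [h, LinearMap.sum_apply]
    exact W.sum_mem fun m _ => W.smul_mem _ (hb m v hv)
  -- Since `r² = 1`, this choice makes the charges `r ν` equal to the prescribed Fermi levels `μ`.
  · set ν : Flavor L a → ℤ := fun f => f.r * μ f with hν
    have h1 : g ν ∈ W := Submodule.subset_span ⟨(0, ν), by simp [bosonOp_zero]⟩
    -- The abstract ground state must be a multiple of the Fermi sea; the multiple is nonzero by
    -- normalization, so the sea itself lies in `W`.
    have h2 : g ν = g ν S • ket S := by
      refine eq_smul_ket_of_rho_eq_zero (levels a hL) (ν := μ) (fun f n hn => ?_) (fun f => ?_) hS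
      · obtain ⟨s, z, h, -⟩ := exists_rho_eq_sum_b hL ha hM f hn
        rw [h, LinearMap.sum_apply]
        exact Finset.sum_eq_zero fun m _ => by simp [hg.b_eq_zero]
      · rw [← zeroMode_eq_rho hL ha hM, hg.zeroMode_eq, hν]
        congr 1
        have h0 : ((f.r : ℤ) : ℤ) * (f.r : ℤ) = 1 := by
          rw [← Units.val_mul, Int.units_mul_self, Units.val_one]
        have h0' : ((f.r : ℤ) : ℂ) * ((f.r : ℤ) : ℂ) = 1 := by exact_mod_cast h0
        push_cast
        rw [← mul_assoc, h0', one_mul]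
    have h3 : g ν S ≠ 0 := fun h0 => by
      have := hg.norm_eq_one ν
      rw [h2, h0] at this
      simp at this
    rw [h2] at h1
    exact (W.smul_mem_iff h3).1 h1

end IsGroundFamily

/-- A vector orthogonal to the core has all its coordinates equal to zero. -/
theorem dense_of_span_eq_top {ι : Type} {κ : Type*} {v : κ → Core ι}
    (h : Submodule.span ℂ (Set.range v) = ⊤) :
    (Submodule.span ℂ (Set.range fun i => toSpace (v i))).topologicalClosure = ⊤ := by
  have h1 : Submodule.span ℂ (Set.range fun i => toSpace (v i)) =
      LinearMap.range (toSpace : Core ι →ₗ[ℂ] Space ι) := by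
    rw [LinearMap.range_eq_map, ← h, Submodule.map_span, ← Set.range_comp]
    rfl
  rw [h1, Submodule.topologicalClosure_eq_top_iff, Submodule.eq_bot_iff]
  intro x hx
  ext S
  have := hx (toSpace (ket S)) ⟨_, rfl⟩
  classical
  simp only [toSpace, ket, Finsupp.linearCombination_single, one_smul] at this
  rw [lp.inner_single_left] at this
  simpa using this

end

end Nodal

/-! ### Products of Klein factors -/

namespace Nodal
open Fock

section

variable {L a : ℝ} {M : ℕ}

/-- With `z = 0` this serves the bosons, with `z = r` or `0` the charges; negative powers shift the
charge in the opposite direction. -/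
theorem apply_zpow_of_intertwine {V : Type*} [AddCommGroup V] [Module ℂ V] (φ : V ≃ₗ[ℂ] V)
    (T : V →ₗ[ℂ] V) (z : ℂ) (h : ∀ v, T (φ v) = φ (T v) + z • φ v) (k : ℤ) (v : V) :
    T ((φ ^ k) v) = (φ ^ k) (T v) + (k * z) • (φ ^ k) v := by
  induction k using Int.induction_on generalizing v with
  | zero => simp
  | succ k ih =>
    rw [zpow_add_one, LinearEquiv.mul_apply, LinearEquiv.mul_apply, ih, h, map_add, map_smul]
    push_cast
    module
  | pred k ih =>
    have h' : T (φ⁻¹ v) = φ⁻¹ (T v) + (-z) • φ⁻¹ v := by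
      have h1 := h (φ⁻¹ v)
      rw [← LinearEquiv.mul_apply, mul_inv_cancel, LinearEquiv.coe_one, id] at h1
      have h2 := congrArg (φ⁻¹ : V ≃ₗ[ℂ] V) h1
      rw [map_add, map_smul, ← LinearEquiv.mul_apply φ⁻¹ φ, inv_mul_cancel] at h2
      have h3 : (φ⁻¹ : V ≃ₗ[ℂ] V) v = φ⁻¹ v := rfl
      rw [h2]
      simp
    rw [zpow_sub_one, LinearEquiv.mul_apply, LinearEquiv.mul_apply, ih, h', map_add, map_smul]
    push_cast
    module

theorem norm_toSpace_onCore {ι : Type} (U : CoreUnitary ι) (v : Core ι) :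
    ‖toSpace (U.onCore v)‖ = ‖toSpace v‖ := by
  rw [← U.op_toSpace]
  exact ContinuousLinearMap.norm_map_of_mem_unitary U.op.2 _

theorem norm_toSpace_onCore_zpow {ι : Type} (U : CoreUnitary ι) (k : ℤ) (v : Core ι) :
    ‖toSpace ((U.onCore ^ k) v)‖ = ‖toSpace v‖ := by
  induction k using Int.induction_on generalizing v with
  | zero => simp
  | succ k ih => rw [zpow_add_one, LinearEquiv.mul_apply, ih, norm_toSpace_onCore]
  | pred k ih =>
    rw [zpow_sub_one, LinearEquiv.mul_apply, ih, ← norm_toSpace_onCore U, ← LinearEquiv.mul_apply,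
      mul_inv_cancel]
    rfl

theorem b_vacuum (hL : 0 < L) (ha : 0 < a) (hM : L = M * a) (m : BosonMode L a) :
    b m vacuum = 0 := by
  have := finite_lattice (L := L) ha
  have := Fintype.ofFinite (lattice L a)
  rw [b_eq hL ha hM, LinearMap.sum_apply]
  exact Finset.sum_eq_zero fun x _ => by
    rw [LinearMap.smul_apply, rho_vacuum _ m.index_pos.le, smul_zero]

theorem zeroMode_vacuum (hL : 0 < L) (ha : 0 < a) (hM : L = M * a) (f : Flavor L a) :
    zeroMode f vacuum = 0 := by
  rw [zeroMode_eq_rho hL ha hM, rho_vacuum _ le_rfl]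

theorem norm_toSpace_ket {ι : Type} (S : Finset ι) : ‖toSpace (ket S)‖ = 1 := by
  rw [norm_eq_sqrt_re_inner (𝕜 := ℂ), inner_ket_left]
  simp [ket]

namespace IsKleinFamily

variable {R : Flavor L a → CoreUnitary (Mode L a)}

theorem zeroMode_onCore [DecidableEq (Flavor L a)] (hR : IsKleinFamily R) (f f' : Flavor L a)
    (v : Core (Mode L a)) : zeroMode f ((R f').onCore v) = (R f').onCore (zeroMode f v) +
      (if f = f' then ((f.r : ℤ) : ℂ) else 0) • (R f').onCore v := by
  have h : zeroMode f ((R f').toEnd v) - (R f').toEnd (zeroMode f v) = _ :=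
    congrArg (fun T => T v) (hR.zeroMode_commutator f f')
  rw [sub_eq_iff_eq_add'] at h
  refine h.trans ?_
  congr 1
  split_ifs with h
  · subst h; rfl
  · simp

/-- Each factor preserves the norm and the absence of bosons and changes the charge of its own
flavor only. A list without repetitions thus assigns each charge once, in whatever order. -/
theorem klein_product (hL : 0 < L) (ha : 0 < a) (hM : L = M * a) [DecidableEq (Flavor L a)]
    (hR : IsKleinFamily R) (ν : Flavor L a → ℤ) {l : List (Flavor L a)} (hl : l.Nodup) :
    (∀ m, b m ((l.map fun f => (R f).onCore ^ ν f).prod vacuum) = 0) ∧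
    (∀ f, zeroMode f ((l.map fun f => (R f).onCore ^ ν f).prod vacuum) =
      (if f ∈ l then ((f.r : ℤ) : ℂ) * (ν f : ℂ) else 0) •
        (l.map fun f => (R f).onCore ^ ν f).prod vacuum) ∧
    ‖toSpace ((l.map fun f => (R f).onCore ^ ν f).prod vacuum)‖ = 1 := by
  induction l with
  | nil =>
    refine ⟨fun m => ?_, fun f => ?_, ?_⟩
    · simpa using b_vacuum hL ha hM m
    · simpa using zeroMode_vacuum hL ha hM f
    · exact norm_toSpace_ket ∅
  | cons k l ih =>
    rw [List.nodup_cons] at hl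
    obtain ⟨h1, h2, h3⟩ := ih hl.2
    rw [List.map_cons, List.prod_cons]
    simp only [LinearEquiv.mul_apply]
    generalize (l.map fun f => (R f).onCore ^ ν f).prod vacuum = w at h1 h2 h3
    refine ⟨fun m => ?_, fun f => ?_, ?_⟩
    · have hb : ∀ v, b m ((R k).onCore v) = (R k).onCore (b m v) + (0 : ℂ) • (R k).onCore v :=
        fun v => by
          rw [zero_smul, add_zero]
          exact congrArg (fun T => T v) (hR.commute_b k m)
      rw [apply_zpow_of_intertwine _ _ _ hb, h1]
      simp
    · rw [apply_zpow_of_intertwine _ _ _ (hR.zeroMode_onCore f k), h2, map_smul, ← add_smul]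
      congr 1
      by_cases hf : f = k
      · subst hf
        rw [if_neg hl.1, if_pos rfl, if_pos List.mem_cons_self]
        ring
      · rw [if_neg hf]
        simp [hf]
    · rw [norm_toSpace_onCore_zpow, h3]

theorem isGroundFamily (hL : 0 < L) (ha : 0 < a) (hM : L = M * a) (hR : IsKleinFamily R)
    {o : List (Flavor L a)} (ho : o.Nodup) (hmem : ∀ f, f ∈ o) :
    IsGroundFamily fun ν => (o.map fun f => (R f).onCore ^ ν f).prod vacuum := by
  classical
  refine ⟨fun ν => (hR.klein_product hL ha hM ν ho).1, fun ν f => ?_,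
    fun ν => (hR.klein_product hL ha hM ν ho).2.2⟩
  have := (hR.klein_product hL ha hM ν ho).2.1 f
  rwa [if_pos (hmem f)] at this

end IsKleinFamily

/-- The boson occupation numbers of an element of `occupations L a`. -/
def occupationFinsupp (hL : 0 < L) (q : occupations L a) : BosonMode L a →₀ ℕ :=
  Finsupp.ofSupportFinite q.1.1 (finite_support_occupations hL q)

/-- The elements of `occupations L a`. -/
def occupationsEquiv (hL : 0 < L) (ha : 0 < a) :
    occupations L a ≃ (BosonMode L a →₀ ℕ) × (Flavor L a → ℤ) :=
  Equiv.ofBijective (fun q => (occupationFinsupp hL q, q.1.2)) (by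
    constructor
    · rintro q q' h
      rw [Prod.mk.injEq] at h
      exact Subtype.ext (Prod.ext (congrArg DFunLike.coe h.1) h.2)
    · rintro ⟨N, ν⟩
      have := finite_flavor (L := L) ha
      -- There are finitely many flavors, so the condition on `ν` is empty; finite support of `N`
      -- settles the other one.
      refine ⟨⟨(N, ν), Summable.of_finite, ?_⟩, Prod.ext (Finsupp.ext fun m => rfl) rfl⟩
      refine summable_of_hasFiniteSupport (N.hasFiniteSupport.subset fun m hm => ?_)
      exact Nat.cast_ne_zero.1 (right_ne_zero_of_mul hm))

theorem orthonormal_η (hL : 0 < L) (ha : 0 < a) (hM : L = M * a)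
    {R : Flavor L a → CoreUnitary (Mode L a)} (hR : IsKleinFamily R) {o : List (Flavor L a)}
    (ho : o.Nodup) (hmem : ∀ f, f ∈ o) :
    Orthonormal ℂ fun q : occupations L a => toSpace (η R o q.1.1 q.1.2) :=
  ((hR.isGroundFamily hL ha hM ho hmem).orthonormal hL ha hM).comp (occupationsEquiv hL ha)
    (occupationsEquiv hL ha).injective

theorem dense_span_η (hL : 0 < L) (ha : 0 < a) (hM : L = M * a)
    {R : Flavor L a → CoreUnitary (Mode L a)} (hR : IsKleinFamily R) {o : List (Flavor L a)}
    (ho : o.Nodup) (hmem : ∀ f, f ∈ o) : (Submodule.span ℂ (Set.range fun q : occupations L a =>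
      toSpace (η R o q.1.1 q.1.2))).topologicalClosure = ⊤ := by
  refine dense_of_span_eq_top (v := fun q : occupations L a => η R o q.1.1 q.1.2) ?_
  rw [← (hR.isGroundFamily hL ha hM ho hmem).span_eq_top hL ha hM,
    ← (occupationsEquiv hL ha).surjective.range_comp]
  rfl

end

end Nodal

/-! ### Unitary operators from orthonormal bases of the core -/

namespace Fock

/-- A downward hop finds its target `j` filled if `j < ν`, and its source `j + n` empty otherwise.
-/
theorem rho_ket_eq_zero_of_filled_iff {F ι : Type} [LinearOrder ι] (e : F × ℤ ≃ ι) {S : Finset ι}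
    {f : F} {ν : ℤ} (h : ∀ j, Filled e S f j ↔ j < ν) {n : ℤ} (hn : 0 < n) :
    rho e f n (ket S) = 0 := by
  rw [rho_apply_of_pos e f hn.ne']
  refine finsum_eq_zero_of_forall_eq_zero fun j => ?_
  by_cases hj : j < ν
  · rw [← neg_eq_iff_eq_neg.2 (fermi_fermiDag_apply e f (by omega : j + n ≠ j) _),
      fermiDag_ket ((h j).2 hj)]
    simp
  · rw [fermi_ket (by rw [h]; omega), map_zero]

section

variable {ι : Type} {κ : Type*}

/-- The Hilbert basis obtained from an orthonormal basis of the core. -/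
def hilbertBasisOfCore (E : Module.Basis κ ℂ (Core ι)) (h : Orthonormal ℂ fun i => toSpace (E i)) :
    HilbertBasis κ ℂ (Space ι) :=
  HilbertBasis.mk h (Nodal.dense_of_span_eq_top E.span_eq).ge

theorem hilbertBasisOfCore_apply (E : Module.Basis κ ℂ (Core ι))
    (h : Orthonormal ℂ fun i => toSpace (E i)) (i : κ) :
    hilbertBasisOfCore E h i = toSpace (E i) := by
  rw [hilbertBasisOfCore, HilbertBasis.coe_mk]

/-- The unitary operator that maps one orthonormal basis of the core to another. -/
def unitaryOfBases (E E' : Module.Basis κ ℂ (Core ι)) (h : Orthonormal ℂ fun i => toSpace (E i))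
    (h' : Orthonormal ℂ fun i => toSpace (E' i)) : CoreUnitary ι where
  op := Unitary.linearIsometryEquiv.symm
    ((hilbertBasisOfCore E h).repr.trans (hilbertBasisOfCore E' h').repr.symm)
  onCore := E.equiv E' (Equiv.refl κ)
  op_toSpace := by
    classical
    set U := (hilbertBasisOfCore E h).repr.trans (hilbertBasisOfCore E' h').repr.symm
    have key : U.toLinearEquiv.toLinearMap ∘ₗ toSpace =
        toSpace ∘ₗ (E.equiv E' (Equiv.refl κ)).toLinearMap := by
      refine E.ext fun i => ?_
      simp only [LinearMap.comp_apply, LinearEquiv.coe_coe, Module.Basis.equiv_apply,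
        Equiv.refl_apply]
      change U (toSpace (E i)) = _
      rw [← hilbertBasisOfCore_apply E h, ← hilbertBasisOfCore_apply E' h']
      simp only [U, LinearIsometryEquiv.trans_apply, HilbertBasis.repr_self,
        HilbertBasis.repr_symm_single]
    exact fun v => congrArg (fun T => T v) key

theorem unitaryOfBases_onCore (E E' : Module.Basis κ ℂ (Core ι))
    (h : Orthonormal ℂ fun i => toSpace (E i)) (h' : Orthonormal ℂ fun i => toSpace (E' i)) (i : κ) :
    (unitaryOfBases E E' h h').onCore (E i) = E' i := by
  simp [unitaryOfBases]

theorem star_op_toSpace (U : CoreUnitary ι) (v : Core ι) :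
    star (U.op : Space ι →L[ℂ] Space ι) (toSpace v) = toSpace (U.onCore.symm v) := by
  have h1 : (U.op : Space ι →L[ℂ] Space ι) (toSpace (U.onCore.symm v)) = toSpace v := by
    rw [U.op_toSpace, LinearEquiv.apply_symm_apply]
  rw [← h1]
  exact congrArg (fun T : Space ι →L[ℂ] Space ι => T (toSpace (U.onCore.symm v)))
    (Unitary.coe_star_mul_self U.op)

theorem ext_of_core_basis (E : Module.Basis κ ℂ (Core ι)) {A B : Space ι →L[ℂ] Space ι}
    (h : ∀ i, A (toSpace (E i)) = B (toSpace (E i))) : A = B := by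
  refine ContinuousLinearMap.ext_on (s := Set.range fun i => toSpace (E i)) ?_ ?_
  · rw [dense_iff_closure_eq, ← Submodule.topologicalClosure_coe, Nodal.dense_of_span_eq_top E.span_eq]
    rfl
  · rintro _ ⟨i, rfl⟩
    exact h i

end

end Fock

/-! ### Existence of Klein factors -/

namespace Nodal
open Fock

section

variable {L a : ℝ} {M : ℕ}

theorem exists_groundFamily (hL : 0 < L) (ha : 0 < a) (hM : L = M * a) :
    ∃ g : (Flavor L a → ℤ) → Core (Mode L a), IsGroundFamily g := by
  have := finite_lattice (L := L) ha
  have := Fintype.ofFinite (lattice L a)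
  have := finite_flavor (L := L) ha
  choose S hS using fun ν : Flavor L a → ℤ =>
    exists_filled_iff_lt (levels a hL) fun f => (f.r : ℤ) * ν f
  refine ⟨fun ν => ket (S ν), fun ν m => ?_, fun ν f => ?_, fun ν => norm_toSpace_ket _⟩
  · rw [b_eq hL ha hM, LinearMap.sum_apply]
    refine Finset.sum_eq_zero fun x _ => ?_
    rw [LinearMap.smul_apply, rho_ket_eq_zero_of_filled_iff _ (hS ν _) m.index_pos, smul_zero]
  · rw [zeroMode_eq_rho hL ha hM, rho_zero_ket _ (hS ν f)]
    push_cast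
    rfl

/-- The basis of the core consisting of the states with definite occupation numbers. -/
def occupationBasis (hL : 0 < L) (ha : 0 < a) (hM : L = M * a)
    {g : (Flavor L a → ℤ) → Core (Mode L a)} (hg : IsGroundFamily g) :
    Module.Basis ((BosonMode L a →₀ ℕ) × (Flavor L a → ℤ)) ℂ (Core (Mode L a)) :=
  Module.Basis.mk (LinearIndependent.of_comp toSpace (hg.orthonormal hL ha hM).linearIndependent)
    (hg.span_eq_top hL ha hM).ge

theorem occupationBasis_apply (hL : 0 < L) (ha : 0 < a) (hM : L = M * a)
    {g : (Flavor L a → ℤ) → Core (Mode L a)} (hg : IsGroundFamily g)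
    (q : (BosonMode L a →₀ ℕ) × (Flavor L a → ℤ)) :
    occupationBasis hL ha hM hg q = bosonOp q.1 (g q.2) := by
  rw [occupationBasis, Module.Basis.mk_apply]

section KleinSign
variable {Φ : Type*} [Fintype Φ] [DecidableEq Φ] {n : ℕ}

/-- The sign that makes the Klein factors of different flavors anticommute. -/
def kleinSign (o : Φ ≃ Fin n) (f : Φ) (ν : Φ → ℤ) : ℂ :=
  (-1) ^ ∑ g with o g < o f, ν g

theorem kleinSign_mul_self (o : Φ ≃ Fin n) (f : Φ) (ν : Φ → ℤ) :
    kleinSign o f ν * kleinSign o f ν = 1 := by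
  rw [kleinSign, ← mul_zpow]
  simp

theorem kleinSign_ne_zero (o : Φ ≃ Fin n) (f : Φ) (ν : Φ → ℤ) : kleinSign o f ν ≠ 0 :=
  left_ne_zero_of_mul_eq_one (kleinSign_mul_self o f ν)

theorem conj_kleinSign (o : Φ ≃ Fin n) (f : Φ) (ν : Φ → ℤ) :
    (starRingEnd ℂ) (kleinSign o f ν) = kleinSign o f ν := by
  simp [kleinSign, map_zpow₀]

/-- The sign flips exactly when the raised flavor precedes `f`; this asymmetry produces the
anticommutation. -/
theorem kleinSign_add_single (o : Φ ≃ Fin n) (f g : Φ) (ν : Φ → ℤ) :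
    kleinSign o f (ν + Pi.single g 1) = (if o g < o f then -1 else 1) * kleinSign o f ν := by
  unfold kleinSign
  simp only [Pi.add_apply, Finset.sum_add_distrib]
  rw [zpow_add₀ (by norm_num), mul_comm]
  congr 1
  simp only [Finset.sum_pi_single', Finset.mem_filter, Finset.mem_univ, true_and]
  split_ifs <;> simp

theorem kleinSign_sub_single (o : Φ ≃ Fin n) (f g : Φ) (ν : Φ → ℤ) :
    kleinSign o f (ν - Pi.single g 1) = (if o g < o f then -1 else 1) * kleinSign o f ν := by
  have h := kleinSign_add_single o f g (ν - Pi.single g 1)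
  rw [sub_add_cancel] at h
  rw [h, ← mul_assoc]
  split_ifs <;> simp

end KleinSign

theorem exists_isKleinFamily (hL : 0 < L) (ha : 0 < a) (hM : L = M * a) :
    ∃ R : Flavor L a → CoreUnitary (Mode L a), IsKleinFamily R := by
  classical
  have := finite_flavor (L := L) ha
  have := Fintype.ofFinite (Flavor L a)
  obtain ⟨g, hg⟩ := exists_groundFamily hL ha hM
  obtain ⟨n, ⟨o⟩⟩ := Finite.exists_equiv_fin (Flavor L a)
  set E := occupationBasis hL ha hM hg with hE
  have hEq : ∀ q, E q = bosonOp q.1 (g q.2) := occupationBasis_apply hL ha hM hg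
  have hortho : Orthonormal ℂ fun q => toSpace (E q) := by
    simpa only [hEq] using hg.orthonormal hL ha hM
  set shift : Flavor L a → ((BosonMode L a →₀ ℕ) × (Flavor L a → ℤ)) ≃
      ((BosonMode L a →₀ ℕ) × (Flavor L a → ℤ)) := fun f =>
    (Equiv.refl _).prodCongr (Equiv.addRight (Pi.single f 1)) with hshift
  have hsh : ∀ f N ν, shift f (N, ν) = (N, ν + Pi.single f 1) := fun f N ν => rfl
  -- The image of `E` under the intended `R f`: charge of `f` raised by one, with sign. Being
  -- orthonormal again, it defines a unitary operator.
  set E' : Flavor L a → Module.Basis ((BosonMode L a →₀ ℕ) × (Flavor L a → ℤ)) ℂ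
      (Core (Mode L a)) := fun f => (E.reindex (shift f).symm).isUnitSMul
    (w := fun q => kleinSign o f q.2) fun q => (kleinSign_ne_zero o f q.2).isUnit with hE'
  have hE'q : ∀ f N ν, E' f (N, ν) = kleinSign o f ν • E (N, ν + Pi.single f 1) := fun f N ν => by
    simp [hE', Module.Basis.isUnitSMul_apply, hsh]
  have hortho' : ∀ f, Orthonormal ℂ fun q => toSpace (E' f q) := fun f => by
    rw [orthonormal_iff_ite] at hortho ⊢
    rintro ⟨N, ν⟩ ⟨N', ν'⟩
    rw [hE'q, hE'q, map_smul, map_smul, inner_smul_left, inner_smul_right, hortho, conj_kleinSign,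
      ← hsh, ← hsh, if_congr (shift f).apply_eq_iff_eq rfl rfl]
    split_ifs with h
    · rw [Prod.mk.injEq] at h
      rw [h.2, mul_one, kleinSign_mul_self]
    · simp
  set R : Flavor L a → CoreUnitary (Mode L a) := fun f =>
    unitaryOfBases E (E' f) hortho (hortho' f) with hR
  have hRE : ∀ f N ν, (R f).onCore (E (N, ν)) = kleinSign o f ν • E (N, ν + Pi.single f 1) :=
    fun f N ν => by rw [hR, unitaryOfBases_onCore, hE'q]
  have hRE' : ∀ f N ν, (R f).onCore.symm (E (N, ν)) =
      kleinSign o f ν • E (N, ν - Pi.single f 1) := fun f N ν => by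
    rw [LinearEquiv.symm_apply_eq, map_smul, hRE, kleinSign_sub_single, if_neg (lt_irrefl _),
      one_mul, smul_smul, kleinSign_mul_self, one_smul, sub_add_cancel]
  have hb : ∀ m N ν, b m (E (N, ν)) = ((√(N m : ℝ) : ℝ) : ℂ) • E (N - Finsupp.single m 1, ν) :=
    fun m N ν => by rw [hEq, hEq, b_bosonOp hL ha hM (hg.b_eq_zero ν)]
  have hbd : ∀ m N ν, bDag m (E (N, ν)) =
      ((√((N m : ℝ) + 1) : ℝ) : ℂ) • E (N + Finsupp.single m 1, ν) :=
    fun m N ν => by rw [hEq, hEq, bDag_bosonOp hL ha hM]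
  have hz : ∀ f N ν, zeroMode f (E (N, ν)) = (((f.r : ℤ) : ℂ) * (ν f : ℂ)) • E (N, ν) :=
    fun f N ν => by rw [hEq, zeroMode_bosonOp hL ha hM (hg.zeroMode_eq ν f)]
  refine ⟨R, fun f m => ?_, fun f m => ?_, fun f f' => ?_, fun f f' => ?_⟩
  -- Boson operators change only `N`, while the shift and its sign involve only `ν`.
  · refine E.ext fun q => ?_
    change b m ((R f).onCore (E (q.1, q.2))) = (R f).onCore (b m (E (q.1, q.2)))
    rw [hRE, map_smul, hb, hb, map_smul, hRE, smul_comm]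
  · refine E.ext fun q => ?_
    change bDag m ((R f).onCore (E (q.1, q.2))) = (R f).onCore (bDag m (E (q.1, q.2)))
    rw [hRE, map_smul, hbd, hbd, map_smul, hRE, smul_comm]
  · refine E.ext fun q => ?_
    change zeroMode f ((R f').onCore (E (q.1, q.2))) - (R f').onCore (zeroMode f (E (q.1, q.2))) = _
    rw [hRE, map_smul, hz, hz, map_smul, hRE]
    by_cases h : f = f'
    · subst h
      rw [if_pos rfl]
      change _ = ((f.r : ℤ) : ℂ) • (R f).onCore (E (q.1, q.2))
      rw [hRE, Pi.add_apply, Pi.single_eq_same]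
      push_cast
      module
    · rw [if_neg h, Pi.add_apply, Pi.single_eq_of_ne h, add_zero, smul_comm, sub_self]
      rfl
  · refine ext_of_core_basis E fun q => ?_
    change ((R f).op : Space (Mode L a) →L[ℂ] Space (Mode L a)) (star ((R f').op : Space (Mode L a) →L[ℂ] Space (Mode L a)) (toSpace (E (q.1, q.2)))) +
      star ((R f').op : Space (Mode L a) →L[ℂ] Space (Mode L a)) (((R f).op : Space (Mode L a) →L[ℂ] Space (Mode L a)) (toSpace (E (q.1, q.2)))) = _
    rw [star_op_toSpace, (R f).op_toSpace, (R f).op_toSpace, star_op_toSpace, ← map_add]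
    by_cases h : f = f'
    · subst h
      rw [if_pos rfl, LinearEquiv.apply_symm_apply, LinearEquiv.symm_apply_apply, map_add]
      exact congrArg (fun T : Space (Mode L a) →L[ℂ] Space (Mode L a) => T (toSpace (E q)))
        one_add_one_eq_two
    · rw [if_neg h, hRE', hRE, map_smul, map_smul, hRE, hRE', smul_smul, smul_smul,
        kleinSign_sub_single, kleinSign_add_single, sub_add_eq_add_sub, ← add_smul]
      have ho : o f ≠ o f' := fun hh => h (o.injective hh)
      -- Exactly one of `f`, `f'` precedes the other, so exactly one of the two terms picks up the
      -- extra minus sign.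
      have : kleinSign o f' q.2 * ((if o f' < o f then -1 else 1) * kleinSign o f q.2) +
          kleinSign o f q.2 * ((if o f < o f' then -1 else 1) * kleinSign o f' q.2) = 0 := by
        rcases lt_or_gt_of_ne ho with h1 | h1
        · rw [if_neg h1.not_gt, if_pos h1]; ring
        · rw [if_pos h1, if_neg h1.not_gt]; ring
      rw [this, zero_smul, map_zero]
      rfl

end

end Nodal

end

theorem lemmaC2 (L a : ℝ) (hL : 0 < L) (ha : 0 < a) (hLa : ∃ M : ℕ, L = M * a) :
    -- (a) existence of Klein factors
    (∃ R : Nodal.Flavor L a → Fock.CoreUnitary (Nodal.Mode L a), Nodal.IsKleinFamily R) ∧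
    -- (b), (c) for every family of Klein factors and every ordering `o` of their product
    ∀ R : Nodal.Flavor L a → Fock.CoreUnitary (Nodal.Mode L a), Nodal.IsKleinFamily R →
    ∀ o : List (Nodal.Flavor L a), o.Nodup → (∀ f, f ∈ o) →
      (Orthonormal ℂ (fun q : Nodal.occupations L a => Fock.toSpace (Nodal.η R o q.1.1 q.1.2)) ∧
        (Submodule.span ℂ (Set.range fun q : Nodal.occupations L a =>
          Fock.toSpace (Nodal.η R o q.1.1 q.1.2))).topologicalClosure = ⊤) ∧
      ∀ q : Nodal.occupations L a,
        (∀ f : Nodal.Flavor L a, Nodal.zeroMode f (Nodal.η R o q.1.1 q.1.2) =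
          (((f.r : ℤ) : ℂ) * (q.1.2 f : ℂ)) • Nodal.η R o q.1.1 q.1.2) ∧
        ∀ m : Nodal.BosonMode L a, Nodal.bDag m (Nodal.b m (Nodal.η R o q.1.1 q.1.2)) =
          (q.1.1 m : ℂ) • Nodal.η R o q.1.1 q.1.2 := by
  obtain ⟨M, hM⟩ := hLa
  refine ⟨Nodal.exists_isKleinFamily hL ha hM, fun R hR o ho hmem =>
    ⟨⟨Nodal.orthonormal_η hL ha hM hR ho hmem, Nodal.dense_span_η hL ha hM hR ho hmem⟩,
      fun q => ?_⟩⟩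
  have hg := hR.isGroundFamily hL ha hM ho hmem
  -- The state `η` is by definition `bosonOp` of its finitely supported occupation numbers, applied
  -- to the Klein product.
  exact ⟨fun f => Nodal.zeroMode_bosonOp hL ha hM (hg.zeroMode_eq q.1.2 f)
      (Nodal.occupationFinsupp hL q),
    fun m => Nodal.number_bosonOp hL ha hM (hg.b_eq_zero q.1.2) (Nodal.occupationFinsupp hL q) m⟩
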